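/- Let $d\ge 2$ and $k\ge 1$ be integers, and let $f:\mathbb{R}^d\to[0,\infty)$ be a bounded measurable probability density. For each $n$ let $\mathcal{X}_n$ be a set of $n$ points drawn independently from the distribution with density $f$. For $r>0$ let $VR(\mathcal{X}_n;r)$ be the random Vietoris–Rips complex, i.e. the clique complex of the graph on $\mathcal{X}_n$ in which distinct points $x,y$ are joined by an edge whenever $|x-y|<2r$, and let $\beta_k=\dim_{\mathbb{Q}} H_k(VR(\mathcal{X}_n;r_n);\mathbb{Q})$. There is a constant $c>0$, depending only on $d$, $k$ and $f$, such that the following holds for every $\epsilon>0$ and every sequence $r_n>0$ with $r_n=O(n^{-1/d-\epsilon})$. 1. If $n^{2k+2}r_n^{d(2k+1)}\to 0$ as $n\to\infty$, then $\beta_k=0$ asymptotically almost surely, i.e. $\mathbb{P}[\beta_k=0]\to 1$. 2. If $n^{2k+2}r_n^{d(2k+1)}\to\alpha\in(0,\infty)$ as $n\to\infty$, then for all sufficiently large $n$ $$d_{TV}(\beta_k,Y)\le c\,\alpha\, n r_n^d,$$ where $Y$ is a Poisson random variable with $\mathbb{E}[Y]=\mathbb{E}[\beta_k]$, and $d_{TV}(X,Y)=\sup_g|\mathbb{E}[g(X)]-\mathbb{E}[g(Y)]|$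 with the supremum over all continuous functions $g$ bounded by one in absolute value. 3. If $n^{2k+2}r_n^{d(2k+1)}\to\infty$ as $n\to\infty$, then $$\frac{\beta_k-\mathbb{E}[\beta_k]}{\sqrt{\mathrm{Var}[\beta_k]}}\Rightarrow\mathcal{N}(0,1),$$ i.e. the normalized Betti number converges in distribution to a standard normal variable. -/

import Mathlib

open MeasureTheory ProbabilityTheory Filter Asymptotics
open scoped Topology NNReal ENNReal

noncomputable section

namespace RandomRips

/-- The clique complex of a graph `G`: its faces are the nonempty finite sets of pairwise adjacent
vertices. -/
def cliqueComplex {V : Type*} (G : SimpleGraph V) : AbstractSimplicialComplex V where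
  faces := {s | s.Nonempty ∧ G.IsClique (s : Set V)}
  isRelLowerSet_faces := fun _ hs =>
    ⟨hs.1, fun _ hts ht => ⟨ht, hs.2.subset (Finset.coe_subset.2 hts)⟩⟩
  singleton_mem := fun v => ⟨Finset.singleton_nonempty v, by simp⟩

section Homology

variable {V : Type*} [LinearOrder V] (Δ : AbstractSimplicialComplex V)

/-- The `k`-dimensional faces: those with `k + 1` vertices. -/
abbrev Face (k : ℕ) : Type _ := {s : Finset V // s ∈ Δ.faces ∧ s.card = k + 1}

/-- Simplicial `k`-chains with rational coefficients. Every face is oriented by the order of its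
vertices. -/
abbrev Chain (k : ℕ) : Type _ := Face Δ k →₀ ℚ

/-- The facet of a face `s` obtained by deleting the vertex `v`. -/
def Face.facet {k : ℕ} (s : Face Δ (k + 1)) (v : s.1) : Face Δ k :=
  ⟨s.1.erase v.1, by
    have hc : (s.1.erase v.1).card = k + 1 := by
      rw [Finset.card_erase_of_mem v.2, s.2.2, Nat.add_sub_cancel]
    exact ⟨(Δ.isRelLowerSet_faces s.2.1).2 (Finset.erase_subset _ _)
      (Finset.card_pos.1 (by omega)), hc⟩⟩

/-- The simplicial boundary map from `(k + 1)`-chains to `k`-chains,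
`∂ [v₀ < ⋯ < vₖ₊₁] = ∑ i, (-1) ^ i [v₀, …, v̂ᵢ, …, vₖ₊₁]`: the position of a vertex `v` of `s` is the
number of vertices of `s` that are smaller than `v`. -/
def boundary (k : ℕ) : Chain Δ (k + 1) →ₗ[ℚ] Chain Δ k :=
  Finsupp.linearCombination ℚ fun s : Face Δ (k + 1) =>
    ∑ v : s.1, Finsupp.single (s.facet Δ v) ((-1 : ℚ) ^ (s.1.filter (· < v.1)).card)

/-- The `k`-cycles (unreduced: every `0`-chain is a cycle). -/
def cycles : (k : ℕ) → Submodule ℚ (Chain Δ k)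
  | 0 => ⊤
  | k + 1 => LinearMap.ker (boundary Δ k)

/-- Simplicial homology with rational coefficients: cycles modulo boundaries. -/
abbrev Homology (k : ℕ) : Type _ :=
  cycles Δ k ⧸ (LinearMap.range (boundary Δ k)).submoduleOf (cycles Δ k)

/-- The `k`-th Betti number, the dimension of the `k`-th rational homology. -/
def betti (k : ℕ) : ℕ := Module.finrank ℚ (Homology Δ k)

end Homology

/-- The geometric graph on a finite family of points of Euclidean space: two distinct members of the
family are adjacent when their distance is less than `2 r`. -/
def geometricGraph {d n : ℕ} (x : Fin n → EuclideanSpace ℝ (Fin d)) (r : ℝ) :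
    SimpleGraph (Fin n) where
  Adj i j := i ≠ j ∧ dist (x i) (x j) < 2 * r
  symm := ⟨fun i j h => ⟨h.1.symm, by rw [dist_comm]; exact h.2⟩⟩
  loopless := ⟨fun _ h => h.1 rfl⟩

/-- The Vietoris–Rips complex of a finite family of points: the clique complex of its geometric
graph. -/
def vietorisRips {d n : ℕ} (x : Fin n → EuclideanSpace ℝ (Fin d)) (r : ℝ) :
    AbstractSimplicialComplex (Fin n) :=
  cliqueComplex (geometricGraph x r)

/-- `X 1, …, X n` are independent random points, each with density `f`. -/
structure IsIIDSample {d n : ℕ} {Ω : Type*} [MeasurableSpace Ω] (P : Measure Ω)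
    (X : Fin n → Ω → EuclideanSpace ℝ (Fin d)) (f : EuclideanSpace ℝ (Fin d) → ℝ) : Prop where
  measurable : ∀ i, Measurable (X i)
  indep : iIndepFun X P
  law : ∀ i, P.map (X i) = volume.withDensity fun x => ENNReal.ofReal (f x)

/-- Total variation distance, normalized as the supremum of `|∫ g dμ - ∫ g dν|` over the continuous
functions `g` that are bounded by one. -/
def dTV {E : Type*} [TopologicalSpace E] [MeasurableSpace E] (μ ν : Measure E) : ℝ :=
  sSup {t : ℝ | ∃ g : E → ℝ, Continuous g ∧ (∀ y, |g y| ≤ 1) ∧ t = |∫ y, g y ∂μ - ∫ y, g y ∂ν|}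

/-- The random Betti number `β_k` of the Vietoris–Rips complex of radius `r` on the random points
`X`. -/
def randomBetti {d n : ℕ} {Ω : Type*} (X : Fin n → Ω → EuclideanSpace ℝ (Fin d)) (r : ℝ) (k : ℕ)
    (ω : Ω) : ℕ :=
  betti (vietorisRips (fun i => X i ω) r) k

end RandomRips

end

/-!
In the sparse regime almost every connected component of the geometric graph is small, and the
smallest complexes with homology in degree `k` are the boundaries of `(k+1)`-dimensional
cross-polytopes, which have `2k+2` vertices. Hence `β_k` is the number of these boundaries, up to a
remainder supported on the components with more than `2k+2` vertices; exploring a component along a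
spanning tree bounds the moments of the remainder by the expected number of cross-polytopes times
`n r^d`, and the Efron–Stein inequality turns this into a bound for its variance. The number of
cross-polytopes is a sum of locally dependent indicators, so the Chen–Stein method compares it with
a Poisson variable, again with relative error of order `n r^d`. All three regimes follow: the first
from Markov's inequality, the second from the Chen–Stein bound, and the third from the normal limit
of Poisson variables with large mean.
-/

noncomputable section

namespace RandomRips

section ChainOperators

variable {V : Type*} [LinearOrder V]

/-- The sign `(-1) ^ i` of the vertex `v` in the face `s ∪ {v}`, where `i` is the number of elements
of `s` below `v`. -/
def vertexSign (v : V) (s : Finset V) : ℚ := (-1) ^ (s.filter (· < v)).card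

lemma vertexSign_mul_self (v : V) (s : Finset V) : vertexSign v s * vertexSign v s = 1 := by
  rw [vertexSign, ← mul_pow, neg_one_mul, neg_neg, one_pow]

lemma vertexSign_ne_zero (v : V) (s : Finset V) : vertexSign v s ≠ 0 :=
  pow_ne_zero _ (by norm_num)

lemma vertexSign_insert_self (v : V) (s : Finset V) :
    vertexSign v (insert v s) = vertexSign v s := by
  simp [vertexSign, Finset.filter_insert]

lemma vertexSign_erase_self (v : V) (s : Finset V) :
    vertexSign v (s.erase v) = vertexSign v s := by
  rw [vertexSign, vertexSign, Finset.filter_erase, Finset.erase_eq_of_notMem (by simp)]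

lemma vertexSign_insert {v w : V} {s : Finset V} (hw : w ∉ s) :
    vertexSign v (insert w s) = (if w < v then -1 else 1) * vertexSign v s := by
  unfold vertexSign
  split_ifs with h
  · rw [Finset.filter_insert, if_pos h, Finset.card_insert_of_notMem (by simp [hw]), pow_succ']
  · rw [Finset.filter_insert, if_neg h, one_mul]

lemma vertexSign_erase {v w : V} {s : Finset V} (hw : w ∈ s) :
    vertexSign v (s.erase w) = (if w < v then -1 else 1) * vertexSign v s := by
  have h := vertexSign_insert (v := v) (Finset.notMem_erase w s)
  rw [Finset.insert_erase hw] at h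
  rw [h, ← mul_assoc]
  split_ifs <;> simp

/-- The link of a chain at the vertex `v`: the signed operator that removes `v` from every face.
Chains are functions on finite sets of vertices. -/
def linkChain (v : V) : (Finset V → ℚ) →ₗ[ℚ] (Finset V → ℚ) where
  toFun z s := if v ∈ s then 0 else vertexSign v s * z (insert v s)
  map_add' x y := by ext s; by_cases h : v ∈ s <;> simp [h, mul_add]
  map_smul' c x := by ext s; by_cases h : v ∈ s <;> simp [h, mul_left_comm]

/-- The cone over a chain with apex `v`: the signed operator that adds `v` to every face. -/
def coneChain (v : V) : (Finset V → ℚ) →ₗ[ℚ] (Finset V → ℚ) where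
  toFun z s := if v ∈ s then vertexSign v s * z (s.erase v) else 0
  map_add' x y := by ext s; by_cases h : v ∈ s <;> simp [h, mul_add]
  map_smul' c x := by ext s; by_cases h : v ∈ s <;> simp [h, mul_left_comm]

lemma linkChain_apply (v : V) (z : Finset V → ℚ) (s : Finset V) :
    linkChain v z s = if v ∈ s then 0 else vertexSign v s * z (insert v s) := rfl

lemma coneChain_apply (v : V) (z : Finset V → ℚ) (s : Finset V) :
    coneChain v z s = if v ∈ s then vertexSign v s * z (s.erase v) else 0 := rfl

lemma linkChain_linkChain (v w : V) (z : Finset V → ℚ) :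
    linkChain v (linkChain w z) = -linkChain w (linkChain v z) := by
  ext s
  simp only [linkChain_apply, Pi.neg_apply, Finset.mem_insert]
  by_cases hvw : v = w
  · subst hvw; simp
  by_cases hv : v ∈ s
  · simp [hv]
  by_cases hw : w ∈ s
  · simp [hw]
  simp only [hv, hw, hvw, Ne.symm hvw, or_self, if_false, vertexSign_insert hv,
    vertexSign_insert hw, Finset.insert_comm v w]
  rcases lt_or_gt_of_ne hvw with h | h <;> simp only [h, h.not_gt, if_true, if_false] <;> ring

lemma linkChain_coneChain_self (v : V) (z : Finset V → ℚ) :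
    linkChain v (coneChain v z) + coneChain v (linkChain v z) = z := by
  ext s
  simp only [linkChain_apply, coneChain_apply, Pi.add_apply, Finset.mem_insert_self, if_true,
    Finset.notMem_erase, if_false, vertexSign_insert_self, vertexSign_erase_self]
  by_cases hv : v ∈ s
  · simp [hv, ← mul_assoc, vertexSign_mul_self, Finset.insert_erase hv]
  · simp [hv, ← mul_assoc, vertexSign_mul_self, Finset.erase_insert hv]

lemma coneChain_linkChain_of_mem {v : V} {s : Finset V} (hv : v ∈ s) (z : Finset V → ℚ) :
    coneChain v (linkChain v z) s = z s := by
  have h := congrFun (linkChain_coneChain_self v z) s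
  rwa [Pi.add_apply, linkChain_apply, if_pos hv, zero_add] at h

lemma linkChain_coneChain {v w : V} (hvw : v ≠ w) (z : Finset V → ℚ) :
    linkChain v (coneChain w z) = -coneChain w (linkChain v z) := by
  ext s
  simp only [linkChain_apply, coneChain_apply, Pi.neg_apply, Finset.mem_insert, Finset.mem_erase]
  by_cases hv : v ∈ s
  · simp [hv, hvw]
  by_cases hw : w ∈ s
  · simp only [hv, hw, and_false, or_true, if_true, if_false, vertexSign_insert hv,
      vertexSign_erase hw]
    rw [Finset.erase_insert_of_ne hvw]
    rcases lt_or_gt_of_ne hvw with h | h <;> simp only [h, h.not_gt, if_true, if_false] <;> ring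
  · simp [hv, hw, Ne.symm hvw]

variable [Fintype V]

/-- The boundary operator of the full simplex with vertex set `V`, on chains that are functions on
finite sets of vertices. The empty set counts as a face, so the chain complex is augmented. -/
def chainBoundary : (Finset V → ℚ) →ₗ[ℚ] (Finset V → ℚ) := ∑ v : V, linkChain v

lemma chainBoundary_eq_sum (z : Finset V → ℚ) : chainBoundary z = ∑ v : V, linkChain v z := by
  rw [chainBoundary, LinearMap.sum_apply]

lemma chainBoundary_apply (z : Finset V → ℚ) (s : Finset V) :
    chainBoundary z s = ∑ v : V, linkChain v z s := by
  rw [chainBoundary_eq_sum, Finset.sum_apply]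

lemma chainBoundary_linkChain (v : V) (z : Finset V → ℚ) :
    chainBoundary (linkChain v z) = -linkChain v (chainBoundary z) := by
  rw [chainBoundary_eq_sum, chainBoundary_eq_sum, map_sum, ← Finset.sum_neg_distrib]
  exact Finset.sum_congr rfl fun w _ => linkChain_linkChain w v z

lemma chainBoundary_chainBoundary (z : Finset V → ℚ) : chainBoundary (chainBoundary z) = 0 := by
  have h : chainBoundary (chainBoundary z) = -chainBoundary (chainBoundary z) := by
    conv_lhs => rw [chainBoundary_eq_sum z, map_sum]
    simp_rw [chainBoundary_linkChain]
    rw [Finset.sum_neg_distrib, ← chainBoundary_eq_sum]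
  exact self_eq_neg.1 h

lemma chainBoundary_coneChain (v : V) (z : Finset V → ℚ) :
    chainBoundary (coneChain v z) = z - coneChain v (chainBoundary z) := by
  rw [chainBoundary_eq_sum, chainBoundary_eq_sum, map_sum,
    ← Finset.add_sum_erase _ _ (Finset.mem_univ v),
    ← Finset.add_sum_erase _ (fun w => coneChain v (linkChain w z)) (Finset.mem_univ v),
    Finset.sum_congr rfl fun w hw => linkChain_coneChain (Finset.ne_of_mem_erase hw) z,
    Finset.sum_neg_distrib]
  nth_rw 3 [← linkChain_coneChain_self v z]
  abel

end ChainOperators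

section CrossPolytope

variable {V : Type*} {G : SimpleGraph V} {W : Finset V} {m : ℕ} {u v : V}

open Classical in
/-- The vertices of `W` that are adjacent to `v`: the vertex set of the link of `v` in the clique
complex of `G` restricted to `W`. -/
def linkSet (G : SimpleGraph V) (W : Finset V) (v : V) : Finset V := W.filter (G.Adj v)

open Classical in
/-- The vertices of `W` other than `v` that are not adjacent to `v`; cycles are pushed off the
vertices for which there are none. -/
def nonNeighbors (G : SimpleGraph V) (W : Finset V) (v : V) : Finset V :=
  W.filter fun u => u ≠ v ∧ ¬ G.Adj v u

lemma mem_linkSet : u ∈ linkSet G W v ↔ u ∈ W ∧ G.Adj v u := by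
  simp [linkSet]

lemma mem_nonNeighbors : u ∈ nonNeighbors G W v ↔ u ∈ W ∧ u ≠ v ∧ ¬ G.Adj v u := by
  simp [nonNeighbors]

lemma linkSet_subset : linkSet G W v ⊆ W := fun _ hu => (mem_linkSet.1 hu).1

lemma notMem_linkSet_self : v ∉ linkSet G W v := fun h => G.irrefl (mem_linkSet.1 h).2

lemma card_linkSet_add_card_nonNeighbors (hv : v ∈ W) :
    (linkSet G W v).card + (nonNeighbors G W v).card + 1 = W.card := by
  classical
  have hnon : W.filter (fun u => ¬ G.Adj v u) = insert v (nonNeighbors G W v) := by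
    ext u
    by_cases huv : u = v
    · simp [huv, hv]
    · simp [huv, mem_nonNeighbors]
  rw [add_assoc, ← Finset.card_insert_of_notMem (fun h => (mem_nonNeighbors.1 h).2.1 rfl), ← hnon]
  exact Finset.card_filter_add_card_filter_not _

/-- `W` has `2 m` vertices and induces the one-skeleton of the `m`-dimensional cross-polytope:
every vertex has exactly one non-neighbour. Cross-polytopes are the smallest vertex sets that carry
homology in dimension `m - 1`. -/
def IsCrossPolytope (G : SimpleGraph V) (m : ℕ) (W : Finset V) : Prop :=
  W.card = 2 * m ∧ ∀ v ∈ W, ∃! u, u ∈ W ∧ u ≠ v ∧ ¬ G.Adj v u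

lemma existsUnique_nonNeighbor_iff :
    (∃! u, u ∈ W ∧ u ≠ v ∧ ¬ G.Adj v u) ↔ (nonNeighbors G W v).card = 1 := by
  simp only [Finset.card_eq_one, Finset.eq_singleton_iff_unique_mem, mem_nonNeighbors]
  rfl

lemma IsCrossPolytope.congr {G' : SimpleGraph V} (h : ∀ u ∈ W, ∀ v ∈ W, (G.Adj u v ↔ G'.Adj u v)) :
    IsCrossPolytope G m W ↔ IsCrossPolytope G' m W := by
  refine and_congr Iff.rfl (forall₂_congr fun v hv => existsUnique_congr fun u => ?_)
  exact and_congr_right fun hu => by rw [h v hv u hu]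

lemma isCrossPolytope_succ_of_forall_linkSet (hW : W.Nonempty) (hcard : W.card ≤ 2 * (m + 1))
    (hnon : ∀ v ∈ W, (nonNeighbors G W v).Nonempty)
    (hlink : ∀ v ∈ W, IsCrossPolytope G m (linkSet G W v)) : IsCrossPolytope G (m + 1) W := by
  have hsum : ∀ v ∈ W, 2 * m + (nonNeighbors G W v).card + 1 = W.card := fun v hv => by
    rw [← (hlink v hv).1, card_linkSet_add_card_nonNeighbors hv]
  have hpos : ∀ v ∈ W, 0 < (nonNeighbors G W v).card := fun v hv => Finset.card_pos.2 (hnon v hv)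
  obtain ⟨v₀, hv₀⟩ := hW
  have hsum₀ := hsum v₀ hv₀
  have hpos₀ := hpos v₀ hv₀
  refine ⟨by omega, fun v hv => existsUnique_nonNeighbor_iff.2 ?_⟩
  have := hsum v hv
  omega

lemma linkSet_eq_erase_erase_of_nonNeighbors [DecidableEq V] (h : nonNeighbors G W v = {u}) :
    linkSet G W v = (W.erase v).erase u := by
  ext x
  have hx : (x ∈ W ∧ x ≠ v ∧ ¬ G.Adj v x) ↔ x = u := by
    rw [← mem_nonNeighbors, h, Finset.mem_singleton]
  have hne : G.Adj v x → x ≠ v := fun h => h.ne'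
  simp only [mem_linkSet, Finset.mem_erase]
  tauto

lemma IsCrossPolytope.exists_antipode [DecidableEq V] (hW : IsCrossPolytope G m W) (hv : v ∈ W) :
    ∃ u ∈ W, u ≠ v ∧ linkSet G W v = (W.erase v).erase u ∧
      linkSet G W u = (W.erase v).erase u := by
  have hsingle : ∀ w ∈ W, ∃ x, nonNeighbors G W w = {x} := fun w hw =>
    Finset.card_eq_one.1 (existsUnique_nonNeighbor_iff.1 (hW.2 w hw))
  obtain ⟨u, hu⟩ := hsingle v hv
  obtain ⟨huW, huv, hadj⟩ := mem_nonNeighbors.1 (hu ▸ Finset.mem_singleton_self u)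
  obtain ⟨x, hx⟩ := hsingle u huW
  have hxv : v = x := Finset.mem_singleton.1 <| hx ▸
    mem_nonNeighbors.2 ⟨hv, huv.symm, fun h => hadj h.symm⟩
  refine ⟨u, huW, huv, linkSet_eq_erase_erase_of_nonNeighbors hu, ?_⟩
  rw [linkSet_eq_erase_erase_of_nonNeighbors (hxv ▸ hx), Finset.erase_right_comm]

lemma IsCrossPolytope.isCrossPolytope_linkSet (hW : IsCrossPolytope G (m + 1) W) (hv : v ∈ W) :
    IsCrossPolytope G m (linkSet G W v) := by
  classical
  obtain ⟨u, huW, huv, hlv, hlu⟩ := hW.exists_antipode hv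
  constructor
  · rw [hlv, Finset.card_erase_of_mem (Finset.mem_erase.2 ⟨huv, huW⟩),
      Finset.card_erase_of_mem hv, hW.1]
    omega
  intro x hx
  have hxv : G.Adj v x := (mem_linkSet.1 hx).2
  have hxu : G.Adj u x := (mem_linkSet.1 (hlu ▸ hlv ▸ hx)).2
  obtain ⟨y, ⟨hyW, hyx, hxy⟩, hyuniq⟩ := hW.2 x (mem_linkSet.1 hx).1
  refine ⟨y, ⟨?_, hyx, hxy⟩, fun t ht => hyuniq t ⟨(mem_linkSet.1 ht.1).1, ht.2⟩⟩
  rw [hlv, Finset.mem_erase, Finset.mem_erase]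
  exact ⟨fun h => hxy (h ▸ hxu.symm), fun h => hxy (h ▸ hxv.symm), hyW⟩

lemma IsCrossPolytope.card_le_of_isClique {s : Finset V} (hW : IsCrossPolytope G m W)
    (hs : s ⊆ W) (hclique : G.IsClique (s : Set V)) : s.card ≤ m := by
  classical
  choose! a ha ha_unique using hW.2
  have hcard : s.card ≤ (W \ s).card := by
    refine Finset.card_le_card_of_injOn a (fun v hv => ?_) (fun v hv w hw h => ?_)
    · obtain ⟨haW, hav, hadj⟩ := ha v (hs hv)
      exact Finset.mem_coe.2 (Finset.mem_sdiff.2 ⟨haW, fun h => hadj (hclique hv h hav.symm)⟩)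
    · obtain ⟨haW, hav, hadjv⟩ := ha v (hs hv)
      obtain ⟨-, haw, hadjw⟩ := ha w (hs hw)
      rw [← h] at haw hadjw
      have hunique := ha_unique (a v) haW
      exact (hunique v ⟨hs hv, hav.symm, fun h => hadjv h.symm⟩).trans
        (hunique w ⟨hs hw, haw.symm, fun h => hadjw h.symm⟩).symm
  have := Finset.card_sdiff_add_card_eq_card hs
  have := hW.1
  omega

end CrossPolytope

section CliqueChains

variable {V : Type*} {G : SimpleGraph V} {W : Finset V} {m : ℕ}

/-- The chains supported on the cliques of size `m` contained in `W`: the `(m - 1)`-chains of the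
clique complex of `G` restricted to `W`. -/
def cliqueChains (G : SimpleGraph V) (W : Finset V) (m : ℕ) : Submodule ℚ (Finset V → ℚ) where
  carrier := {z | ∀ s, z s ≠ 0 → s ⊆ W ∧ s.card = m ∧ G.IsClique (s : Set V)}
  add_mem' {x y} hx hy s hs := by
    by_cases h : x s = 0
    · exact hy s fun h' => hs (by simp [h, h'])
    · exact hx s h
  zero_mem' s hs := absurd rfl hs
  smul_mem' c x hx s hs := hx s fun h => hs (by simp [h])

lemma cliqueChains_mono (G : SimpleGraph V) {W W' : Finset V} (h : W ⊆ W') (m : ℕ) :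
    cliqueChains G W m ≤ cliqueChains G W' m := fun _ hz s hs =>
  ⟨(hz s hs).1.trans h, (hz s hs).2⟩

lemma cliqueChains_congr {G' : SimpleGraph V} (h : ∀ u ∈ W, ∀ v ∈ W, (G.Adj u v ↔ G'.Adj u v)) :
    cliqueChains G W m = cliqueChains G' W m := by
  ext z
  refine forall_congr' fun s => imp_congr_right fun _ => and_congr_right fun hs =>
    and_congr_right fun _ => ?_
  exact ⟨fun H u hu v hv huv => (h u (hs hu) v (hs hv)).1 (H hu hv huv),
    fun H u hu v hv huv => (h u (hs hu) v (hs hv)).2 (H hu hv huv)⟩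

lemma cliqueChains_eq_bot (h : ∀ s ⊆ W, G.IsClique (s : Set V) → s.card ≠ m) :
    cliqueChains G W m = ⊥ := by
  refine (Submodule.eq_bot_iff _).2 fun z hz => funext fun s => ?_
  by_contra hs
  obtain ⟨hsW, hcard, hclique⟩ := hz s hs
  exact h s hsW hclique hcard

lemma mem_cliqueChains_erase [DecidableEq V] {z : Finset V → ℚ} {v : V}
    (hz : z ∈ cliqueChains G W m) (h : ∀ s, v ∈ s → z s = 0) :
    z ∈ cliqueChains G (W.erase v) m := fun s hs =>
  ⟨Finset.subset_erase.2 ⟨(hz s hs).1, fun hv => hs (h s hv)⟩, (hz s hs).2⟩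

lemma apply_eq_zero_of_mem_cliqueChains_linkSet {z : Finset V → ℚ} {v : V} {s : Finset V}
    (hz : z ∈ cliqueChains G (linkSet G W v) m) (hv : v ∈ s) : z s = 0 := by
  by_contra hs
  exact notMem_linkSet_self ((hz s hs).1 hv)

/-- A chain has full support on `W` if it does not vanish on any `m`-clique of `W`, as does the
fundamental cycle of a cross-polytope. -/
def HasFullSupport (G : SimpleGraph V) (W : Finset V) (m : ℕ) (z : Finset V → ℚ) : Prop :=
  ∀ s ⊆ W, s.card = m → G.IsClique (s : Set V) → z s ≠ 0

variable [LinearOrder V] {z : Finset V → ℚ} {v : V}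

lemma hasFullSupport_succ_of_forall_linkChain
    (h : ∀ v ∈ W, HasFullSupport G (linkSet G W v) m (linkChain v z)) :
    HasFullSupport G W (m + 1) z := by
  intro s hsW hcard hclique hzs
  obtain ⟨v, hv⟩ := Finset.card_pos.1 (by omega : 0 < s.card)
  refine h v (hsW hv) (s.erase v) (fun u hu => ?_) ?_ (hclique.subset (by simp)) ?_
  · exact mem_linkSet.2 ⟨hsW (Finset.mem_of_mem_erase hu),
      hclique hv (Finset.mem_of_mem_erase hu) (Finset.ne_of_mem_erase hu).symm⟩
  · rw [Finset.card_erase_of_mem hv, hcard, Nat.add_sub_cancel]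
  · rw [linkChain_apply, if_neg (Finset.notMem_erase v s), Finset.insert_erase hv, hzs, mul_zero]

lemma linkChain_mem_cliqueChains (hz : z ∈ cliqueChains G W (m + 1)) (v : V) :
    linkChain v z ∈ cliqueChains G (linkSet G W v) m := by
  intro s hs
  rw [linkChain_apply] at hs
  have hv : v ∉ s := fun hv => hs (if_pos hv)
  rw [if_neg hv] at hs
  obtain ⟨hsW, hcard, hclique⟩ := hz _ (right_ne_zero_of_mul hs)
  rw [Finset.card_insert_of_notMem hv] at hcard
  refine ⟨fun u hu => mem_linkSet.2 ⟨hsW (Finset.mem_insert_of_mem hu), ?_⟩, by omega,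
    hclique.subset (by simp)⟩
  exact hclique (by simp) (by simp [hu]) (fun h => hv (h ▸ hu))

lemma coneChain_mem_cliqueChains (hv : v ∈ W) (hz : z ∈ cliqueChains G (linkSet G W v) m) :
    coneChain v z ∈ cliqueChains G W (m + 1) := by
  intro s hs
  rw [coneChain_apply] at hs
  have hvs : v ∈ s := by
    by_contra hvs
    exact hs (if_neg hvs)
  rw [if_pos hvs] at hs
  obtain ⟨hsub, hcard, hclique⟩ := hz _ (right_ne_zero_of_mul hs)
  refine ⟨fun u hu => ?_, by rw [← Finset.card_erase_add_one hvs, hcard], ?_⟩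
  · by_cases huv : u = v
    · exact huv ▸ hv
    · exact linkSet_subset (hsub (Finset.mem_erase.2 ⟨huv, hu⟩))
  · rw [← Finset.insert_erase hvs, Finset.coe_insert, SimpleGraph.isClique_insert]
    exact ⟨hclique, fun b hb _ => (mem_linkSet.1 (hsub hb)).2⟩

variable [Fintype V]

lemma chainBoundary_mem_cliqueChains (hz : z ∈ cliqueChains G W (m + 1)) :
    chainBoundary z ∈ cliqueChains G W m := by
  rw [chainBoundary_eq_sum]
  exact Submodule.sum_mem _ fun v _ =>
    cliqueChains_mono G linkSet_subset m (linkChain_mem_cliqueChains hz v)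

/-- The cycles supported on the `m`-cliques of `W`: the reduced `(m - 1)`-cycles of the clique
complex of `G` restricted to `W`. -/
def cliqueCycles (G : SimpleGraph V) (W : Finset V) (m : ℕ) : Submodule ℚ (Finset V → ℚ) :=
  cliqueChains G W m ⊓ LinearMap.ker chainBoundary

/-- The boundaries of the chains supported on the `(m + 1)`-cliques of `W`: the `(m - 1)`-boundaries
of the clique complex of `G` restricted to `W`. -/
def cliqueBoundaries (G : SimpleGraph V) (W : Finset V) (m : ℕ) : Submodule ℚ (Finset V → ℚ) :=
  (cliqueChains G W (m + 1)).map chainBoundary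

lemma cliqueBoundaries_le_cliqueCycles (G : SimpleGraph V) (W : Finset V) (m : ℕ) :
    cliqueBoundaries G W m ≤ cliqueCycles G W m := by
  rintro _ ⟨w, hw, rfl⟩
  exact ⟨chainBoundary_mem_cliqueChains hw, chainBoundary_chainBoundary w⟩

lemma cliqueBoundaries_mono (G : SimpleGraph V) {W W' : Finset V} (h : W ⊆ W') (m : ℕ) :
    cliqueBoundaries G W m ≤ cliqueBoundaries G W' m :=
  Submodule.map_mono (cliqueChains_mono G h _)

lemma linkChain_mem_cliqueCycles (hz : z ∈ cliqueCycles G W (m + 1)) (v : V) :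
    linkChain v z ∈ cliqueCycles G (linkSet G W v) m := by
  refine ⟨linkChain_mem_cliqueChains hz.1 v, LinearMap.mem_ker.2 ?_⟩
  rw [chainBoundary_linkChain, LinearMap.mem_ker.1 hz.2, map_zero, neg_zero]

-- If the link of the cycle at `v` is `∂ w`, adding the boundary of the cone over `w` cancels all
-- faces containing `v`.
lemma exists_add_mem_cliqueCycles_erase (hv : v ∈ W) (hz : z ∈ cliqueCycles G W (m + 1))
    (hlink : linkChain v z ∈ cliqueBoundaries G (linkSet G W v) m) :
    ∃ y ∈ cliqueBoundaries G W (m + 1), z + y ∈ cliqueCycles G (W.erase v) (m + 1) := by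
  obtain ⟨w, hw, hwz⟩ := hlink
  have hy : chainBoundary (coneChain v w) ∈ cliqueBoundaries G W (m + 1) :=
    Submodule.mem_map_of_mem (coneChain_mem_cliqueChains hv hw)
  obtain ⟨hchain, hcycle⟩ :=
    Submodule.add_mem _ hz (cliqueBoundaries_le_cliqueCycles G W (m + 1) hy)
  refine ⟨_, hy, mem_cliqueChains_erase hchain fun s hvs => ?_, hcycle⟩
  rw [chainBoundary_coneChain, hwz, Pi.add_apply, Pi.sub_apply, coneChain_linkChain_of_mem hvs,
    apply_eq_zero_of_mem_cliqueChains_linkSet hw hvs]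
  ring

-- If `v` is adjacent to all other vertices, then the part of the cycle away from `v` lies in the
-- link of `v` and bounds there.
lemma linkChain_mem_cliqueBoundaries_of_nonNeighbors_eq_empty (hv : v ∈ W)
    (hnon : nonNeighbors G W v = ∅) (hz : z ∈ cliqueCycles G W (m + 1)) :
    linkChain v z ∈ cliqueBoundaries G (linkSet G W v) m := by
  have hlink : linkSet G W v = W.erase v := by
    ext u
    have hu : u ∈ W → u ≠ v → G.Adj v u := fun huW huv => by
      by_contra h
      exact Finset.notMem_empty u (hnon ▸ mem_nonNeighbors.2 ⟨huW, huv, h⟩)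
    rw [mem_linkSet, Finset.mem_erase]
    exact ⟨fun h => ⟨h.2.ne', h.1⟩, fun h => ⟨h.2, hu h.2 h.1⟩⟩
  refine ⟨coneChain v (linkChain v z) - z, ?_, ?_⟩
  · rw [hlink]
    refine mem_cliqueChains_erase (Submodule.sub_mem _
      (coneChain_mem_cliqueChains hv (linkChain_mem_cliqueChains hz.1 v)) hz.1) fun s hvs => ?_
    rw [Pi.sub_apply, coneChain_linkChain_of_mem hvs, sub_self]
  · rw [map_sub, chainBoundary_coneChain, chainBoundary_linkChain, LinearMap.mem_ker.1 hz.2,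
      map_zero, neg_zero, map_zero, sub_zero, sub_zero]

lemma mem_cliqueBoundaries_or_hasFullSupport_zero (hW : W = ∅) (hz : z ∈ cliqueChains G W 0) :
    z ∈ cliqueBoundaries G W 0 ∨ (IsCrossPolytope G 0 W ∧ HasFullSupport G W 0 z) := by
  subst hW
  by_cases h : z ∅ = 0
  · have hz0 : z = 0 := funext fun s => by
      by_contra hs
      exact hs (Finset.subset_empty.1 (hz s hs).1 ▸ h)
    exact Or.inl (hz0 ▸ Submodule.zero_mem _)
  · refine Or.inr ⟨⟨rfl, by simp⟩, fun s hs _ _ => ?_⟩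
    rwa [Finset.subset_empty.1 hs]

theorem mem_cliqueBoundaries_or_isCrossPolytope (hW : W.card ≤ 2 * m)
    (hz : z ∈ cliqueCycles G W m) :
    z ∈ cliqueBoundaries G W m ∨ (IsCrossPolytope G m W ∧ HasFullSupport G W m z) := by
  induction m generalizing W z with
  | zero =>
    exact mem_cliqueBoundaries_or_hasFullSupport_zero (Finset.card_eq_zero.1 (by omega)) hz.1
  | succ m ih =>
    induction hN : W.card using Nat.strong_induction_on generalizing W z with
    | _ N ihN =>
    by_contra! ⟨hbound, hcross⟩
    have hnot_bound : ∀ v ∈ W, linkChain v z ∉ cliqueBoundaries G (linkSet G W v) m := by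
      intro v hv hlink
      obtain ⟨y, hy, hzy⟩ := exists_add_mem_cliqueCycles_erase hv hz hlink
      have hcard : (W.erase v).card + 1 = W.card := Finset.card_erase_add_one hv
      rcases ihN _ (by omega) (by omega) hzy rfl with hbound' | ⟨hcross', -⟩
      · refine hbound ((Submodule.add_mem_iff_left _ hy).1 ?_)
        exact cliqueBoundaries_mono G (Finset.erase_subset v W) _ hbound'
      · have := hcross'.1
        omega
    have hnon : ∀ v ∈ W, (nonNeighbors G W v).Nonempty := fun v hv =>
      Finset.nonempty_iff_ne_empty.2 fun hempty => hnot_bound v hv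
        (linkChain_mem_cliqueBoundaries_of_nonNeighbors_eq_empty hv hempty hz)
    have hlink : ∀ v ∈ W, IsCrossPolytope G m (linkSet G W v) ∧
        HasFullSupport G (linkSet G W v) m (linkChain v z) := by
      intro v hv
      have hsum := card_linkSet_add_card_nonNeighbors (G := G) hv
      have hpos := Finset.card_pos.2 (hnon v hv)
      exact (ih (by omega) (linkChain_mem_cliqueCycles hz v)).resolve_left (hnot_bound v hv)
    have hne : W.Nonempty := Finset.nonempty_iff_ne_empty.2 fun hempty => hbound <| by
      have hbot : cliqueChains G W (m + 1) = ⊥ := cliqueChains_eq_bot fun s hs _ => by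
        simp [Finset.subset_empty.1 (hempty ▸ hs)]
      exact (Submodule.eq_bot_iff _).1 hbot z hz.1 ▸ Submodule.zero_mem _
    exact hcross (isCrossPolytope_succ_of_forall_linkSet hne hW hnon fun v hv => (hlink v hv).1)
      (hasFullSupport_succ_of_forall_linkChain fun v hv => (hlink v hv).2)

end CliqueChains

section CrossPolytopeCycle

variable {V : Type*} [LinearOrder V] [Fintype V] {G : SimpleGraph V} {W : Finset V} {m : ℕ}

lemma single_empty_mem_cliqueCycles (G : SimpleGraph V) (W : Finset V) :
    Pi.single ∅ 1 ∈ cliqueCycles G W 0 := by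
  refine ⟨fun s hs => ?_, LinearMap.mem_ker.2 (funext fun s => ?_)⟩
  · obtain rfl : s = ∅ := by
      by_contra h
      exact hs (Pi.single_eq_of_ne h 1)
    simp
  · rw [chainBoundary_apply]
    refine Finset.sum_eq_zero fun v _ => ?_
    simp [linkChain_apply]

lemma coneChain_sub_coneChain_mem_cliqueCycles {u v : V} (hu : u ∈ W) (hv : v ∈ W)
    (h : linkSet G W u = linkSet G W v) {z : Finset V → ℚ}
    (hz : z ∈ cliqueCycles G (linkSet G W v) m) :
    coneChain v z - coneChain u z ∈ cliqueCycles G W (m + 1) := by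
  refine ⟨Submodule.sub_mem _ (coneChain_mem_cliqueChains hv hz.1)
    (coneChain_mem_cliqueChains hu (h ▸ hz.1)), LinearMap.mem_ker.2 ?_⟩
  rw [map_sub, chainBoundary_coneChain, chainBoundary_coneChain, LinearMap.mem_ker.1 hz.2,
    map_zero, map_zero, sub_self]

-- A cross-polytope is the suspension of the link of a vertex, with that vertex and its antipode as
-- the apices, so suspending a cycle of the link gives the fundamental cycle.
lemma IsCrossPolytope.exists_mem_cliqueCycles_ne_zero (hW : IsCrossPolytope G m W) :
    ∃ z ∈ cliqueCycles G W m, z ≠ 0 := by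
  induction m generalizing W with
  | zero =>
    exact ⟨_, single_empty_mem_cliqueCycles G W, fun h => by simpa using congrFun h ∅⟩
  | succ m ih =>
    obtain ⟨v, hv⟩ : W.Nonempty := Finset.card_pos.1 (by rw [hW.1]; omega)
    obtain ⟨u, huW, huv, hlv, hlu⟩ := hW.exists_antipode hv
    obtain ⟨z, hz, hz_ne⟩ := ih (hW.isCrossPolytope_linkSet hv)
    refine ⟨coneChain v z - coneChain u z,
      coneChain_sub_coneChain_mem_cliqueCycles huW hv (hlu.trans hlv.symm) hz, fun h => ?_⟩
    obtain ⟨s, hs⟩ := Function.ne_iff.1 hz_ne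
    have hsub : s ⊆ (W.erase v).erase u := hlv ▸ (hz.1 s hs).1
    have hus : u ∉ s := fun h => Finset.notMem_erase u _ (hsub h)
    have hvs : v ∉ s := fun h => Finset.notMem_erase v _ (Finset.mem_of_mem_erase (hsub h))
    have hval := congrFun h (insert v s)
    simp only [Pi.sub_apply, coneChain_apply, Finset.mem_insert_self, if_true, Pi.zero_apply,
      Finset.mem_insert, huv, hus, or_self, if_false, Finset.erase_insert hvs, sub_zero] at hval
    exact mul_ne_zero (vertexSign_ne_zero _ _) hs hval

lemma IsCrossPolytope.cliqueBoundaries_eq_bot (hW : IsCrossPolytope G m W) :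
    cliqueBoundaries G W m = ⊥ := by
  rw [cliqueBoundaries, cliqueChains_eq_bot fun s hs hclique => ?_, Submodule.map_bot]
  exact ((hW.card_le_of_isClique hs hclique).trans_lt m.lt_succ_self).ne

lemma IsCrossPolytope.finrank_cliqueCycles (hW : IsCrossPolytope G m W) :
    Module.finrank ℚ (cliqueCycles G W m) = 1 := by
  obtain ⟨z, hz, hz_ne⟩ := hW.exists_mem_cliqueCycles_ne_zero
  obtain ⟨s, hs⟩ := Function.ne_iff.1 hz_ne
  obtain ⟨hsW, hcard, hclique⟩ := hz.1 s hs
  have hspan : cliqueCycles G W m = Submodule.span ℚ {z} := by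
    refine le_antisymm (fun y hy => ?_) ((Submodule.span_singleton_le_iff_mem _ _).2 hz)
    have hvanish : (y - (y s / z s) • z) s = 0 := by
      rw [Pi.sub_apply, Pi.smul_apply, smul_eq_mul, div_mul_cancel₀ _ hs, sub_self]
    rcases mem_cliqueBoundaries_or_isCrossPolytope hW.1.le
      (Submodule.sub_mem _ hy (Submodule.smul_mem _ (y s / z s) hz)) with hbound | ⟨-, hfull⟩
    · rw [hW.cliqueBoundaries_eq_bot, Submodule.mem_bot, sub_eq_zero] at hbound
      exact Submodule.mem_span_singleton.2 ⟨_, hbound.symm⟩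
    · exact absurd hvanish (hfull s hsW hcard hclique)
  rw [hspan, finrank_span_singleton hz_ne]

end CrossPolytopeCycle

section CliqueBetti

variable {V : Type*} [LinearOrder V] [Fintype V] {G : SimpleGraph V} {W : Finset V} {m : ℕ}

/-- The reduced Betti number in dimension `m - 1` of the clique complex of `G` restricted to `W`;
the index is the number of vertices of the faces. -/
def cliqueBetti (G : SimpleGraph V) (W : Finset V) (m : ℕ) : ℕ :=
  Module.finrank ℚ (cliqueCycles G W m) - Module.finrank ℚ (cliqueBoundaries G W m)

lemma cliqueBetti_add_finrank_cliqueBoundaries (G : SimpleGraph V) (W : Finset V) (m : ℕ) :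
    cliqueBetti G W m + Module.finrank ℚ (cliqueBoundaries G W m) =
      Module.finrank ℚ (cliqueCycles G W m) :=
  Nat.sub_add_cancel (Submodule.finrank_mono (cliqueBoundaries_le_cliqueCycles G W m))

lemma cliqueBetti_congr {G' : SimpleGraph V} (h : ∀ u ∈ W, ∀ v ∈ W, (G.Adj u v ↔ G'.Adj u v)) :
    cliqueBetti G W m = cliqueBetti G' W m := by
  have hcycles : cliqueCycles G W m = cliqueCycles G' W m := by
    rw [cliqueCycles, cliqueCycles, cliqueChains_congr h]
  have hboundaries : cliqueBoundaries G W m = cliqueBoundaries G' W m := by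
    rw [cliqueBoundaries, cliqueBoundaries, cliqueChains_congr h]
  rw [cliqueBetti, cliqueBetti, hcycles, hboundaries]

lemma IsCrossPolytope.cliqueBetti_eq_one (hW : IsCrossPolytope G m W) :
    cliqueBetti G W m = 1 := by
  rw [cliqueBetti, hW.finrank_cliqueCycles, hW.cliqueBoundaries_eq_bot, finrank_bot]

lemma cliqueBetti_eq_zero_of_not_isCrossPolytope (hcard : W.card ≤ 2 * m)
    (hW : ¬ IsCrossPolytope G m W) : cliqueBetti G W m = 0 := by
  have hle : cliqueCycles G W m ≤ cliqueBoundaries G W m := fun z hz =>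
    (mem_cliqueBoundaries_or_isCrossPolytope hcard hz).resolve_right fun h => hW h.1
  rw [cliqueBetti, Nat.sub_eq_zero_of_le (Submodule.finrank_mono hle)]

-- A cycle is determined by its values on the `m`-subsets of `W`.
lemma cliqueBetti_le (G : SimpleGraph V) (W : Finset V) (m : ℕ) :
    cliqueBetti G W m ≤ W.card ^ m := by
  let restrict : cliqueCycles G W m →ₗ[ℚ] (W.powersetCard m → ℚ) :=
    (LinearMap.funLeft ℚ ℚ (Subtype.val : W.powersetCard m → Finset V)).comp
      (Submodule.subtype _)
  have hinj : Function.Injective restrict := by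
    rw [← LinearMap.ker_eq_bot, LinearMap.ker_eq_bot']
    rintro ⟨z, hz, hz0⟩ h
    ext s
    by_contra hs
    obtain ⟨hsW, hcard, -⟩ := hz s hs
    exact hs (congrFun h ⟨s, Finset.mem_powersetCard.2 ⟨hsW, hcard⟩⟩)
  have hrank := LinearMap.finrank_le_finrank_of_injective hinj
  rw [Module.finrank_fintype_fun_eq_card, Fintype.card_coe, Finset.card_powersetCard] at hrank
  exact (Nat.sub_le _ _).trans (hrank.trans (Nat.choose_le_pow W.card m))

end CliqueBetti

section CrossPolytopeCount

variable {V : Type*} {G : SimpleGraph V} {W : Finset V} {m : ℕ}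

open Classical in
/-- The number of subsets of `W` that induce an `m`-dimensional cross-polytope; it approximates the
Betti number `cliqueBetti G W m`. -/
def crossPolytopeCount (G : SimpleGraph V) (W : Finset V) (m : ℕ) : ℕ :=
  (W.powerset.filter (IsCrossPolytope G m)).card

lemma crossPolytopeCount_congr {G' : SimpleGraph V}
    (h : ∀ u ∈ W, ∀ v ∈ W, (G.Adj u v ↔ G'.Adj u v)) :
    crossPolytopeCount G W m = crossPolytopeCount G' W m := by
  classical
  unfold crossPolytopeCount
  congr 1
  refine Finset.filter_congr fun S hS => ?_
  rw [Finset.mem_powerset] at hS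
  exact IsCrossPolytope.congr fun u hu v hv => h u (hS hu) v (hS hv)

lemma crossPolytopeCount_le (G : SimpleGraph V) (W : Finset V) (m : ℕ) :
    crossPolytopeCount G W m ≤ W.card ^ (2 * m) := by
  classical
  refine le_trans ?_ (Nat.choose_le_pow W.card (2 * m))
  rw [← Finset.card_powersetCard]
  refine Finset.card_le_card fun S hS => ?_
  rw [Finset.mem_filter, Finset.mem_powerset] at hS
  exact Finset.mem_powersetCard.2 ⟨hS.1, hS.2.1⟩

lemma crossPolytopeCount_of_card_le (hcard : W.card ≤ 2 * m) [Decidable (IsCrossPolytope G m W)] :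
    crossPolytopeCount G W m = if IsCrossPolytope G m W then 1 else 0 := by
  classical
  have hfilter : W.powerset.filter (IsCrossPolytope G m) =
      if IsCrossPolytope G m W then {W} else ∅ := by
    ext S
    have hS : S ⊆ W → IsCrossPolytope G m S → S = W := fun hS hcross =>
      Finset.eq_of_subset_of_card_le hS (hcross.1 ▸ hcard)
    rw [Finset.mem_filter, Finset.mem_powerset]
    split_ifs with hW
    · refine ⟨fun h => Finset.mem_singleton.2 (hS h.1 h.2), fun h => ?_⟩
      obtain rfl := Finset.mem_singleton.1 h
      exact ⟨subset_rfl, hW⟩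
    · exact ⟨fun h => absurd (hS h.1 h.2 ▸ h.2) hW, fun h => absurd h (Finset.notMem_empty S)⟩
  rw [crossPolytopeCount, hfilter]
  split_ifs <;> simp

lemma cliqueBetti_eq_crossPolytopeCount [LinearOrder V] [Fintype V] (hcard : W.card ≤ 2 * m) :
    cliqueBetti G W m = crossPolytopeCount G W m := by
  classical
  rw [crossPolytopeCount_of_card_le hcard]
  split_ifs with hW
  · exact hW.cliqueBetti_eq_one
  · exact cliqueBetti_eq_zero_of_not_isCrossPolytope hcard hW

end CrossPolytopeCount

section DisjointUnion

variable {V : Type*} {G : SimpleGraph V} {C D : Finset V} {m : ℕ}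

lemma cliqueChains_disjoint (G : SimpleGraph V) (hCD : Disjoint C D) (hm : 1 ≤ m) :
    Disjoint (cliqueChains G C m) (cliqueChains G D m) := by
  refine Submodule.disjoint_def.2 fun z hzC hzD => funext fun s => ?_
  by_contra hs
  obtain ⟨hsC, hcard, -⟩ := hzC s hs
  obtain ⟨x, hx⟩ := Finset.card_pos.1 (by omega : 0 < s.card)
  exact Finset.disjoint_left.1 hCD (hsC hx) ((hzD s hs).1 hx)

section UnionOfSets

variable [DecidableEq V]

lemma subset_or_subset_of_isClique {s : Finset V} (hno : ∀ u ∈ C, ∀ v ∈ D, ¬ G.Adj u v)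
    (hs : s ⊆ C ∪ D) (hclique : G.IsClique (s : Set V)) : s ⊆ C ∨ s ⊆ D := by
  by_contra! ⟨hC, hD⟩
  obtain ⟨x, hx, hxC⟩ := Finset.not_subset.1 hC
  obtain ⟨y, hy, hyD⟩ := Finset.not_subset.1 hD
  have hxD := (Finset.mem_union.1 (hs hx)).resolve_left hxC
  have hyC := (Finset.mem_union.1 (hs hy)).resolve_right hyD
  exact hno y hyC x hxD (hclique hy hx fun h => hyD (h ▸ hxD))

lemma IsCrossPolytope.subset_or_subset {S : Finset V} (hS : IsCrossPolytope G m S) (hm : 2 ≤ m)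
    (hno : ∀ u ∈ C, ∀ v ∈ D, ¬ G.Adj u v) (hsub : S ⊆ C ∪ D) : S ⊆ C ∨ S ⊆ D := by
  by_contra! ⟨hC, hD⟩
  obtain ⟨x, hx, hxC⟩ := Finset.not_subset.1 hC
  obtain ⟨y, hy, hyD⟩ := Finset.not_subset.1 hD
  have hxD := (Finset.mem_union.1 (hsub hx)).resolve_left hxC
  have hyC := (Finset.mem_union.1 (hsub hy)).resolve_right hyD
  have hle : S ⊆ {x, y} := by
    intro u hu
    rw [Finset.mem_insert, Finset.mem_singleton]
    rcases Finset.mem_union.1 (hsub hu) with huC | huD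
    · exact Or.inr <| (hS.2 x hx).unique
        ⟨hu, fun h => hxC (h ▸ huC), fun h => hno u huC x hxD h.symm⟩
        ⟨hy, fun h => hxC (h ▸ hyC), fun h => hno y hyC x hxD h.symm⟩
    · exact Or.inl <| (hS.2 y hy).unique
        ⟨hu, fun h => hyD (h ▸ huD), hno y hyC u huD⟩
        ⟨hx, fun h => hyD (h ▸ hxD), hno y hyC x hxD⟩
  have := (Finset.card_le_card hle).trans Finset.card_le_two
  have := hS.1
  omega

lemma crossPolytopeCount_union (hno : ∀ u ∈ C, ∀ v ∈ D, ¬ G.Adj u v) (hCD : Disjoint C D)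
    (hm : 2 ≤ m) :
    crossPolytopeCount G (C ∪ D) m = crossPolytopeCount G C m + crossPolytopeCount G D m := by
  classical
  unfold crossPolytopeCount
  rw [← Finset.card_union_of_disjoint]
  · congr 1
    ext S
    simp only [Finset.mem_union, Finset.mem_filter, Finset.mem_powerset, ← or_and_right]
    refine and_congr_left fun hS => ⟨hS.subset_or_subset hm hno, ?_⟩
    rintro (h | h)
    · exact h.trans Finset.subset_union_left
    · exact h.trans Finset.subset_union_right
  · refine Finset.disjoint_left.2 fun S hS hS' => ?_
    simp only [Finset.mem_filter, Finset.mem_powerset] at hS hS'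
    obtain ⟨x, hx⟩ := Finset.card_pos.1 (by rw [hS.2.1]; omega : 0 < S.card)
    exact Finset.disjoint_left.1 hCD (hS.1 hx) (hS'.1 hx)

lemma cliqueChains_union (hno : ∀ u ∈ C, ∀ v ∈ D, ¬ G.Adj u v) (m : ℕ) :
    cliqueChains G (C ∪ D) m = cliqueChains G C m ⊔ cliqueChains G D m := by
  refine le_antisymm (fun z hz => ?_) (sup_le (cliqueChains_mono G Finset.subset_union_left m)
    (cliqueChains_mono G Finset.subset_union_right m))
  refine Submodule.mem_sup.2
    ⟨fun s => if s ⊆ C then z s else 0, fun s hs => ?_,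
      fun s => if s ⊆ C then 0 else z s, fun s hs => ?_, ?_⟩
  · obtain ⟨hsC, hzs⟩ := ite_ne_right_iff.1 hs
    exact ⟨hsC, (hz s hzs).2⟩
  · obtain ⟨hsC, hzs⟩ := ite_ne_left_iff.1 hs
    obtain ⟨hsub, hcard, hclique⟩ := hz s hzs.symm
    exact ⟨(subset_or_subset_of_isClique hno hsub hclique).resolve_left hsC, hcard, hclique⟩
  · ext s
    by_cases h : s ⊆ C <;> simp [h]

end UnionOfSets

variable [LinearOrder V] [Fintype V]

lemma cliqueBoundaries_union (hno : ∀ u ∈ C, ∀ v ∈ D, ¬ G.Adj u v) (m : ℕ) :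
    cliqueBoundaries G (C ∪ D) m = cliqueBoundaries G C m ⊔ cliqueBoundaries G D m := by
  rw [cliqueBoundaries, cliqueChains_union hno, Submodule.map_sup, cliqueBoundaries,
    cliqueBoundaries]

lemma cliqueCycles_union (hno : ∀ u ∈ C, ∀ v ∈ D, ¬ G.Adj u v) (hCD : Disjoint C D)
    (hm : 2 ≤ m) :
    cliqueCycles G (C ∪ D) m = cliqueCycles G C m ⊔ cliqueCycles G D m := by
  refine le_antisymm ?_ (sup_le
    (inf_le_inf_right _ (cliqueChains_mono G Finset.subset_union_left m))
    (inf_le_inf_right _ (cliqueChains_mono G Finset.subset_union_right m)))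
  rintro z ⟨hz, hz0⟩
  obtain ⟨m, rfl⟩ : ∃ m', m = m' + 1 := ⟨m - 1, by omega⟩
  rw [SetLike.mem_coe, cliqueChains_union hno, Submodule.mem_sup] at hz
  obtain ⟨x, hx, y, hy, rfl⟩ := hz
  have hxy : chainBoundary x + chainBoundary y = 0 := by
    rw [← map_add]
    exact hz0
  have hx0 : chainBoundary x = 0 := by
    refine Submodule.disjoint_def.1 (cliqueChains_disjoint G hCD (m := m) (by omega)) _
      (chainBoundary_mem_cliqueChains hx) ?_
    rw [eq_neg_of_add_eq_zero_left hxy]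
    exact Submodule.neg_mem _ (chainBoundary_mem_cliqueChains hy)
  have hy0 : chainBoundary y = 0 := by rwa [hx0, zero_add] at hxy
  exact Submodule.add_mem_sup ⟨hx, hx0⟩ ⟨hy, hy0⟩

lemma finrank_sup_of_disjoint {K M : Type*} [DivisionRing K] [AddCommGroup M] [Module K M]
    [FiniteDimensional K M] {A B : Submodule K M} (h : Disjoint A B) :
    Module.finrank K (A ⊔ B : Submodule K M) = Module.finrank K A + Module.finrank K B := by
  have hrank := Submodule.finrank_sup_add_finrank_inf_eq A B
  rwa [h.eq_bot, finrank_bot, add_zero] at hrank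

lemma cliqueBetti_union (hno : ∀ u ∈ C, ∀ v ∈ D, ¬ G.Adj u v) (hCD : Disjoint C D)
    (hm : 2 ≤ m) : cliqueBetti G (C ∪ D) m = cliqueBetti G C m + cliqueBetti G D m := by
  have hcycles : Disjoint (cliqueCycles G C m) (cliqueCycles G D m) :=
    (cliqueChains_disjoint G hCD (by omega)).mono inf_le_left inf_le_left
  have hboundaries : Disjoint (cliqueBoundaries G C m) (cliqueBoundaries G D m) :=
    hcycles.mono (cliqueBoundaries_le_cliqueCycles G C m) (cliqueBoundaries_le_cliqueCycles G D m)
  have hunion := cliqueBetti_add_finrank_cliqueBoundaries G (C ∪ D) m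
  rw [cliqueCycles_union hno hCD hm, cliqueBoundaries_union hno,
    finrank_sup_of_disjoint hcycles, finrank_sup_of_disjoint hboundaries] at hunion
  have hC := cliqueBetti_add_finrank_cliqueBoundaries G C m
  have hD := cliqueBetti_add_finrank_cliqueBoundaries G D m
  omega

end DisjointUnion

section Comparison

variable {V : Type*}

/-- Extension of simplicial chains by zero to functions on all finite sets of vertices. -/
def extendChain (Δ : AbstractSimplicialComplex V) (k : ℕ) : Chain Δ k →ₗ[ℚ] (Finset V → ℚ) :=
  Finsupp.lcoeFun.comp (Finsupp.lmapDomain ℚ ℚ Subtype.val)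

lemma extendChain_single [DecidableEq V] (Δ : AbstractSimplicialComplex V) {k : ℕ} (s : Face Δ k)
    (c : ℚ) : extendChain Δ k (Finsupp.single s c) = Pi.single s.1 c := by
  ext t
  simp [extendChain, Finsupp.mapDomain_single, Finsupp.single_apply, Pi.single_apply, eq_comm]

lemma extendChain_injective (Δ : AbstractSimplicialComplex V) (k : ℕ) :
    Function.Injective (extendChain Δ k) :=
  DFunLike.coe_injective.comp (Finsupp.mapDomain_injective Subtype.val_injective)

variable [LinearOrder V]

lemma linkChain_single (v : V) (t : Finset V) (c : ℚ) :
    linkChain v (Pi.single t c) =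
      if v ∈ t then Pi.single (t.erase v) (c * vertexSign v t) else 0 := by
  ext s
  have hfresh : v ∈ s → s ≠ t.erase v := fun hvs h => Finset.notMem_erase v t (h ▸ hvs)
  have hinsert : v ∉ s → v ∈ t → (insert v s = t ↔ s = t.erase v) := fun hvs hvt =>
    ⟨fun h => by rw [← h, Finset.erase_insert hvs],
      fun h => by rw [h, Finset.insert_erase hvt]⟩
  rw [linkChain_apply]
  by_cases hvs : v ∈ s <;> by_cases hvt : v ∈ t
  · rw [if_pos hvs, if_pos hvt, Pi.single_eq_of_ne (hfresh hvs)]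
  · rw [if_pos hvs, if_neg hvt, Pi.zero_apply]
  · rw [if_neg hvs, if_pos hvt, Pi.single_apply, Pi.single_apply]
    simp only [hinsert hvs hvt]
    split_ifs with h
    · rw [h, vertexSign_erase_self, mul_comm]
    · exact mul_zero _
  · have hne : insert v s ≠ t := fun h => hvt (h ▸ Finset.mem_insert_self v s)
    rw [if_neg hvs, if_neg hvt, Pi.single_eq_of_ne hne, mul_zero, Pi.zero_apply]

variable [Fintype V] {G : SimpleGraph V} {k : ℕ}

lemma extendChain_boundary (Δ : AbstractSimplicialComplex V) (k : ℕ) (z : Chain Δ (k + 1)) :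
    extendChain Δ k (boundary Δ k z) = chainBoundary (extendChain Δ (k + 1) z) := by
  suffices h : (extendChain Δ k).comp (boundary Δ k) = chainBoundary.comp (extendChain Δ (k + 1))
    from LinearMap.congr_fun h z
  refine Finsupp.lhom_ext fun s c => ?_
  rw [LinearMap.comp_apply, LinearMap.comp_apply, boundary, Finsupp.linearCombination_single,
    map_smul, map_sum, extendChain_single, chainBoundary_eq_sum]
  simp_rw [extendChain_single, linkChain_single]
  rw [← Finset.sum_filter, Finset.filter_mem_eq_inter, Finset.univ_inter,
    ← Finset.sum_coe_sort s.1, Finset.smul_sum]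
  refine Finset.sum_congr rfl fun v _ => ?_
  rw [← Pi.single_smul, smul_eq_mul]
  rfl

lemma range_extendChain (G : SimpleGraph V) (k : ℕ) :
    LinearMap.range (extendChain (cliqueComplex G) k) = cliqueChains G Finset.univ (k + 1) := by
  apply le_antisymm
  · rintro _ ⟨z, rfl⟩
    induction z using Finsupp.induction_linear with
    | zero => exact (map_zero (extendChain (cliqueComplex G) k)).symm ▸ Submodule.zero_mem _
    | add x y hx hy => exact (map_add (extendChain (cliqueComplex G) k) x y).symm ▸
        Submodule.add_mem _ hx hy
    | single s c =>
      rw [extendChain_single]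
      intro t ht
      obtain rfl : t = s.1 := by
        by_contra h
        exact ht (Pi.single_eq_of_ne h _)
      exact ⟨Finset.subset_univ _, s.2.2, s.2.1.2⟩
  · intro z hz
    rw [← Finset.univ_sum_single z]
    refine Submodule.sum_mem _ fun s _ => ?_
    by_cases h : z s = 0
    · rw [h, Pi.single_zero]
      exact Submodule.zero_mem _
    · obtain ⟨-, hcard, hclique⟩ := hz s h
      exact ⟨Finsupp.single ⟨s, ⟨Finset.card_pos.1 (by omega), hclique⟩, hcard⟩ (z s),
        extendChain_single _ _ _⟩

lemma range_boundary_le_cycles {V : Type*} [LinearOrder V] [Finite V]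
    (Δ : AbstractSimplicialComplex V) (k : ℕ) :
    LinearMap.range (boundary Δ k) ≤ cycles Δ k := by
  have := Fintype.ofFinite V
  cases k with
  | zero => exact le_top
  | succ k =>
    rintro _ ⟨z, rfl⟩
    refine extendChain_injective Δ k ?_
    rw [extendChain_boundary, extendChain_boundary, chainBoundary_chainBoundary, map_zero]

lemma map_extendChain_cycles (G : SimpleGraph V) (k : ℕ) :
    (cycles (cliqueComplex G) (k + 1)).map (extendChain (cliqueComplex G) (k + 1)) =
      cliqueCycles G Finset.univ (k + 2) := by
  have hcycle : ∀ y, y ∈ cycles (cliqueComplex G) (k + 1) ↔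
      chainBoundary (extendChain (cliqueComplex G) (k + 1) y) = 0 := fun y => by
    rw [← extendChain_boundary, ← map_zero (extendChain (cliqueComplex G) k),
      (extendChain_injective _ k).eq_iff]
    rfl
  ext z
  rw [cliqueCycles, Submodule.mem_inf, ← range_extendChain, LinearMap.mem_ker]
  constructor
  · rintro ⟨y, hy, rfl⟩
    exact ⟨⟨y, rfl⟩, (hcycle y).1 hy⟩
  · rintro ⟨⟨y, rfl⟩, hy⟩
    exact ⟨y, (hcycle y).2 hy, rfl⟩

lemma map_extendChain_range_boundary (G : SimpleGraph V) (k : ℕ) :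
    (LinearMap.range (boundary (cliqueComplex G) k)).map (extendChain (cliqueComplex G) k) =
      cliqueBoundaries G Finset.univ (k + 1) := by
  rw [cliqueBoundaries, ← range_extendChain, ← LinearMap.range_comp, ← LinearMap.range_comp]
  exact congrArg LinearMap.range (LinearMap.ext (extendChain_boundary (cliqueComplex G) k))

theorem betti_cliqueComplex (G : SimpleGraph V) (hk : 1 ≤ k) :
    betti (cliqueComplex G) k = cliqueBetti G Finset.univ (k + 1) := by
  obtain ⟨k, rfl⟩ : ∃ j, k = j + 1 := ⟨k - 1, by omega⟩
  set Δ := cliqueComplex G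
  have hinj := extendChain_injective Δ (k + 1)
  have hcycles := (Submodule.equivMapOfInjective _ hinj (cycles Δ (k + 1))).finrank_eq
  have hboundaries := (Submodule.equivMapOfInjective _ hinj
    (LinearMap.range (boundary Δ (k + 1)))).finrank_eq
  have hsubmodule :=
    (Submodule.submoduleOfEquivOfLe (range_boundary_le_cycles Δ (k + 1))).finrank_eq
  have hquotient := Submodule.finrank_quotient_add_finrank
    ((LinearMap.range (boundary Δ (k + 1))).submoduleOf (cycles Δ (k + 1)))
  rw [map_extendChain_cycles] at hcycles
  rw [map_extendChain_range_boundary] at hboundaries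
  rw [hsubmodule, hboundaries, hcycles] at hquotient
  exact Nat.eq_sub_of_add_eq hquotient

end Comparison

section Components

variable {V : Type*}

/-- The graph `G` with all edges at vertices of `T` deleted. -/
def isolate (G : SimpleGraph V) (T : Finset V) : SimpleGraph V where
  Adj u v := G.Adj u v ∧ u ∉ T ∧ v ∉ T
  symm := ⟨fun _ _ h => ⟨h.1.symm, h.2.2, h.2.1⟩⟩
  loopless := ⟨fun _ h => h.1.ne rfl⟩

lemma isolate_le (G : SimpleGraph V) (T : Finset V) : isolate G T ≤ G := fun _ _ h => h.1

lemma isolate_empty (G : SimpleGraph V) : isolate G ∅ = G := by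
  ext
  simp [isolate]

lemma isolate_insert [DecidableEq V] (G : SimpleGraph V) (i : V) (T : Finset V) :
    isolate G (insert i T) = isolate (isolate G T) {i} := by
  ext
  simp only [isolate, Finset.mem_insert, Finset.mem_singleton]
  tauto

variable [Fintype V] {G G' : SimpleGraph V} {u v : V}

open Classical in
/-- The vertices of the connected component of `v` in `G`. -/
def componentOf (G : SimpleGraph V) (v : V) : Finset V := Finset.univ.filter (G.Reachable v)

lemma mem_componentOf : u ∈ componentOf G v ↔ G.Reachable v u := by
  simp [componentOf]

lemma mem_componentOf_self (G : SimpleGraph V) (v : V) : v ∈ componentOf G v :=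
  mem_componentOf.2 (SimpleGraph.Reachable.refl v)

lemma componentOf_mono (h : G ≤ G') (v : V) : componentOf G v ⊆ componentOf G' v := fun _ hu =>
  mem_componentOf.2 ((mem_componentOf.1 hu).mono h)

lemma not_adj_of_mem_componentOf {i : V} (hu : u ∈ componentOf G i) (hv : v ∉ componentOf G i) :
    ¬ G.Adj u v := fun h =>
  hv (mem_componentOf.2 ((mem_componentOf.1 hu).trans h.reachable))

end Components

section Remainder

/-- The bound `c ^ (2 m)` for the contribution to `bettiRemainder` of a component with `c` vertices;
components with at most `2 m` vertices do not contribute. -/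
def componentWeight (m c : ℕ) : ℝ := if 2 * m < c then (c : ℝ) ^ (2 * m) else 0

lemma componentWeight_mono (m : ℕ) : Monotone (componentWeight m) := by
  intro a b h
  unfold componentWeight
  split_ifs
  · gcongr
  · omega
  · positivity
  · rfl

variable {V : Type*} [LinearOrder V] [Fintype V] {G : SimpleGraph V} {m : ℕ}

/-- The error in approximating the Betti number by the number of cross-polytopes. -/
def bettiRemainder (G : SimpleGraph V) (W : Finset V) (m : ℕ) : ℝ :=
  (cliqueBetti G W m : ℝ) - crossPolytopeCount G W m

lemma abs_bettiRemainder_le (G : SimpleGraph V) (W : Finset V) (m : ℕ) :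
    |bettiRemainder G W m| ≤ componentWeight m W.card := by
  unfold componentWeight bettiRemainder
  split_ifs with h
  · have hcount : (crossPolytopeCount G W m : ℝ) ≤ (W.card : ℝ) ^ (2 * m) := by
      exact_mod_cast crossPolytopeCount_le G W m
    have hbetti : (cliqueBetti G W m : ℝ) ≤ (W.card : ℝ) ^ (2 * m) := by
      exact_mod_cast (cliqueBetti_le G W m).trans
        (Nat.pow_le_pow_right (by omega) (by omega : m ≤ 2 * m))
    exact abs_sub_le_of_nonneg_of_le (Nat.cast_nonneg _) hbetti (Nat.cast_nonneg _) hcount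
  · rw [cliqueBetti_eq_crossPolytopeCount (by omega), sub_self, abs_zero]

lemma bettiRemainder_union {C D : Finset V} (hno : ∀ u ∈ C, ∀ v ∈ D, ¬ G.Adj u v)
    (hCD : Disjoint C D) (hm : 2 ≤ m) :
    bettiRemainder G (C ∪ D) m = bettiRemainder G C m + bettiRemainder G D m := by
  rw [bettiRemainder, cliqueBetti_union hno hCD hm, crossPolytopeCount_union hno hCD hm,
    bettiRemainder, bettiRemainder]
  push_cast
  ring

lemma bettiRemainder_congr {G' : SimpleGraph V} {W : Finset V}
    (h : ∀ u ∈ W, ∀ v ∈ W, (G.Adj u v ↔ G'.Adj u v)) :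
    bettiRemainder G W m = bettiRemainder G' W m := by
  rw [bettiRemainder, bettiRemainder, cliqueBetti_congr h, crossPolytopeCount_congr h]

lemma bettiRemainder_univ_eq_add_compl {C : Finset V} (hC : ∀ u ∈ C, ∀ v ∉ C, ¬ G.Adj u v)
    (hm : 2 ≤ m) :
    bettiRemainder G Finset.univ m = bettiRemainder G C m + bettiRemainder G Cᶜ m := by
  rw [← bettiRemainder_union (fun u hu v hv => hC u hu v (Finset.mem_compl.1 hv))
    disjoint_compl_right hm, Finset.union_compl]

-- Isolating `i` changes the graph only within the component of `i`.
lemma abs_bettiRemainder_sub_isolate_singleton_le (G : SimpleGraph V) (i : V) (hm : 2 ≤ m) :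
    |bettiRemainder G Finset.univ m - bettiRemainder (isolate G {i}) Finset.univ m| ≤
      2 * componentWeight m (componentOf G i).card := by
  have hno : ∀ u ∈ componentOf G i, ∀ v ∉ componentOf G i, ¬ G.Adj u v := fun u hu v hv =>
    not_adj_of_mem_componentOf hu hv
  have hne : ∀ u ∈ (componentOf G i)ᶜ, u ∉ ({i} : Finset V) := by
    intro u hu h
    rw [Finset.mem_singleton.1 h, Finset.mem_compl] at hu
    exact hu (mem_componentOf_self G i)
  have hcompl : bettiRemainder (isolate G {i}) (componentOf G i)ᶜ m =
      bettiRemainder G (componentOf G i)ᶜ m :=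
    bettiRemainder_congr fun u hu v hv => ⟨fun h => h.1, fun h => ⟨h, hne u hu, hne v hv⟩⟩
  have hno' : ∀ u ∈ componentOf G i, ∀ v ∉ componentOf G i, ¬ (isolate G {i}).Adj u v :=
    fun u hu v hv h => hno u hu v hv h.1
  rw [bettiRemainder_univ_eq_add_compl hno hm, bettiRemainder_univ_eq_add_compl hno' hm, hcompl,
    add_sub_add_right_eq_sub, two_mul]
  exact (abs_sub _ _).trans (add_le_add (abs_bettiRemainder_le _ _ _) (abs_bettiRemainder_le _ _ _))

lemma abs_bettiRemainder_sub_isolate_le (G : SimpleGraph V) (T : Finset V) (hm : 2 ≤ m) :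
    |bettiRemainder G Finset.univ m - bettiRemainder (isolate G T) Finset.univ m| ≤
      ∑ i ∈ T, 2 * componentWeight m (componentOf G i).card := by
  induction T using Finset.induction_on with
  | empty => rw [isolate_empty, sub_self, abs_zero, Finset.sum_empty]
  | insert i T hi ih =>
    rw [Finset.sum_insert hi, isolate_insert]
    have hstep := abs_bettiRemainder_sub_isolate_singleton_le (isolate G T) i hm
    have hmono :=
      componentWeight_mono m (Finset.card_le_card (componentOf_mono (isolate_le G T) i))
    have htri := abs_sub_le (bettiRemainder G Finset.univ m)
      (bettiRemainder (isolate G T) Finset.univ m)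
      (bettiRemainder (isolate (isolate G T) {i}) Finset.univ m)
    linarith

lemma bettiRemainder_eq_zero_of_card_le {W : Finset V} (hW : W.card ≤ 2 * m) :
    bettiRemainder G W m = 0 := by
  rw [bettiRemainder, cliqueBetti_eq_crossPolytopeCount hW, sub_self]

lemma bettiRemainder_eq_zero_of_edgeless (h : ∀ u v, ¬ G.Adj u v) (W : Finset V) (hm : 2 ≤ m) :
    bettiRemainder G W m = 0 := by
  induction W using Finset.induction_on with
  | empty => exact bettiRemainder_eq_zero_of_card_le (Nat.zero_le _)
  | insert i W hi ih =>
    rw [Finset.insert_eq, bettiRemainder_union (fun u _ v _ => h u v)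
      (Finset.disjoint_singleton_left.2 hi) hm, ih, add_zero]
    exact bettiRemainder_eq_zero_of_card_le (by rw [Finset.card_singleton]; omega)

theorem abs_bettiRemainder_le_sum (G : SimpleGraph V) (hm : 2 ≤ m) :
    |bettiRemainder G Finset.univ m| ≤
      ∑ i : V, 2 * componentWeight m (componentOf G i).card := by
  have hisolate := abs_bettiRemainder_sub_isolate_le G Finset.univ hm
  rwa [bettiRemainder_eq_zero_of_edgeless (G := isolate G Finset.univ)
    (fun u v h => h.2.1 (Finset.mem_univ u)) _ hm, sub_zero] at hisolate

end Remainder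

section Poisson

/-- The probability that a Poisson variable with mean `r` equals `n`. -/
def poissonWeight (r : ℝ≥0) (n : ℕ) : ℝ := (poissonMeasure r).real {n}

variable {r a b : ℝ≥0} {g : ℕ → ℝ} {n : ℕ}

lemma poissonWeight_eq (r : ℝ≥0) (n : ℕ) :
    poissonWeight r n = Real.exp (-r) * r ^ n / n.factorial :=
  poissonMeasure_real_singleton r n

lemma poissonWeight_zero (r : ℝ≥0) : poissonWeight r 0 = Real.exp (-r) := by
  simp [poissonWeight_eq]

lemma poissonWeight_nonneg (r : ℝ≥0) (n : ℕ) : 0 ≤ poissonWeight r n := measureReal_nonneg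

lemma poissonWeight_pos (hr : 0 < r) (n : ℕ) : 0 < poissonWeight r n :=
  poissonMeasure_real_singleton_pos n hr

lemma succ_mul_poissonWeight_succ (r : ℝ≥0) (n : ℕ) :
    (n + 1 : ℝ) * poissonWeight r (n + 1) = r * poissonWeight r n := by
  rw [poissonWeight_eq, poissonWeight_eq, Nat.factorial_succ]
  push_cast
  field_simp
  ring

lemma poissonWeight_succ (r : ℝ≥0) (n : ℕ) :
    poissonWeight r (n + 1) = r * poissonWeight r n / (n + 1) := by
  rw [eq_div_iff (by positivity), mul_comm, succ_mul_poissonWeight_succ]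

lemma poissonWeight_mul_poissonWeight_succ_le {j : ℕ} (hjn : j ≤ n) (r : ℝ≥0) :
    poissonWeight r j * poissonWeight r (n + 1) ≤ poissonWeight r (j + 1) * poissonWeight r n := by
  have hprod : 0 ≤ r * poissonWeight r j * poissonWeight r n :=
    mul_nonneg (mul_nonneg r.2 (poissonWeight_nonneg r j)) (poissonWeight_nonneg r n)
  rw [poissonWeight_succ, poissonWeight_succ]
  calc poissonWeight r j * (r * poissonWeight r n / (n + 1))
      = r * poissonWeight r j * poissonWeight r n / (n + 1) := by ring
    _ ≤ r * poissonWeight r j * poissonWeight r n / (j + 1) := by gcongr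
    _ = r * poissonWeight r j / (j + 1) * poissonWeight r n := by ring

lemma hasSum_poissonWeight (r : ℝ≥0) : HasSum (poissonWeight r) 1 := by
  simpa only [funext (poissonWeight_eq r)] using hasSum_one_poissonMeasure r

lemma integrable_poissonMeasure_of_abs_le (hg : ∀ n, |g n| ≤ 1) (r : ℝ≥0) :
    Integrable g (poissonMeasure r) :=
  Integrable.of_bound .of_discrete 1 (Eventually.of_forall hg)

lemma hasSum_poissonWeight_mul (hg : ∀ n, |g n| ≤ 1) (r : ℝ≥0) :
    HasSum (fun n => poissonWeight r n * g n) (∫ n, g n ∂(poissonMeasure r)) := by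
  simpa only [poissonWeight_eq, smul_eq_mul] using
    hasSum_integral_poissonMeasure (integrable_poissonMeasure_of_abs_le hg r)

lemma exp_sub_mul_poissonWeight_le (hab : a ≤ b) (n : ℕ) :
    Real.exp ((a : ℝ) - b) * poissonWeight a n ≤ poissonWeight b n := by
  have hexp : Real.exp ((a : ℝ) - b) * Real.exp (-a) = Real.exp (-b) := by
    rw [← Real.exp_add]
    congr 1
    ring
  rw [poissonWeight_eq, poissonWeight_eq, mul_div_assoc, ← mul_assoc, hexp, mul_div_assoc]
  gcongr

lemma abs_integral_poissonMeasure_sub_exp_mul_le (hab : a ≤ b) (hg : ∀ n, |g n| ≤ 1) :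
    |∫ n, g n ∂(poissonMeasure b) - Real.exp ((a : ℝ) - b) * ∫ n, g n ∂(poissonMeasure a)| ≤
      1 - Real.exp ((a : ℝ) - b) := by
  have hdiff := (hasSum_poissonWeight_mul hg b).sub
    ((hasSum_poissonWeight_mul hg a).mul_left (Real.exp ((a : ℝ) - b)))
  have hone := (hasSum_poissonWeight b).sub
    ((hasSum_poissonWeight a).mul_left (Real.exp ((a : ℝ) - b)))
  rw [mul_one] at hone
  have hterm : ∀ n, |poissonWeight b n * g n -
      Real.exp ((a : ℝ) - b) * (poissonWeight a n * g n)| ≤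
      poissonWeight b n - Real.exp ((a : ℝ) - b) * poissonWeight a n := fun n => by
    have hle := sub_nonneg.2 (exp_sub_mul_poissonWeight_le hab n)
    rw [← mul_assoc, ← sub_mul, abs_mul, abs_of_nonneg hle]
    exact mul_le_of_le_one_right hle (hg n)
  exact abs_le.2 ⟨hasSum_le (fun n => (abs_le.1 (hterm n)).1) hone.neg hdiff,
    hasSum_le (fun n => (abs_le.1 (hterm n)).2) hdiff hone⟩

lemma abs_integral_poissonMeasure_sub_le (a b : ℝ≥0) (hg : ∀ n, |g n| ≤ 1) :
    |∫ n, g n ∂(poissonMeasure a) - ∫ n, g n ∂(poissonMeasure b)| ≤ 2 * |(a : ℝ) - b| := by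
  wlog hab : a ≤ b generalizing a b
  · rw [abs_sub_comm, abs_sub_comm (a : ℝ)]
    exact this b a (le_of_not_ge hab)
  have hab' : (a : ℝ) - b ≤ 0 := sub_nonpos.2 (NNReal.coe_le_coe.2 hab)
  set t := Real.exp ((a : ℝ) - b)
  set A := ∫ n, g n ∂(poissonMeasure a)
  set B := ∫ n, g n ∂(poissonMeasure b)
  have ht_le : t ≤ 1 := Real.exp_le_one_iff.2 hab'
  have ht_ge : (a : ℝ) - b + 1 ≤ t := Real.add_one_le_exp _
  have hA : |A| ≤ 1 := by
    simpa using norm_integral_le_of_norm_le_const (μ := poissonMeasure a) (f := g) (C := 1)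
      (Eventually.of_forall hg)
  calc |A - B| = |(B - t * A) - (1 - t) * A| := by rw [abs_sub_comm]; ring_nf
    _ ≤ |B - t * A| + |(1 - t) * A| := abs_sub _ _
    _ ≤ (1 - t) + (1 - t) * 1 := by
        rw [abs_mul, abs_of_nonneg (sub_nonneg.2 ht_le)]
        exact add_le_add (abs_integral_poissonMeasure_sub_exp_mul_le hab hg)
          (mul_le_mul_of_nonneg_left hA (sub_nonneg.2 ht_le))
    _ ≤ 2 * |(a : ℝ) - b| := by
        rw [abs_of_nonpos hab']
        linarith

end Poisson

section SteinEquation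

/-- The solution of the Stein equation `r * f (n + 1) - n * f n = g n - E g` for the Poisson
distribution with mean `r`; its value at `0` does not enter the equation. -/
def steinSolution (r : ℝ≥0) (g : ℕ → ℝ) : ℕ → ℝ
  | 0 => 0
  | n + 1 => (∑ j ∈ Finset.range (n + 1),
      poissonWeight r j * (g j - ∫ n, g n ∂(poissonMeasure r))) / (r * poissonWeight r n)

variable {r : ℝ≥0} {g : ℕ → ℝ}

lemma mul_steinSolution_succ_sub (hr : 0 < r) (g : ℕ → ℝ) (n : ℕ) :
    (r : ℝ) * steinSolution r g (n + 1) - n * steinSolution r g n =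
      g n - ∫ n, g n ∂(poissonMeasure r) := by
  have : (0 : ℝ) < r := hr
  have := poissonWeight_pos hr n
  cases n with
  | zero =>
    simp only [steinSolution, zero_add, Finset.range_one, Finset.sum_singleton, CharP.cast_eq_zero,
      mul_zero, sub_zero]
    field_simp
  | succ n =>
    simp only [steinSolution]
    have := poissonWeight_pos hr n
    rw [Finset.sum_range_succ _ (n + 1), ← succ_mul_poissonWeight_succ r n]
    push_cast
    field_simp
    ring

lemma sum_poissonWeight_mul_le (r : ℝ≥0) (n : ℕ) :
    (∑ j ∈ Finset.range (n + 1), poissonWeight r j) * poissonWeight r (n + 1) ≤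
      poissonWeight r n *
        (∑ j ∈ Finset.range (n + 2), poissonWeight r j - poissonWeight r 0) := by
  rw [Finset.sum_range_succ' _ (n + 1), add_sub_cancel_right, Finset.sum_mul, mul_comm,
    Finset.sum_mul]
  exact Finset.sum_le_sum fun j hj =>
    poissonWeight_mul_poissonWeight_succ_le (Nat.lt_succ_iff.1 (Finset.mem_range.1 hj)) r

lemma poissonWeight_mul_one_sub_sum_le (r : ℝ≥0) (n : ℕ) :
    poissonWeight r n * (1 - ∑ j ∈ Finset.range (n + 2), poissonWeight r j) ≤
      poissonWeight r (n + 1) * (1 - ∑ j ∈ Finset.range (n + 1), poissonWeight r j) := by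
  have htail : ∀ n, HasSum (fun j => poissonWeight r (j + n))
      (1 - ∑ j ∈ Finset.range n, poissonWeight r j) := fun n =>
    (hasSum_nat_add_iff' n).2 (hasSum_poissonWeight r)
  exact hasSum_le
    (fun j => poissonWeight_mul_poissonWeight_succ_le (by omega : n ≤ j + (n + 1)) r)
    ((htail (n + 2)).mul_left _) ((htail (n + 1)).mul_left _)

lemma sum_poissonWeight_mul_sub (r : ℝ≥0) (g : ℕ → ℝ) (e : ℝ) (n : ℕ) :
    ∑ j ∈ Finset.range n, poissonWeight r j * (g j - e) =
      ∑ j ∈ Finset.range n, poissonWeight r j * g j -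
        (∑ j ∈ Finset.range n, poissonWeight r j) * e := by
  simp only [mul_sub, Finset.sum_sub_distrib, Finset.sum_mul]

-- The left hand side is the sum of `A (p (1 - (F + p')) - p' (1 - F))`,
-- `(e - (A + p' x)) (F p' - p (F + p'))` and `x p' (p (1 - (F + p')) + F p')`.
lemma sub_mul_sub_sub_mul_le {A F e x p p' p₀ : ℝ} (hA : 0 ≤ A) (hF : 0 ≤ F) (hp : 0 ≤ p)
    (hp' : 0 ≤ p') (hp₀ : 0 ≤ p₀) (hx : x ≤ 1) (hAe : A + p' * x ≤ e) (hF_le : F + p' ≤ 1)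
    (hhead : F * p' ≤ p * (F + p' - p₀)) (htail : p * (1 - (F + p')) ≤ p' * (1 - F)) :
    (A + p' * x - (F + p') * e) * p - (A - F * e) * p' ≤ (1 - p₀) * (p * p') := by
  have hterm₁ : A * (p * (1 - (F + p')) - p' * (1 - F)) ≤ 0 :=
    mul_nonpos_of_nonneg_of_nonpos hA (by linarith)
  have hterm₂ : (e - (A + p' * x)) * (F * p' - p * (F + p')) ≤ 0 :=
    mul_nonpos_of_nonneg_of_nonpos (by linarith) (by linarith [mul_nonneg hp hp₀])
  have hterm₃ : x * (p' * (p * (1 - (F + p')) + F * p')) ≤ p' * (p * (1 - p₀)) := by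
    have hpos : 0 ≤ p * (1 - (F + p')) + F * p' :=
      add_nonneg (mul_nonneg hp (by linarith)) (mul_nonneg hF hp')
    exact (mul_le_of_le_one_left (mul_nonneg hp' hpos) hx).trans
      (mul_le_mul_of_nonneg_left (by linarith) hp')
  linarith

lemma steinSolution_sub_le (hr : 0 < r) (hg₀ : ∀ n, 0 ≤ g n) (hg₁ : ∀ n, g n ≤ 1) (n : ℕ) :
    steinSolution r g (n + 2) - steinSolution r g (n + 1) ≤ (1 - poissonWeight r 0) / r := by
  have hr' : (0 : ℝ) < r := hr
  have hw := poissonWeight_nonneg r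
  have hE := hasSum_poissonWeight_mul (fun n => abs_le.2 ⟨by linarith [hg₀ n], hg₁ n⟩) r
  have hterm : ∀ j, 0 ≤ poissonWeight r j * g j := fun j => mul_nonneg (hw j) (hg₀ j)
  have hA_le := sum_le_hasSum (Finset.range (n + 2)) (fun j _ => hterm j) hE
  have hF_le := sum_le_hasSum (Finset.range (n + 2)) (fun j _ => hw j) (hasSum_poissonWeight r)
  have hhead := sum_poissonWeight_mul_le r n
  have htail := poissonWeight_mul_one_sub_sum_le r n
  rw [Finset.sum_range_succ _ (n + 1)] at hA_le hF_le hhead htail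
  have hnum := sub_mul_sub_sub_mul_le (Finset.sum_nonneg fun j _ => hterm j)
    (Finset.sum_nonneg fun j _ => hw j) (hw n) (hw (n + 1)) (hw 0) (hg₁ (n + 1)) hA_le hF_le
    hhead htail
  have hp := poissonWeight_pos hr n
  have hp' := poissonWeight_pos hr (n + 1)
  simp only [steinSolution, sum_poissonWeight_mul_sub]
  rw [Finset.sum_range_succ _ (n + 1), Finset.sum_range_succ _ (n + 1),
    div_sub_div _ _ (by positivity) (by positivity), div_le_div_iff₀ (by positivity) hr']
  linarith [mul_le_mul_of_nonneg_right hnum (mul_pos hr' hr').le]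

lemma steinSolution_const_add_mul (hg : ∀ n, |g n| ≤ 1) (a b : ℝ) (n : ℕ) :
    steinSolution r (fun n => a + b * g n) n = b * steinSolution r g n := by
  cases n with
  | zero => exact (mul_zero b).symm
  | succ n =>
    have hint : ∫ n, (a + b * g n) ∂(poissonMeasure r) =
        a + b * ∫ n, g n ∂(poissonMeasure r) := by
      rw [integral_add (integrable_const a)
        ((integrable_poissonMeasure_of_abs_le hg r).const_mul b), integral_const_mul]
      simp
    simp only [steinSolution, hint, add_sub_add_left_eq_sub, ← mul_sub, mul_left_comm _ b,
      ← Finset.mul_sum, mul_div_assoc]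

lemma one_sub_poissonWeight_zero_div_le (hr : 0 < r) :
    (1 - poissonWeight r 0) / r ≤ min 1 (1 / (r : ℝ)) := by
  have hr' : (0 : ℝ) < r := hr
  refine le_min ?_ ?_
  · rw [div_le_one hr', poissonWeight_zero]
    linarith [Real.add_one_le_exp (-(r : ℝ))]
  · gcongr
    linarith [poissonWeight_nonneg r 0]

lemma abs_steinSolution_sub_le (hr : 0 < r) (hg : ∀ n, |g n| ≤ 1) (n : ℕ) :
    |steinSolution r g (n + 2) - steinSolution r g (n + 1)| ≤ 2 * min 1 (1 / (r : ℝ)) := by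
  have hle := fun n => (abs_le.1 (hg n)).1
  have hge := fun n => (abs_le.1 (hg n)).2
  have hupper := steinSolution_sub_le hr (g := fun n => 1 / 2 + 1 / 2 * g n)
    (fun n => by linarith [hle n]) (fun n => by linarith [hge n]) n
  have hlower := steinSolution_sub_le hr (g := fun n => 1 / 2 + -1 / 2 * g n)
    (fun n => by linarith [hge n]) (fun n => by linarith [hle n]) n
  rw [steinSolution_const_add_mul hg, steinSolution_const_add_mul hg] at hupper hlower
  have hbound := one_sub_poissonWeight_zero_div_le hr
  rw [abs_le]
  constructor <;> linarith

end SteinEquation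

section ChenStein

variable {Ω : Type*} [MeasurableSpace Ω] {P : Measure Ω} {ι : Type*} {ξ : ι → Ω → ℕ}

lemma integrable_comp_of_le [IsFiniteMeasure P] {U : Ω → ℕ} (hU : Measurable U) {N : ℕ}
    (hN : ∀ ω, U ω ≤ N) (f : ℕ → ℝ) : Integrable (fun ω => f (U ω)) P := by
  refine Integrable.of_bound ((measurable_from_nat (f := f)).comp hU).aestronglyMeasurable
    (∑ n ∈ Finset.range (N + 1), |f n|) (Eventually.of_forall fun ω => ?_)
  exact Finset.single_le_sum (f := fun n => |f n|) (fun n _ => abs_nonneg _)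
    (Finset.mem_range.2 (Nat.lt_succ_of_le (hN ω)))

lemma abs_sub_le_mul_of_abs_succ_sub_le {f : ℕ → ℝ} {K : ℝ} (hf : ∀ n, |f (n + 1) - f n| ≤ K)
    (b c : ℕ) : |f (b + c) - f b| ≤ K * c := by
  induction c with
  | zero => simp
  | succ c ih =>
    have htri := abs_sub_le (f (b + (c + 1))) (f (b + c)) (f b)
    have hstep : |f (b + (c + 1)) - f (b + c)| ≤ K := hf (b + c)
    push_cast
    linarith

lemma abs_comp_sum_succ_sub_filter_le {f : ℕ → ℝ} {K : ℝ} (hf : ∀ n, |f (n + 2) - f (n + 1)| ≤ K)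
    (s : Finset ι) (p : ι → Prop) [DecidablePred p] (a : ι → ℕ) :
    |f (∑ j ∈ s, a j + 1) - f (∑ j ∈ s.filter (fun j => ¬ p j), a j + 1)| ≤
      K * ∑ j ∈ s.filter p, (a j : ℝ) := by
  have hle := abs_sub_le_mul_of_abs_succ_sub_le (f := fun n => f (n + 1)) hf
    (∑ j ∈ s.filter (fun j => ¬ p j), a j) (∑ j ∈ s.filter p, a j)
  rw [add_comm (∑ j ∈ s.filter (fun j => ¬ p j), a j),
    Finset.sum_filter_add_sum_filter_not] at hle
  exact_mod_cast hle

/-- The variables `ξ i`, `i ∈ s`, are indicators with dependency neighbourhoods given by `nb`: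
each `ξ i` is independent of the sum of the `ξ j` with `j` outside the neighbourhood of `i`. -/
structure IsLocallyDependent (P : Measure Ω) (s : Finset ι) (ξ : ι → Ω → ℕ) (nb : ι → ι → Prop)
    [DecidableRel nb] : Prop where
  measurable : ∀ i, Measurable (ξ i)
  le_one : ∀ i ω, ξ i ω ≤ 1
  refl : ∀ i ∈ s, nb i i
  indepFun : ∀ i ∈ s, IndepFun (ξ i) (fun ω => ∑ j ∈ s.filter (fun j => ¬ nb i j), ξ j ω) P

/-- The error term of the Chen–Stein bound for a family of indicators `ξ i`, `i ∈ s`, with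
dependency neighbourhoods given by `nb`. -/
def dependencyError [DecidableEq ι] (P : Measure Ω) (s : Finset ι) (ξ : ι → Ω → ℕ)
    (nb : ι → ι → Prop) [DecidableRel nb] : ℝ :=
  ∑ i ∈ s, (∑ j ∈ s.filter (nb i), (∫ ω, (ξ i ω : ℝ) ∂P) * ∫ ω, (ξ j ω : ℝ) ∂P) +
  ∑ i ∈ s, (∑ j ∈ (s.filter (nb i)).erase i, ∫ ω, (ξ i ω : ℝ) * ξ j ω ∂P)

section Indicators

variable (hmeas : ∀ i, Measurable (ξ i)) (h01 : ∀ i ω, ξ i ω ≤ 1)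
include hmeas h01

lemma integrable_comp_sum [IsFiniteMeasure P] (t : Finset ι) (f : ℕ → ℝ) :
    Integrable (fun ω => f (∑ j ∈ t, ξ j ω)) P :=
  integrable_comp_of_le (Finset.measurable_sum t fun j _ => hmeas j)
    (fun ω => Finset.sum_le_card_nsmul t (fun j => ξ j ω) 1 fun j _ => h01 j ω) f

lemma integrable_cast [IsFiniteMeasure P] (i : ι) : Integrable (fun ω => (ξ i ω : ℝ)) P :=
  integrable_comp_of_le (hmeas i) (h01 i) fun n => (n : ℝ)

lemma integrable_mul_comp_sum [IsFiniteMeasure P] (i : ι) (t : Finset ι) (f : ℕ → ℝ) :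
    Integrable (fun ω => (ξ i ω : ℝ) * f (∑ j ∈ t, ξ j ω)) P := by
  refine (integrable_comp_sum hmeas h01 t f).bdd_mul (c := 1)
    (integrable_cast hmeas h01 i).aestronglyMeasurable (Eventually.of_forall fun ω => ?_)
  rw [Real.norm_natCast]
  exact_mod_cast h01 i ω

lemma integrable_mul_cast [IsFiniteMeasure P] (i j : ι) :
    Integrable (fun ω => (ξ i ω : ℝ) * ξ j ω) P := by
  simpa only [Finset.sum_singleton] using
    integrable_mul_comp_sum hmeas h01 i {j} fun n => (n : ℝ)

end Indicators

namespace IsLocallyDependent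

variable {s : Finset ι} {nb : ι → ι → Prop} [DecidableRel nb] {i : ι} {f : ℕ → ℝ} {K : ℝ}
  (h : IsLocallyDependent P s ξ nb)
include h

lemma integral_mul_comp_eq (hi : i ∈ s) (f : ℕ → ℝ) :
    ∫ ω, (ξ i ω : ℝ) * f (∑ j ∈ s.filter (fun j => ¬ nb i j), ξ j ω) ∂P =
      (∫ ω, (ξ i ω : ℝ) ∂P) * ∫ ω, f (∑ j ∈ s.filter (fun j => ¬ nb i j), ξ j ω) ∂P :=
  ((h.indepFun i hi).comp (_mγ := Real.measurableSpace) (_mγ' := Real.measurableSpace)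
    (φ := fun n : ℕ => (n : ℝ)) (ψ := f) measurable_from_nat
    measurable_from_nat).integral_fun_mul_eq_mul_integral
      (measurable_from_nat.comp (h.measurable i)).aestronglyMeasurable
      (measurable_from_nat.comp
        (Finset.measurable_sum _ fun j _ => h.measurable j)).aestronglyMeasurable

lemma cast_eq_zero_or_one (i : ι) (ω : Ω) : (ξ i ω : ℝ) = 0 ∨ (ξ i ω : ℝ) = 1 := by
  rcases Nat.le_one_iff_eq_zero_or_eq_one.1 (h.le_one i ω) with h0 | h1
  · exact Or.inl (by rw [h0, Nat.cast_zero])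
  · exact Or.inr (by rw [h1, Nat.cast_one])

variable [DecidableEq ι]

lemma abs_mul_comp_succ_sub_le (hi : i ∈ s) (hf : ∀ n, |f (n + 2) - f (n + 1)| ≤ K) (ω : Ω) :
    |(ξ i ω : ℝ) * f (∑ j ∈ s.filter (fun j => ¬ nb i j), ξ j ω + 1) -
      ξ i ω * f (∑ j ∈ s, ξ j ω)| ≤
      K * ∑ j ∈ (s.filter (nb i)).erase i, (ξ i ω : ℝ) * ξ j ω := by
  rw [← Finset.mul_sum]
  rcases h.cast_eq_zero_or_one i ω with h0 | h1
  · simp [h0]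
  · have hone : ξ i ω = 1 := by exact_mod_cast h1
    have hsum : ∑ j ∈ s, ξ j ω = ∑ j ∈ s.filter (fun j => ¬ nb i j), ξ j ω +
        ∑ j ∈ (s.filter (nb i)).erase i, ξ j ω + 1 := by
      rw [← Finset.sum_filter_add_sum_filter_not s (nb i),
        ← Finset.add_sum_erase _ _ (Finset.mem_filter.2 ⟨hi, h.refl i hi⟩), hone]
      ring
    have hle := abs_sub_le_mul_of_abs_succ_sub_le (f := fun n => f (n + 1)) hf
      (∑ j ∈ s.filter (fun j => ¬ nb i j), ξ j ω) (∑ j ∈ (s.filter (nb i)).erase i, ξ j ω)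
    rw [← hsum, abs_sub_comm] at hle
    rw [h1, one_mul, one_mul, one_mul]
    exact_mod_cast hle

-- Removing the neighbourhood of `i` from the sum makes the two factors independent.
lemma abs_integral_mul_integral_sub_le [IsFiniteMeasure P] (hi : i ∈ s)
    (hf : ∀ n, |f (n + 2) - f (n + 1)| ≤ K) :
    |(∫ ω, (ξ i ω : ℝ) ∂P) * (∫ ω, f (∑ j ∈ s, ξ j ω + 1) ∂P) -
      ∫ ω, (ξ i ω : ℝ) * f (∑ j ∈ s, ξ j ω) ∂P| ≤
      K * (∑ j ∈ s.filter (nb i), (∫ ω, (ξ i ω : ℝ) ∂P) * ∫ ω, (ξ j ω : ℝ) ∂P +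
        ∑ j ∈ (s.filter (nb i)).erase i, ∫ ω, (ξ i ω : ℝ) * ξ j ω ∂P) := by
  have hcomp := fun t => integrable_comp_sum (P := P) h.measurable h.le_one t
  have hmul := fun t => integrable_mul_comp_sum (P := P) h.measurable h.le_one i t
  have hmean : 0 ≤ ∫ ω, (ξ i ω : ℝ) ∂P := integral_nonneg fun ω => Nat.cast_nonneg _
  set far := s.filter fun j => ¬ nb i j
  have hfirst : |∫ ω, (f (∑ j ∈ s, ξ j ω + 1) - f (∑ j ∈ far, ξ j ω + 1)) ∂P| ≤
      K * ∑ j ∈ s.filter (nb i), ∫ ω, (ξ j ω : ℝ) ∂P := by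
    rw [← integral_finsetSum _ fun j _ => integrable_cast h.measurable h.le_one j,
      ← integral_const_mul]
    exact norm_integral_le_of_norm_le ((integrable_finsetSum _ fun j _ =>
      integrable_cast h.measurable h.le_one j).const_mul K)
      (Eventually.of_forall fun ω => (Real.norm_eq_abs _).trans_le
        (abs_comp_sum_succ_sub_filter_le hf s (nb i) fun j => ξ j ω))
  have hsecond : |∫ ω, ((ξ i ω : ℝ) * f (∑ j ∈ far, ξ j ω + 1) -
      ξ i ω * f (∑ j ∈ s, ξ j ω)) ∂P| ≤
      K * ∑ j ∈ (s.filter (nb i)).erase i, ∫ ω, (ξ i ω : ℝ) * ξ j ω ∂P := by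
    rw [← integral_finsetSum _ fun j _ => integrable_mul_cast h.measurable h.le_one i j,
      ← integral_const_mul]
    exact norm_integral_le_of_norm_le ((integrable_finsetSum _ fun j _ =>
      integrable_mul_cast h.measurable h.le_one i j).const_mul K)
      (Eventually.of_forall fun ω => (Real.norm_eq_abs _).trans_le
        (h.abs_mul_comp_succ_sub_le hi hf ω))
  rw [integral_sub (hcomp s fun n => f (n + 1)) (hcomp far fun n => f (n + 1))] at hfirst
  rw [integral_sub (hmul far fun n => f (n + 1)) (hmul s f),
    h.integral_mul_comp_eq hi fun n => f (n + 1)] at hsecond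
  refine (abs_sub_le _ _ _).trans ((add_le_add ?_ hsecond).trans_eq (mul_add _ _ _).symm)
  rw [← mul_sub, abs_mul, abs_of_nonneg hmean, ← Finset.mul_sum, mul_left_comm]
  exact mul_le_mul_of_nonneg_left hfirst hmean

variable [IsProbabilityMeasure P]

theorem abs_integral_sub_poisson_le {r : ℝ≥0} (hr : 0 < r)
    (hmean : (r : ℝ) = ∑ i ∈ s, ∫ ω, (ξ i ω : ℝ) ∂P) {g : ℕ → ℝ} (hg : ∀ n, |g n| ≤ 1) :
    |∫ ω, g (∑ i ∈ s, ξ i ω) ∂P - ∫ n, g n ∂(poissonMeasure r)| ≤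
      2 * min 1 (1 / (r : ℝ)) * dependencyError P s ξ nb := by
  set f := steinSolution r g
  have hcomp := integrable_comp_sum (P := P) h.measurable h.le_one s
  have hmul := fun i => integrable_mul_comp_sum (P := P) h.measurable h.le_one i s
  have hstein : ∀ ω, g (∑ i ∈ s, ξ i ω) - ∫ n, g n ∂(poissonMeasure r) =
      r * f (∑ j ∈ s, ξ j ω + 1) - ∑ i ∈ s, (ξ i ω : ℝ) * f (∑ j ∈ s, ξ j ω) := fun ω => by
    rw [← mul_steinSolution_succ_sub hr, ← Finset.sum_mul, Nat.cast_sum]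
  have hdiff : ∫ ω, g (∑ i ∈ s, ξ i ω) ∂P - ∫ n, g n ∂(poissonMeasure r) =
      ∑ i ∈ s, ((∫ ω, (ξ i ω : ℝ) ∂P) * (∫ ω, f (∑ j ∈ s, ξ j ω + 1) ∂P) -
        ∫ ω, (ξ i ω : ℝ) * f (∑ j ∈ s, ξ j ω) ∂P) := by
    calc _ = ∫ ω, (g (∑ i ∈ s, ξ i ω) - ∫ n, g n ∂(poissonMeasure r)) ∂P := by
          rw [integral_sub (hcomp g) (integrable_const _), integral_const, probReal_univ, one_smul]
      _ = _ := by
          simp_rw [hstein]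
          rw [integral_sub ((hcomp fun n => f (n + 1)).const_mul _)
            (integrable_finsetSum _ fun i _ => hmul i f), integral_const_mul,
            integral_finsetSum _ fun i _ => hmul i f, Finset.sum_sub_distrib, ← Finset.sum_mul,
            hmean]
  rw [hdiff, dependencyError, ← Finset.sum_add_distrib, Finset.mul_sum]
  exact (Finset.abs_sum_le_sum_abs _ _).trans (Finset.sum_le_sum fun i hi =>
    h.abs_integral_mul_integral_sub_le hi (abs_steinSolution_sub_le hr hg))

lemma integral_mul_sum_eq (hi : i ∈ s) :
    ∫ ω, (ξ i ω : ℝ) * ∑ j ∈ s, (ξ j ω : ℝ) ∂P =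
      (∫ ω, (ξ i ω : ℝ) ∂P) * (∑ j ∈ s, ∫ ω, (ξ j ω : ℝ) ∂P) + ∫ ω, (ξ i ω : ℝ) ∂P +
      ∑ j ∈ (s.filter (nb i)).erase i, (∫ ω, (ξ i ω : ℝ) * ξ j ω ∂P) -
      ∑ j ∈ s.filter (nb i), (∫ ω, (ξ i ω : ℝ) ∂P) * ∫ ω, (ξ j ω : ℝ) ∂P := by
  have hint := integrable_cast (P := P) h.measurable h.le_one
  have hmul := integrable_mul_cast (P := P) h.measurable h.le_one i
  have hindep := h.integral_mul_comp_eq hi fun n => (n : ℝ)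
  simp only [Nat.cast_sum, Finset.mul_sum] at hindep
  rw [integral_finsetSum _ fun j _ => hmul j, integral_finsetSum _ fun j _ => hint j] at hindep
  have hsq : ∫ ω, (ξ i ω : ℝ) * ξ i ω ∂P = ∫ ω, (ξ i ω : ℝ) ∂P :=
    integral_congr_ae (Eventually.of_forall fun ω => by
      rcases h.cast_eq_zero_or_one i ω with h0 | h1 <;> simp [*])
  simp_rw [Finset.mul_sum]
  rw [integral_finsetSum _ fun j _ => hmul j, ← Finset.sum_filter_add_sum_filter_not s (nb i),
    hindep, ← Finset.add_sum_erase _ _ (Finset.mem_filter.2 ⟨hi, h.refl i hi⟩), hsq,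
    ← Finset.sum_filter_add_sum_filter_not s (nb i)
      fun j => (∫ ω, (ξ i ω : ℝ) ∂P) * ∫ ω, (ξ j ω : ℝ) ∂P, Finset.mul_sum]
  ring

theorem abs_variance_sub_mean_le :
    |variance (fun ω => ((∑ i ∈ s, ξ i ω : ℕ) : ℝ)) P - ∑ i ∈ s, ∫ ω, (ξ i ω : ℝ) ∂P| ≤
      dependencyError P s ξ nb := by
  have hint := integrable_cast (P := P) h.measurable h.le_one
  have hmul := integrable_mul_cast (P := P) h.measurable h.le_one
  have hnonneg : ∀ i, 0 ≤ ∫ ω, (ξ i ω : ℝ) ∂P := fun i => integral_nonneg fun ω =>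
    Nat.cast_nonneg _
  have hL2 : MemLp (fun ω => ∑ i ∈ s, (ξ i ω : ℝ)) 2 P :=
    memLp_finsetSum s fun i _ => MemLp.of_bound (hint i).aestronglyMeasurable 1
      (Eventually.of_forall fun ω => by rw [Real.norm_natCast]; exact_mod_cast h.le_one i ω)
  have hsecond : ∫ ω, (∑ i ∈ s, (ξ i ω : ℝ)) ^ 2 ∂P =
      ∑ i ∈ s, ∫ ω, (ξ i ω : ℝ) * ∑ j ∈ s, (ξ j ω : ℝ) ∂P := by
    rw [← integral_finsetSum]
    · simp_rw [sq, Finset.sum_mul]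
    · intro i _
      simp_rw [Finset.mul_sum]
      exact integrable_finsetSum _ fun j _ => hmul i j
  have hvar : variance (fun ω => ∑ i ∈ s, (ξ i ω : ℝ)) P - ∑ i ∈ s, ∫ ω, (ξ i ω : ℝ) ∂P =
      ∑ i ∈ s, (∑ j ∈ (s.filter (nb i)).erase i, (∫ ω, (ξ i ω : ℝ) * ξ j ω ∂P)) -
      ∑ i ∈ s, ∑ j ∈ s.filter (nb i), (∫ ω, (ξ i ω : ℝ) ∂P) * ∫ ω, (ξ j ω : ℝ) ∂P := by
    rw [variance_eq_sub hL2]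
    simp only [Pi.pow_apply]
    rw [hsecond, integral_finsetSum _ fun i _ => hint i,
      Finset.sum_congr rfl fun i hi => h.integral_mul_sum_eq hi, Finset.sum_sub_distrib,
      Finset.sum_add_distrib, Finset.sum_add_distrib, ← Finset.sum_mul]
    ring
  simp only [Nat.cast_sum]
  have hfirst : 0 ≤ ∑ i ∈ s, ∑ j ∈ s.filter (nb i),
      (∫ ω, (ξ i ω : ℝ) ∂P) * ∫ ω, (ξ j ω : ℝ) ∂P :=
    Finset.sum_nonneg fun i _ => Finset.sum_nonneg fun j _ => mul_nonneg (hnonneg i) (hnonneg j)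
  have hjoint : 0 ≤ ∑ i ∈ s, ∑ j ∈ (s.filter (nb i)).erase i, ∫ ω, (ξ i ω : ℝ) * ξ j ω ∂P :=
    Finset.sum_nonneg fun i _ => Finset.sum_nonneg fun j _ => integral_nonneg fun ω => by positivity
  rw [hvar, dependencyError, abs_le]
  constructor <;> linarith

end IsLocallyDependent

end ChenStein

section EfronStein

section Bounded

lemma abs_sub_sq_le_of_abs_le {α : Type*} {F G : α → ℝ} {B : ℝ} (hFB : ∀ x, |F x| ≤ B)
    (hGB : ∀ x, |G x| ≤ B) (x : α) :
    |(F x - G x) ^ 2| ≤ (2 * B) ^ 2 := by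
  rw [abs_pow]
  exact pow_le_pow_left₀ (abs_nonneg _)
    ((abs_sub _ _).trans (by linarith [hFB x, hGB x])) 2

variable {α : Type*} [MeasurableSpace α] {ν : Measure α} {F : α → ℝ} {B : ℝ}

lemma integrable_of_abs_le [IsFiniteMeasure ν] (hF : Measurable F) (hB : ∀ x, |F x| ≤ B) :
    Integrable F ν :=
  Integrable.of_bound hF.aestronglyMeasurable B (Eventually.of_forall hB)

variable [IsProbabilityMeasure ν]

lemma variance_eq_sub_of_abs_le (hF : Measurable F) (hB : ∀ x, |F x| ≤ B) :
    variance F ν = ∫ x, F x ^ 2 ∂ν - (∫ x, F x ∂ν) ^ 2 :=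
  variance_eq_sub (MemLp.of_bound hF.aestronglyMeasurable B (Eventually.of_forall hB))

lemma sq_integral_le (hF : Measurable F) (hB : ∀ x, |F x| ≤ B) :
    (∫ x, F x ∂ν) ^ 2 ≤ ∫ x, F x ^ 2 ∂ν :=
  sub_nonneg.1 ((variance_nonneg F ν).trans_eq (variance_eq_sub_of_abs_le hF hB))

lemma variance_le_integral_sub_const_sq (hF : Measurable F) (c : ℝ) :
    variance F ν ≤ ∫ x, (F x - c) ^ 2 ∂ν :=
  (variance_sub_const hF.aestronglyMeasurable c).symm.trans_le
    (variance_le_expectation_sq (hF.sub_const c).aestronglyMeasurable)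

end Bounded

variable {E : Type*} [MeasurableSpace E] {n : ℕ}

lemma piFinSuccAbove_symm_apply_zero (q : E × (Fin n → E)) :
    (MeasurableEquiv.piFinSuccAbove (fun _ : Fin (n + 1) => E) 0).symm q =
      (Fin.cons q.1 q.2 : Fin (n + 1) → E) :=
  Fin.insertNth_zero' _ _

lemma measurable_cons :
    Measurable fun q : E × (Fin n → E) => (Fin.cons q.1 q.2 : Fin (n + 1) → E) := by
  simp_rw [← piFinSuccAbove_symm_apply_zero]
  exact MeasurableEquiv.measurable _

variable {μ : Measure E} {F F₁ F₂ : (Fin (n + 1) → E) → ℝ} {B : ℝ}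

lemma measurable_comp_cons (hF : Measurable F) (y : Fin n → E) :
    Measurable fun x => F (Fin.cons x y) :=
  hF.comp (measurable_cons.comp (measurable_id.prodMk measurable_const))

/-- The average of `F` over its first variable, as a function of the other variables. -/
def firstAverage (μ : Measure E) (F : (Fin (n + 1) → E) → ℝ) (y : Fin n → E) : ℝ :=
  ∫ x, F (Fin.cons x y) ∂μ

variable [IsProbabilityMeasure μ]

lemma measurable_firstAverage (hF : Measurable F) : Measurable (firstAverage μ F) :=
  ((hF.comp measurable_cons).stronglyMeasurable.integral_prod_left').measurable

lemma abs_firstAverage_le (hB : ∀ x, |F x| ≤ B) (y : Fin n → E) : |firstAverage μ F y| ≤ B := by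
  have hle := norm_integral_le_of_norm_le_const (μ := μ) (f := fun x => F (Fin.cons x y))
    (Eventually.of_forall fun x => hB (Fin.cons x y))
  rwa [probReal_univ, mul_one] at hle

lemma integral_firstAverage (hF : Measurable F) (hB : ∀ x, |F x| ≤ B) :
    ∫ y, firstAverage μ F y ∂(Measure.pi fun _ => μ) = ∫ x, F x ∂(Measure.pi fun _ => μ) := by
  have hmp := (measurePreserving_piFinSuccAbove (fun _ : Fin (n + 1) => μ) 0).symm
  rw [← hmp.integral_comp' (g := F), integral_prod_symm]
  · simp_rw [piFinSuccAbove_symm_apply_zero]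
    rfl
  · exact integrable_of_abs_le (hF.comp (MeasurableEquiv.measurable _)) fun x => hB _

lemma integral_firstAverage_sub_sq_le (hF₁ : Measurable F₁) (hB₁ : ∀ x, |F₁ x| ≤ B)
    (hF₂ : Measurable F₂) (hB₂ : ∀ x, |F₂ x| ≤ B) :
    ∫ y, (firstAverage μ F₁ y - firstAverage μ F₂ y) ^ 2 ∂(Measure.pi fun _ => μ) ≤
      ∫ x, (F₁ x - F₂ x) ^ 2 ∂(Measure.pi fun _ => μ) := by
  have hsq : Measurable fun x => (F₁ x - F₂ x) ^ 2 := (hF₁.sub hF₂).pow_const 2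
  have hsqB := abs_sub_sq_le_of_abs_le hB₁ hB₂
  rw [← integral_firstAverage hsq hsqB]
  refine integral_mono
    (integrable_of_abs_le (((measurable_firstAverage hF₁).sub
      (measurable_firstAverage hF₂)).pow_const 2)
      (abs_sub_sq_le_of_abs_le (abs_firstAverage_le hB₁) (abs_firstAverage_le hB₂)))
    (integrable_of_abs_le (measurable_firstAverage hsq) (abs_firstAverage_le hsqB)) fun y => ?_
  have hsec₁ := measurable_comp_cons hF₁ y
  have hsec₂ := measurable_comp_cons hF₂ y
  rw [firstAverage, firstAverage, ← integral_sub
    (integrable_of_abs_le hsec₁ fun x => hB₁ _) (integrable_of_abs_le hsec₂ fun x => hB₂ _)]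
  exact sq_integral_le (hsec₁.sub hsec₂) (B := B + B) fun x =>
    (abs_sub _ _).trans (add_le_add (hB₁ _) (hB₂ _))

-- The law of total variance, in which the variance given the last `n` variables is minimized by
-- the mean among the constants.
lemma variance_pi_succ_le (hF₁ : Measurable F₁) (hB₁ : ∀ x, |F₁ x| ≤ B) (hF₂ : Measurable F₂)
    (hB₂ : ∀ x, |F₂ x| ≤ B) (hF₂dep : ∀ x x' y, F₂ (Fin.cons x y) = F₂ (Fin.cons x' y)) :
    variance F₁ (Measure.pi fun _ => μ) ≤ ∫ x, (F₁ x - F₂ x) ^ 2 ∂(Measure.pi fun _ => μ) +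
      variance (firstAverage μ F₁) (Measure.pi fun _ => μ) := by
  have hsq := hF₁.pow_const 2
  have hsqB : ∀ x, |F₁ x ^ 2| ≤ B ^ 2 := fun x => by
    rw [abs_pow]; exact pow_le_pow_left₀ (abs_nonneg _) (hB₁ x) 2
  have havgB : ∀ y, |firstAverage μ F₁ y ^ 2| ≤ B ^ 2 := fun y => by
    rw [abs_pow]; exact pow_le_pow_left₀ (abs_nonneg _) (abs_firstAverage_le hB₁ y) 2
  have hdiff : Measurable fun x => (F₁ x - F₂ x) ^ 2 := (hF₁.sub hF₂).pow_const 2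
  have hdiffB := abs_sub_sq_le_of_abs_le hB₁ hB₂
  have hint₁ := integrable_of_abs_le (ν := Measure.pi fun _ : Fin n => μ)
    (measurable_firstAverage (μ := μ) hsq) (abs_firstAverage_le hsqB)
  have hint₂ := integrable_of_abs_le (ν := Measure.pi fun _ : Fin n => μ)
    ((measurable_firstAverage (μ := μ) hF₁).pow_const 2) havgB
  have hcond : ∫ y, (firstAverage μ (fun x => F₁ x ^ 2) y - firstAverage μ F₁ y ^ 2)
      ∂(Measure.pi fun _ => μ) ≤ ∫ x, (F₁ x - F₂ x) ^ 2 ∂(Measure.pi fun _ => μ) := by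
    rw [← integral_firstAverage hdiff hdiffB]
    refine integral_mono (hint₁.sub hint₂) (integrable_of_abs_le (measurable_firstAverage hdiff)
      (abs_firstAverage_le hdiffB)) fun y => ?_
    obtain ⟨x₀⟩ := nonempty_of_isProbabilityMeasure μ
    have hsec := measurable_comp_cons hF₁ y
    refine (variance_eq_sub_of_abs_le (ν := μ) hsec fun x => hB₁ _).symm.trans_le ?_
    refine (variance_le_integral_sub_const_sq (ν := μ) hsec (F₂ (Fin.cons x₀ y))).trans_eq ?_
    exact integral_congr_ae (Eventually.of_forall fun x => by simp only [hF₂dep x x₀ y])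
  rw [integral_sub hint₁ hint₂, integral_firstAverage hsq hsqB] at hcond
  rw [variance_eq_sub_of_abs_le hF₁ hB₁, variance_eq_sub_of_abs_le (measurable_firstAverage hF₁)
    (abs_firstAverage_le hB₁), integral_firstAverage hF₁ hB₁]
  linarith

/-- The Efron–Stein inequality. -/
theorem variance_pi_le_sum {F : (Fin n → E) → ℝ} {F' : Fin n → (Fin n → E) → ℝ}
    (hF : Measurable F) (hB : ∀ x, |F x| ≤ B) (hF' : ∀ i, Measurable (F' i))
    (hB' : ∀ i x, |F' i x| ≤ B) (hdep : ∀ i x y, (∀ j, j ≠ i → x j = y j) → F' i x = F' i y) :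
    variance F (Measure.pi fun _ => μ) ≤
      ∑ i, ∫ x, (F x - F' i x) ^ 2 ∂(Measure.pi fun _ => μ) := by
  induction n with
  | zero =>
    have hconst : ∀ x, F x = F Fin.elim0 := fun x => congrArg F (Subsingleton.elim _ _)
    refine (variance_le_integral_sub_const_sq hF (F Fin.elim0)).trans_eq ?_
    simp_rw [hconst, sub_self]
    simp
  | succ n ih =>
    have htail := ih (F := firstAverage μ F) (F' := fun i => firstAverage μ (F' i.succ))
      (measurable_firstAverage hF) (abs_firstAverage_le hB)
      (fun i => measurable_firstAverage (hF' _)) (fun i => abs_firstAverage_le (hB' _))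
      fun i x y hxy => integral_congr_ae (Eventually.of_forall fun t => hdep _ _ _ fun j hj => by
        induction j using Fin.cases with
        | zero => rfl
        | succ j => exact hxy j fun h => hj (congrArg Fin.succ h))
    rw [Fin.sum_univ_succ]
    refine (variance_pi_succ_le hF hB (hF' 0) (hB' 0) fun x x' y => hdep 0 _ _ fun j hj => ?_).trans
      (add_le_add le_rfl (htail.trans (Finset.sum_le_sum fun i _ =>
        integral_firstAverage_sub_sq_le hF hB (hF' _) (hB' _))))
    obtain ⟨j, rfl⟩ := Fin.exists_succ_eq.2 hj
    rfl

end EfronStein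

section ProductSpace

lemma preimage_insertNth_forall_mem {E : Type*} {n : ℕ} {i : Fin (n + 1)} {S : Finset (Fin (n + 1))}
    (hi : i ∉ S) (R : Fin (n + 1) → Set (E × E)) (a : E) :
    (fun y : Fin n → E => (i.insertNth a y : Fin (n + 1) → E)) ⁻¹'
        {x | ∀ j ∈ S, (x i, x j) ∈ R j} =
      Set.univ.pi fun t => {b | i.succAbove t ∈ S → (a, b) ∈ R (i.succAbove t)} := by
  ext y
  simp only [Set.mem_preimage, Set.mem_ofPred_eq, Set.mem_pi, Set.mem_univ, true_imp_iff,
    Fin.insertNth_apply_same]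
  constructor
  · intro h t ht
    simpa only [Fin.insertNth_apply_succAbove] using h _ ht
  · intro h j hj
    obtain ⟨t, rfl⟩ := Fin.exists_succAbove_eq (x := j) (y := i) (ne_of_mem_of_not_mem hj hi)
    simpa only [Fin.insertNth_apply_succAbove] using h t hj

variable {E : Type*} [MeasurableSpace E] {n : ℕ}

lemma measurableSet_forall_mem {i : Fin n} (S : Finset (Fin n)) {R : Fin n → Set (E × E)}
    (hR : ∀ j, MeasurableSet (R j)) :
    MeasurableSet {x : Fin n → E | ∀ j ∈ S, (x i, x j) ∈ R j} := by
  simp only [Set.ofPred_forall]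
  exact Finset.measurableSet_biInter S fun j _ =>
    ((measurable_pi_apply i).prodMk (measurable_pi_apply j)) (hR j)

lemma pi_forall_mem_eq_lintegral {μ : Measure E} [IsProbabilityMeasure μ] {i : Fin n}
    {S : Finset (Fin n)} (hi : i ∉ S) {R : Fin n → Set (E × E)} (hR : ∀ j, MeasurableSet (R j)) :
    (Measure.pi fun _ : Fin n => μ) {x | ∀ j ∈ S, (x i, x j) ∈ R j} =
      ∫⁻ a, ∏ j ∈ S, μ {b | (a, b) ∈ R j} ∂μ := by
  obtain ⟨n, rfl⟩ : ∃ n', n = n' + 1 := ⟨n - 1, by have := i.2; omega⟩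
  have hmeas := measurableSet_forall_mem (i := i) S hR
  have hmp := (measurePreserving_piFinSuccAbove (fun _ : Fin (n + 1) => μ) i).symm
  rw [← hmp.measure_preimage hmeas.nullMeasurableSet, Measure.prod_apply (hmp.measurable hmeas)]
  refine lintegral_congr fun a => ?_
  let φ : Fin (n + 1) → ℝ≥0∞ := fun j => μ {b | j ∈ S → (a, b) ∈ R j}
  have hone : ∀ j ∉ S, φ j = 1 := fun j hj => by
    simp only [φ, hj, IsEmpty.forall_iff, Set.ofPred_true, measure_univ]
  calc _ = (Measure.pi fun _ : Fin n => μ)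
        (Set.univ.pi fun t => {b | i.succAbove t ∈ S → (a, b) ∈ R (i.succAbove t)}) :=
      congrArg _ (preimage_insertNth_forall_mem hi R a)
    _ = ∏ t, φ (i.succAbove t) := Measure.pi_pi _ _
    _ = ∏ j, φ j := by rw [Fin.prod_univ_succAbove _ i, hone i hi, one_mul]
    _ = ∏ j ∈ S, φ j := (Finset.prod_subset (Finset.subset_univ S) fun j _ hj => hone j hj).symm
    _ = ∏ j ∈ S, μ {b | (a, b) ∈ R j} := Finset.prod_congr rfl fun j hj => by
      simp only [φ, hj, true_imp_iff]

lemma indepFun_of_disjoint {β γ : Type*} [MeasurableSpace β] [MeasurableSpace γ]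
    {μ : Measure E} [IsProbabilityMeasure μ] {S T : Finset (Fin n)} (hST : Disjoint S T)
    {F : (Fin n → E) → β} {G : (Fin n → E) → γ} (hF : Measurable F) (hG : Measurable G)
    (hFS : ∀ x y, (∀ i ∈ S, x i = y i) → F x = F y)
    (hGT : ∀ x y, (∀ i ∈ T, x i = y i) → G x = G y) :
    IndepFun F G (Measure.pi fun _ : Fin n => μ) := by
  obtain ⟨x₀⟩ : Nonempty E := nonempty_of_isProbabilityMeasure μ
  let extend (U : Finset (Fin n)) (y : U → E) (i : Fin n) : E :=
    if h : i ∈ U then y ⟨i, h⟩ else x₀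
  have hextend : ∀ U, Measurable (extend U) := fun U => measurable_pi_iff.2 fun i => by
    by_cases h : i ∈ U
    · simpa only [extend, h, dite_true] using measurable_pi_apply _
    · simpa only [extend, h, dite_false] using measurable_const
  have hrestrict : ∀ (U : Finset (Fin n)) (x : Fin n → E),
      ∀ i ∈ U, x i = extend U (fun j => x j) i := fun U x i hi => by
    simp only [extend, hi, dite_true]
  have hind := (iIndepFun_pi (μ := fun _ : Fin n => μ) (X := fun _ => id)
    fun _ => aemeasurable_id).indepFun_finset S T hST fun i => measurable_pi_apply i
  convert hind.comp (hF.comp (hextend S)) (hG.comp (hextend T)) using 1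
  · exact funext fun x => hFS _ _ (hrestrict S x)
  · exact funext fun x => hGT _ _ (hrestrict T x)

end ProductSpace

section RandomGraph

variable {n : ℕ}

lemma measurableSet_forall_dist_le {E : Type*} [PseudoMetricSpace E] [SecondCountableTopology E]
    [MeasurableSpace E] [OpensMeasurableSpace E] (i : Fin n) (S : Finset (Fin n)) (ρ : ℝ) :
    MeasurableSet {x : Fin n → E | ∀ j ∈ S, dist (x j) (x i) ≤ ρ} :=
  measurableSet_forall_mem S (R := fun _ => {p : E × E | dist p.2 p.1 ≤ ρ})
    fun _ => measurableSet_le (measurable_snd.dist measurable_fst) measurable_const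

lemma measure_forall_dist_le {E : Type*} [PseudoMetricSpace E] [SecondCountableTopology E]
    [MeasurableSpace E] [OpensMeasurableSpace E] {μ : Measure E} [IsProbabilityMeasure μ]
    {ρ q : ℝ} (hq0 : 0 ≤ q) (hq : ∀ a, μ (Metric.closedBall a ρ) ≤ ENNReal.ofReal q)
    {i : Fin n} {S : Finset (Fin n)} (hi : i ∉ S) :
    (Measure.pi fun _ : Fin n => μ).real {x | ∀ j ∈ S, dist (x j) (x i) ≤ ρ} ≤ q ^ S.card := by
  refine ENNReal.toReal_le_of_le_ofReal (pow_nonneg hq0 _) ?_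
  calc _ = ∫⁻ a, ∏ _j ∈ S, μ (Metric.closedBall a ρ) ∂μ :=
        pi_forall_mem_eq_lintegral hi (R := fun _ => {p : E × E | dist p.2 p.1 ≤ ρ})
          fun _ => measurableSet_le (measurable_snd.dist measurable_fst) measurable_const
    _ ≤ ∫⁻ _, ENNReal.ofReal (q ^ S.card) ∂μ := lintegral_mono fun a => by
        rw [ENNReal.ofReal_pow hq0, ← Finset.prod_const]
        exact Finset.prod_le_prod' fun j _ => hq a
    _ = _ := by rw [lintegral_const, measure_univ, mul_one]

variable {d : ℕ}

lemma geometricGraph_adj {x : Fin n → EuclideanSpace ℝ (Fin d)} {r : ℝ} {i j : Fin n} :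
    (geometricGraph x r).Adj i j ↔ i ≠ j ∧ dist (x i) (x j) < 2 * r := Iff.rfl

lemma measurable_comp_geometricGraph {β : Type*} [MeasurableSpace β] (r : ℝ)
    (ψ : SimpleGraph (Fin n) → β) :
    Measurable fun x : Fin n → EuclideanSpace ℝ (Fin d) => ψ (geometricGraph x r) := by
  let _ : MeasurableSpace (SimpleGraph (Fin n)) := ⊤
  suffices h : Measurable fun x : Fin n → EuclideanSpace ℝ (Fin d) => geometricGraph x r from
    (measurable_from_top (f := ψ)).comp h
  refine measurable_to_countable' fun G => ?_
  have hpre : (fun x : Fin n → EuclideanSpace ℝ (Fin d) => geometricGraph x r) ⁻¹' {G} =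
      ⋂ i, ⋂ j, {x | (i ≠ j ∧ dist (x i) (x j) < 2 * r) ↔ G.Adj i j} := by
    ext x
    simp only [Set.mem_preimage, Set.mem_singleton_iff, Set.mem_iInter, Set.mem_ofPred_eq,
      ← geometricGraph_adj, SimpleGraph.ext_iff, funext_iff, eq_iff_iff]
  rw [hpre]
  refine MeasurableSet.iInter fun i => MeasurableSet.iInter fun j => ?_
  have hlt : MeasurableSet {x : Fin n → EuclideanSpace ℝ (Fin d) | dist (x i) (x j) < 2 * r} :=
    measurableSet_lt ((measurable_pi_apply i).dist (measurable_pi_apply j)) measurable_const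
  exact ((MeasurableSet.const _).inter hlt).iff (MeasurableSet.const _)

end RandomGraph

section LocalBounds

variable {d n : ℕ} {r A : ℝ}

-- A connected set of `l + 1` vertices grows along an edge leaving it, which moves away from `i` by
-- at most `2 r`.
lemma exists_subset_componentOf (x : Fin n → EuclideanSpace ℝ (Fin d)) (i : Fin n) {l : ℕ}
    (hl : l + 1 ≤ (componentOf (geometricGraph x r) i).card) :
    ∃ S ⊆ componentOf (geometricGraph x r) i, i ∈ S ∧ S.card = l + 1 ∧
      ∀ t ∈ S, dist (x t) (x i) ≤ 2 * r * l := by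
  induction l with
  | zero =>
    exact ⟨{i}, Finset.singleton_subset_iff.2 (mem_componentOf_self _ i),
      Finset.mem_singleton_self i, Finset.card_singleton i, by simp⟩
  | succ l ih =>
    obtain ⟨S, hS, hiS, hcard, hdist⟩ := ih (by omega)
    obtain ⟨u, hu, huS⟩ := Finset.exists_mem_notMem_of_card_lt_card
      (by omega : S.card < (componentOf (geometricGraph x r) i).card)
    obtain ⟨p⟩ := mem_componentOf.1 hu
    obtain ⟨e, _, hfst, hsnd⟩ := p.exists_boundary_dart (S : Set (Fin n)) hiS huS
    have hedge : dist (x e.snd) (x e.fst) < 2 * r := by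
      rw [dist_comm]
      exact (geometricGraph_adj.1 e.adj).2
    refine ⟨insert e.snd S, Finset.insert_subset
      (mem_componentOf.2 ((mem_componentOf.1 (hS hfst)).trans e.adj.reachable)) hS,
      Finset.mem_insert_of_mem hiS, by rw [Finset.card_insert_of_notMem hsnd, hcard],
      fun t ht => ?_⟩
    push_cast
    rcases Finset.mem_insert.1 ht with rfl | ht
    · linarith [dist_triangle (x e.snd) (x e.fst) (x i), hdist _ hfst]
    · linarith [hdist t ht, dist_nonneg (x := x e.snd) (y := x e.fst)]

/-- `μ` gives mass at most `A ρ ^ d` to every ball of radius `ρ`. -/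
def HasBallBound (μ : Measure (EuclideanSpace ℝ (Fin d))) (A : ℝ) : Prop :=
  0 ≤ A ∧ ∀ a ρ, 0 ≤ ρ → μ (Metric.closedBall a ρ) ≤ ENNReal.ofReal (A * ρ ^ d)

/-- The constant in the bound for the probability that a component has more than `j` vertices. -/
def tailConst (A : ℝ) (d j : ℕ) : ℝ := (A * (2 * j) ^ d) ^ j

lemma tailConst_nonneg (hA : 0 ≤ A) (d j : ℕ) : 0 ≤ tailConst A d j := by
  unfold tailConst
  positivity

lemma setOf_componentOf_card_subset (i : Fin n) (j : ℕ) :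
    {x : Fin n → EuclideanSpace ℝ (Fin d) |
        j + 1 ≤ (componentOf (geometricGraph x r) i).card} ⊆
      ⋃ S ∈ (Finset.univ.erase i).powersetCard j,
        {x | ∀ t ∈ S, dist (x t) (x i) ≤ 2 * r * j} := by
  intro x hx
  obtain ⟨S, _, hiS, hcard, hdist⟩ := exists_subset_componentOf x i hx
  refine Set.mem_biUnion (x := S.erase i) ?_ fun t ht => hdist t (Finset.mem_of_mem_erase ht)
  rw [Finset.mem_coe, Finset.mem_powersetCard, Finset.card_erase_of_mem hiS, hcard,
    Nat.add_sub_cancel]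
  exact ⟨Finset.erase_subset_erase _ (Finset.subset_univ _), rfl⟩

variable {μ : Measure (EuclideanSpace ℝ (Fin d))} [IsProbabilityMeasure μ]

lemma measure_componentOf_card_le (hA : HasBallBound μ A) (hr : 0 ≤ r) (i : Fin n) (j : ℕ) :
    (Measure.pi fun _ : Fin n => μ).real
      {x | j + 1 ≤ (componentOf (geometricGraph x r) i).card} ≤
      tailConst A d j * (n * r ^ d) ^ j := by
  have hq0 : 0 ≤ A * (2 * r * j) ^ d := mul_nonneg hA.1 (by positivity)
  have hnotMem : ∀ S ∈ (Finset.univ.erase i).powersetCard j, i ∉ S := fun S hS hi =>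
    Finset.notMem_erase i _ ((Finset.mem_powersetCard.1 hS).1 hi)
  calc _ ≤ _ := measureReal_mono (setOf_componentOf_card_subset i j) (measure_ne_top _ _)
    _ ≤ ∑ S ∈ (Finset.univ.erase i).powersetCard j, (Measure.pi fun _ : Fin n => μ).real
        {x | ∀ t ∈ S, dist (x t) (x i) ≤ 2 * r * j} := measureReal_biUnion_finset_le _ _
    _ ≤ ∑ S ∈ (Finset.univ.erase i).powersetCard j, (A * (2 * r * j) ^ d) ^ j :=
        Finset.sum_le_sum fun S hS => (measure_forall_dist_le hq0
          (fun a => hA.2 a _ (by positivity)) (hnotMem S hS)).trans_eq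
          (by rw [(Finset.mem_powersetCard.1 hS).2])
    _ ≤ (n : ℝ) ^ j * (A * (2 * r * j) ^ d) ^ j := by
        rw [Finset.sum_const, nsmul_eq_mul, Finset.card_powersetCard]
        refine mul_le_mul_of_nonneg_right ?_ (by positivity)
        have hcard : (Finset.univ.erase i).card ≤ n := (Finset.card_le_univ _).trans_eq
          (Fintype.card_fin n)
        exact_mod_cast (Nat.choose_le_pow _ j).trans (Nat.pow_le_pow_left hcard j)
    _ = tailConst A d j * (n * r ^ d) ^ j := by
        rw [tailConst, ← mul_pow, ← mul_pow]
        congr 1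
        rw [mul_pow, mul_pow, mul_pow]
        ring

-- The value of `c - 1` selects the summand that dominates; values of at least `J` are covered by
-- the last term.
lemma componentWeight_pow_le {c N : ℕ} (hc : c ≤ N) (m J : ℕ) {p : ℕ} (hp : p ≠ 0) :
    componentWeight m c ^ p ≤
      ∑ j ∈ Finset.Ico (2 * m) J,
        ((j + 1 : ℝ) ^ (2 * m)) ^ p * (Set.Ici (j + 1)).indicator 1 c +
      ((N : ℝ) ^ (2 * m)) ^ p * (Set.Ici (J + 1)).indicator 1 c := by
  have hnonneg : ∀ (j : ℕ) (a : ℝ), 0 ≤ (a ^ (2 * m)) ^ p * (Set.Ici (j + 1)).indicator 1 c :=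
    fun j a => mul_nonneg (by rw [← pow_mul, mul_assoc]; exact Even.pow_nonneg (even_two_mul _) a)
      (Set.indicator_nonneg (fun _ _ => zero_le_one) _)
  have hsum := Finset.sum_nonneg fun (j : ℕ) (_ : j ∈ Finset.Ico (2 * m) J) =>
    hnonneg j ((j : ℝ) + 1)
  unfold componentWeight
  split_ifs with h
  · rcases le_or_gt (J + 1) c with hJ | hJ
    · refine le_add_of_nonneg_of_le hsum ?_
      rw [Set.indicator_of_mem (Set.mem_Ici.2 hJ), Pi.one_apply, mul_one]
      gcongr
    · refine le_add_of_le_of_nonneg ?_ (hnonneg J N)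
      obtain ⟨j, rfl⟩ : ∃ j, c = j + 1 := ⟨c - 1, by omega⟩
      refine le_trans ?_ (Finset.single_le_sum (fun j _ => hnonneg j ((j : ℝ) + 1))
        (Finset.mem_Ico.2 ⟨(by omega : 2 * m ≤ j), (by omega : j < J)⟩))
      rw [Set.indicator_of_mem (Set.mem_Ici.2 le_rfl), Pi.one_apply, mul_one, Nat.cast_add_one]
  · rw [zero_pow hp]
    exact add_nonneg hsum (hnonneg J N)

lemma integral_componentWeight_pow_le_sum {Ω : Type*} [MeasurableSpace Ω] {P : Measure Ω}
    [IsFiniteMeasure P] {C : Ω → ℕ} (hC : Measurable C) {N : ℕ} (hN : ∀ ω, C ω ≤ N) (m J : ℕ)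
    {p : ℕ} (hp : p ≠ 0) :
    ∫ ω, componentWeight m (C ω) ^ p ∂P ≤
      ∑ j ∈ Finset.Ico (2 * m) J, ((j + 1 : ℝ) ^ (2 * m)) ^ p * P.real {ω | j + 1 ≤ C ω} +
      ((N : ℝ) ^ (2 * m)) ^ p * P.real {ω | J + 1 ≤ C ω} := by
  have hind : ∀ (j : ℕ) (a : ℝ),
      Integrable (fun ω => a * (Set.Ici (j + 1)).indicator 1 (C ω)) P := fun j a =>
    integrable_comp_of_le hC hN fun c => a * (Set.Ici (j + 1)).indicator 1 c
  have hval : ∀ (j : ℕ) (a : ℝ), ∫ ω, a * (Set.Ici (j + 1)).indicator 1 (C ω) ∂P =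
      a * P.real {ω | j + 1 ≤ C ω} := fun j a => by
    rw [integral_const_mul]
    exact congrArg _ (integral_indicator_one (hC measurableSet_Ici))
  have hsum := integrable_finsetSum (Finset.Ico (2 * m) J) fun j _ =>
    hind j ((((j : ℝ) + 1) ^ (2 * m)) ^ p)
  refine (integral_mono (integrable_comp_of_le hC hN fun c => componentWeight m c ^ p)
    (hsum.add (hind J _)) fun ω => componentWeight_pow_le (hN ω) m J hp).trans_eq ?_
  rw [integral_add' hsum (hind J _), integral_finsetSum _ fun j _ => hind j _, hval]
  simp_rw [hval]

lemma integral_componentWeight_pow_le (hA : HasBallBound μ A) (hr : 0 ≤ r) (i : Fin n) (m J : ℕ)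
    {p : ℕ} (hp : p ≠ 0) :
    ∫ x, componentWeight m (componentOf (geometricGraph x r) i).card ^ p
        ∂(Measure.pi fun _ : Fin n => μ) ≤
      ∑ j ∈ Finset.Ico (2 * m) J,
        ((j + 1 : ℝ) ^ (2 * m)) ^ p * (tailConst A d j * (n * r ^ d) ^ j) +
      ((n : ℝ) ^ (2 * m)) ^ p * (tailConst A d J * (n * r ^ d) ^ J) := by
  refine (integral_componentWeight_pow_le_sum
    (measurable_comp_geometricGraph r fun G => (componentOf G i).card)
    (fun x => (Finset.card_le_univ _).trans_eq (Fintype.card_fin n)) m J hp).trans ?_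
  exact add_le_add (Finset.sum_le_sum fun j _ => mul_le_mul_of_nonneg_left
    (measure_componentOf_card_le hA hr i j) (by positivity))
    (mul_le_mul_of_nonneg_left (measure_componentOf_card_le hA hr i J) (by positivity))

end LocalBounds

section CrossPolytopeProbability

variable {d n : ℕ}

open Classical in
/-- The indicator of the event that the points with index in `S` form a cross-polytope. -/
def crossIndicator (r : ℝ) (m : ℕ) (S : Finset (Fin n)) (x : Fin n → EuclideanSpace ℝ (Fin d)) :
    ℕ := if IsCrossPolytope (geometricGraph x r) m S then 1 else 0

lemma crossIndicator_le_one (r : ℝ) (m : ℕ) (S : Finset (Fin n))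
    (x : Fin n → EuclideanSpace ℝ (Fin d)) : crossIndicator r m S x ≤ 1 := by
  unfold crossIndicator
  split_ifs
  exacts [le_rfl, zero_le_one]

lemma crossIndicator_eq_zero_or_one (r : ℝ) (m : ℕ) (S : Finset (Fin n))
    (x : Fin n → EuclideanSpace ℝ (Fin d)) :
    crossIndicator r m S x = 0 ∨ crossIndicator r m S x = 1 :=
  Nat.le_one_iff_eq_zero_or_eq_one.1 (crossIndicator_le_one r m S x)

lemma isCrossPolytope_of_crossIndicator_ne_zero {r : ℝ} {m : ℕ} {S : Finset (Fin n)}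
    {x : Fin n → EuclideanSpace ℝ (Fin d)} (h : crossIndicator r m S x ≠ 0) :
    IsCrossPolytope (geometricGraph x r) m S :=
  not_not.1 fun hS => h (if_neg hS)

lemma measurable_crossIndicator (r : ℝ) (m : ℕ) (S : Finset (Fin n)) :
    Measurable (crossIndicator (d := d) r m S) := by
  classical
  exact measurable_comp_geometricGraph r fun G => if IsCrossPolytope G m S then 1 else 0

lemma crossIndicator_congr (r : ℝ) (m : ℕ) (S : Finset (Fin n))
    {x y : Fin n → EuclideanSpace ℝ (Fin d)} (h : ∀ i ∈ S, x i = y i) :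
    crossIndicator r m S x = crossIndicator r m S y := by
  unfold crossIndicator
  rw [IsCrossPolytope.congr (G := geometricGraph x r) (G' := geometricGraph y r)]
  intro u hu v hv
  rw [geometricGraph_adj, geometricGraph_adj, h u hu, h v hv]

lemma crossPolytopeCount_eq_sum (r : ℝ) (m : ℕ) (x : Fin n → EuclideanSpace ℝ (Fin d)) :
    crossPolytopeCount (geometricGraph x r) Finset.univ m =
      ∑ S ∈ Finset.univ.powersetCard (2 * m), crossIndicator r m S x := by
  classical
  unfold crossPolytopeCount crossIndicator
  rw [Finset.card_filter, Finset.powerset_univ]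
  refine (Finset.sum_subset (Finset.subset_univ _) fun S _ hS => if_neg fun h => hS ?_).symm
  exact Finset.mem_powersetCard.2 ⟨Finset.subset_univ _, h.1⟩

-- Two points have a common neighbour: at most one point is excluded by each of them.
lemma IsCrossPolytope.dist_le {r : ℝ} {m : ℕ} (hm : 2 ≤ m) {S : Finset (Fin n)}
    {x : Fin n → EuclideanSpace ℝ (Fin d)} (h : IsCrossPolytope (geometricGraph x r) m S)
    {i j : Fin n} (hi : i ∈ S) (hj : j ∈ S) : dist (x j) (x i) ≤ 4 * r := by
  classical
  obtain ⟨u, -, hu⟩ := h.2 i hi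
  obtain ⟨v, -, hv⟩ := h.2 j hj
  obtain ⟨w, hw, hwiuv⟩ : ∃ w ∈ S, w ∉ ({i, u, v} : Finset (Fin n)) := by
    apply Finset.exists_mem_notMem_of_card_lt_card
    have hthree : ({i, u, v} : Finset (Fin n)).card ≤ 3 := Finset.card_le_three
    have hcard := h.1
    omega
  simp only [Finset.mem_insert, Finset.mem_singleton, not_or] at hwiuv
  obtain ⟨hwi, hwu, hwv⟩ := hwiuv
  have hiw : dist (x i) (x w) < 2 * r :=
    not_not.1 fun hc => hwu (hu w ⟨hw, hwi, fun hadj => hc hadj.2⟩)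
  have hjw : dist (x j) (x w) < 2 * r := by
    by_cases hwj : w = j
    · rw [hwj, dist_self]
      exact dist_nonneg.trans_lt hiw
    · exact not_not.1 fun hc => hwv (hv w ⟨hw, hwj, fun hadj => hc hadj.2⟩)
  linarith [dist_triangle_right (x j) (x i) (x w)]

variable {μ : Measure (EuclideanSpace ℝ (Fin d))} [IsProbabilityMeasure μ] {r q : ℝ} {m : ℕ}
  {S T : Finset (Fin n)}

lemma integral_crossIndicator_mul_le (hq0 : 0 ≤ q)
    (hq : ∀ a, μ (Metric.closedBall a (4 * r)) ≤ ENNReal.ofReal q) (hm : 2 ≤ m) {i : Fin n}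
    (hiS : i ∈ S) (hiT : i ∈ T) :
    ∫ x, (crossIndicator r m S x : ℝ) * crossIndicator r m T x ∂(Measure.pi fun _ : Fin n => μ) ≤
      q ^ ((S ∪ T).erase i).card := by
  have hmeas := measurableSet_forall_dist_le (E := EuclideanSpace ℝ (Fin d)) i
    ((S ∪ T).erase i) (4 * r)
  refine le_trans ?_ (measure_forall_dist_le hq0 hq (Finset.notMem_erase i (S ∪ T)))
  rw [← integral_indicator_one hmeas]
  refine integral_mono_of_nonneg (Eventually.of_forall fun x => by positivity)
    ((integrable_const (1 : ℝ)).indicator hmeas) (Eventually.of_forall fun x => ?_)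
  dsimp only
  rcases eq_or_ne (crossIndicator r m S x * crossIndicator r m T x) 0 with h | h
  · rw [← Nat.cast_mul, h, Nat.cast_zero]
    exact Set.indicator_nonneg (fun _ _ => zero_le_one) _
  · have hS := isCrossPolytope_of_crossIndicator_ne_zero (left_ne_zero_of_mul h)
    have hT := isCrossPolytope_of_crossIndicator_ne_zero (right_ne_zero_of_mul h)
    rw [Set.indicator_of_mem, Pi.one_apply]
    · exact_mod_cast Nat.mul_le_mul (crossIndicator_le_one r m S x) (crossIndicator_le_one r m T x)
    · intro j hj
      rcases Finset.mem_union.1 (Finset.mem_of_mem_erase hj) with hj | hj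
      exacts [hS.dist_le hm hiS hj, hT.dist_le hm hiT hj]

lemma integral_crossIndicator_le (hq0 : 0 ≤ q)
    (hq : ∀ a, μ (Metric.closedBall a (4 * r)) ≤ ENNReal.ofReal q) (hm : 2 ≤ m)
    (hS : S.card = 2 * m) :
    ∫ x, (crossIndicator r m S x : ℝ) ∂(Measure.pi fun _ : Fin n => μ) ≤ q ^ (2 * m - 1) := by
  obtain ⟨i, hi⟩ : S.Nonempty := Finset.card_pos.1 (by omega)
  have hmul := integral_crossIndicator_mul_le hq0 hq hm hi hi
  rw [Finset.union_self, Finset.card_erase_of_mem hi, hS] at hmul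
  refine le_of_eq_of_le (integral_congr_ae (Eventually.of_forall fun x => ?_)) hmul
  rcases crossIndicator_eq_zero_or_one r m S x with h | h <;> simp only [h] <;> norm_num

end CrossPolytopeProbability

section CrossPolytopeDependency

/-- Two finite sets overlap if they are not disjoint. -/
abbrev Overlap {V : Type*} (S T : Finset V) : Prop := ¬ Disjoint S T

lemma Overlap.card_sdiff_lt {V : Type*} [DecidableEq V] {S T : Finset V} (h : Overlap S T) :
    (T \ S).card < T.card := by
  obtain ⟨i, hiS, hiT⟩ := Finset.not_disjoint_iff.1 h
  exact Finset.card_lt_card (Finset.ssubset_iff_of_subset Finset.sdiff_subset |>.2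
    ⟨i, hiT, fun hi => (Finset.mem_sdiff.1 hi).2 hiS⟩)

-- A set `T` is determined by its two parts `T ∩ S` and `T \ S`.
lemma sum_card_sdiff_le {V : Type*} [Fintype V] [DecidableEq V] (S : Finset V)
    {𝒯 : Finset (Finset V)} {φ : ℕ → ℝ} (hφ : ∀ v, 0 ≤ φ v) {I : Finset ℕ}
    (hI : ∀ T ∈ 𝒯, (T \ S).card ∈ I) :
    ∑ T ∈ 𝒯, φ (T \ S).card ≤ 2 ^ S.card * ∑ v ∈ I, (Fintype.card V : ℝ) ^ v * φ v := by
  have hsum : ∑ T ∈ 𝒯, φ (T \ S).card =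
      ∑ q ∈ 𝒯.image (fun T => (T ∩ S, T \ S)), φ q.2.card := by
    rw [Finset.sum_image]
    intro T _ T' _ h
    simp only [Prod.mk.injEq] at h
    rw [← Finset.sdiff_union_inter T S, h.1, h.2, Finset.sdiff_union_inter]
  have hsub : 𝒯.image (fun T => (T ∩ S, T \ S)) ⊆
      S.powerset ×ˢ I.biUnion fun v => Finset.univ.powersetCard v := by
    intro q hq
    obtain ⟨T, hT, rfl⟩ := Finset.mem_image.1 hq
    simp only [Finset.mem_product, Finset.mem_powerset, Finset.mem_biUnion,
      Finset.mem_powersetCard]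
    exact ⟨Finset.inter_subset_right, _, hI T hT, Finset.subset_univ _, rfl⟩
  refine (hsum.trans_le (Finset.sum_le_sum_of_subset_of_nonneg hsub fun q _ _ => hφ _)).trans ?_
  simp only [Finset.sum_product, Finset.sum_const, Finset.card_powerset, nsmul_eq_mul,
    Nat.cast_pow, Nat.cast_ofNat]
  rw [Finset.sum_biUnion fun a _ b _ hab => Finset.pairwise_disjoint_powersetCard _ hab]
  refine mul_le_mul_of_nonneg_left (Finset.sum_le_sum fun v _ => ?_) (by positivity)
  rw [Finset.sum_congr rfl fun B hB => by rw [(Finset.mem_powersetCard.1 hB).2],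
    Finset.sum_const, nsmul_eq_mul, Finset.card_powersetCard]
  exact mul_le_mul_of_nonneg_right (by exact_mod_cast Nat.choose_le_pow _ v) (hφ v)

lemma sum_powersetCard_le {n l : ℕ} {φ : Finset (Fin n) → ℝ} {c : ℝ} (hc : 0 ≤ c)
    (hφ : ∀ S, S.card = l → φ S ≤ c) :
    ∑ S ∈ Finset.univ.powersetCard l, φ S ≤ (n : ℝ) ^ l * c := by
  refine (Finset.sum_le_card_nsmul _ _ c fun S hS => hφ S (Finset.mem_powersetCard.1 hS).2).trans ?_
  rw [nsmul_eq_mul, Finset.card_powersetCard, Finset.card_univ, Fintype.card_fin]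
  exact mul_le_mul_of_nonneg_right (by exact_mod_cast Nat.choose_le_pow n l) hc

variable {d n : ℕ} {μ : Measure (EuclideanSpace ℝ (Fin d))} [IsProbabilityMeasure μ]

lemma isLocallyDependent_crossIndicator (r : ℝ) {m : ℕ} (hm : 1 ≤ m) :
    IsLocallyDependent (Measure.pi fun _ : Fin n => μ) (Finset.univ.powersetCard (2 * m))
      (crossIndicator r m) Overlap where
  measurable := measurable_crossIndicator r m
  le_one := crossIndicator_le_one r m
  refl S hS h := by
    have hcard := (Finset.mem_powersetCard.1 hS).2
    rw [disjoint_self.1 h, Finset.bot_eq_empty, Finset.card_empty] at hcard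
    omega
  indepFun S _ := by
    refine indepFun_of_disjoint (S := S) (T := Sᶜ) disjoint_compl_right
      (measurable_crossIndicator r m S)
      (Finset.measurable_sum _ fun T _ => measurable_crossIndicator r m T)
      (fun x y h => crossIndicator_congr r m S h) fun x y h => ?_
    refine Finset.sum_congr rfl fun T hT => crossIndicator_congr r m T fun i hi => h i ?_
    have hdisj := not_not.1 (Finset.mem_filter.1 hT).2
    exact Finset.mem_compl.2 fun hiS => Finset.disjoint_left.1 hdisj hiS hi

variable {r q : ℝ} {m : ℕ} {S : Finset (Fin n)} (hq0 : 0 ≤ q)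
  (hq : ∀ a, μ (Metric.closedBall a (4 * r)) ≤ ENNReal.ofReal q) (hm : 2 ≤ m)
include hq0 hq hm

lemma sum_overlap_integral_mul_integral_le (hn : 1 ≤ n) (hS : S.card = 2 * m) :
    ∑ T ∈ (Finset.univ.powersetCard (2 * m)).filter (Overlap S),
      (∫ x, (crossIndicator r m S x : ℝ) ∂(Measure.pi fun _ : Fin n => μ)) *
        ∫ x, (crossIndicator r m T x : ℝ) ∂(Measure.pi fun _ : Fin n => μ) ≤
      2 ^ (2 * m) * ((2 * m) * ((n : ℝ) ^ (2 * m - 1) *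
        (q ^ (2 * m - 1) * q ^ (2 * m - 1)))) := by
  have hn1 : (1 : ℝ) ≤ n := by exact_mod_cast hn
  set c := q ^ (2 * m - 1) * q ^ (2 * m - 1)
  have hc : 0 ≤ c := by positivity
  have hterm : ∀ T ∈ (Finset.univ.powersetCard (2 * m)).filter (Overlap S),
      (∫ x, (crossIndicator r m S x : ℝ) ∂(Measure.pi fun _ : Fin n => μ)) *
        ∫ x, (crossIndicator r m T x : ℝ) ∂(Measure.pi fun _ : Fin n => μ) ≤ c := fun T hT =>
    mul_le_mul (integral_crossIndicator_le hq0 hq hm hS) (integral_crossIndicator_le hq0 hq hm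
      (Finset.mem_powersetCard.1 (Finset.mem_filter.1 hT).1).2)
      (integral_nonneg fun x => Nat.cast_nonneg _) (pow_nonneg hq0 _)
  have hcard : ∀ T ∈ (Finset.univ.powersetCard (2 * m)).filter (Overlap S),
      (T \ S).card ∈ Finset.range (2 * m) := fun T hT => by
    obtain ⟨hTmem, hov⟩ := Finset.mem_filter.1 hT
    rw [Finset.mem_range, ← (Finset.mem_powersetCard.1 hTmem).2]
    exact hov.card_sdiff_lt
  refine (Finset.sum_le_sum hterm).trans
    ((sum_card_sdiff_le S (φ := fun _ => c) (fun _ => hc) hcard).trans ?_)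
  rw [hS, Fintype.card_fin]
  refine mul_le_mul_of_nonneg_left ?_ (by positivity)
  refine (Finset.sum_le_card_nsmul _ _ ((n : ℝ) ^ (2 * m - 1) * c) fun v hv => ?_).trans_eq ?_
  · exact mul_le_mul_of_nonneg_right (pow_le_pow_right₀ hn1
      (Nat.le_sub_one_of_lt (Finset.mem_range.1 hv))) hc
  · rw [Finset.card_range, nsmul_eq_mul]
    push_cast
    ring

variable (hnq : n * q ≤ 1)
include hnq

lemma sum_overlap_integral_mul_le (hS : S.card = 2 * m) :
    ∑ T ∈ ((Finset.univ.powersetCard (2 * m)).filter (Overlap S)).erase S,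
      ∫ x, (crossIndicator r m S x : ℝ) * crossIndicator r m T x
        ∂(Measure.pi fun _ : Fin n => μ) ≤
      2 ^ (2 * m) * ((2 * m) * (q ^ (2 * m - 1) * (n * q))) := by
  have hterm : ∀ T ∈ ((Finset.univ.powersetCard (2 * m)).filter (Overlap S)).erase S,
      ∫ x, (crossIndicator r m S x : ℝ) * crossIndicator r m T x
        ∂(Measure.pi fun _ : Fin n => μ) ≤ q ^ (2 * m - 1 + (T \ S).card) := fun T hT => by
    obtain ⟨i, hiS, hiT⟩ := Finset.not_disjoint_iff.1
      (Finset.mem_filter.1 (Finset.mem_of_mem_erase hT)).2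
    refine (integral_crossIndicator_mul_le hq0 hq hm hiS hiT).trans_eq ?_
    rw [Finset.card_erase_of_mem (Finset.mem_union_left _ hiS), Finset.union_comm,
      ← Finset.card_sdiff_add_card, hS]
    congr 1
    omega
  have hcard : ∀ T ∈ ((Finset.univ.powersetCard (2 * m)).filter (Overlap S)).erase S,
      (T \ S).card ∈ Finset.Ico 1 (2 * m) := fun T hT => by
    obtain ⟨hne, hTfilter⟩ := Finset.mem_erase.1 hT
    obtain ⟨hTmem, hov⟩ := Finset.mem_filter.1 hTfilter
    have hTcard := (Finset.mem_powersetCard.1 hTmem).2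
    refine Finset.mem_Ico.2 ⟨?_, hov.card_sdiff_lt.trans_eq hTcard⟩
    rw [Nat.one_le_iff_ne_zero, Finset.card_ne_zero, Finset.sdiff_nonempty]
    exact fun h => hne (Finset.eq_of_subset_of_card_le h (by omega))
  refine (Finset.sum_le_sum hterm).trans
    ((sum_card_sdiff_le S (φ := fun v => q ^ (2 * m - 1 + v)) (fun _ => by positivity)
      hcard).trans ?_)
  rw [hS, Fintype.card_fin]
  refine mul_le_mul_of_nonneg_left ?_ (by positivity)
  refine (Finset.sum_le_card_nsmul _ _ (q ^ (2 * m - 1) * (n * q)) fun v hv => ?_).trans ?_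
  · calc (n : ℝ) ^ v * q ^ (2 * m - 1 + v) = q ^ (2 * m - 1) * (n * q) ^ v := by
          rw [pow_add, mul_pow]; ring
      _ ≤ q ^ (2 * m - 1) * (n * q) ^ 1 := mul_le_mul_of_nonneg_left
          (pow_le_pow_of_le_one (by positivity) hnq (Finset.mem_Ico.1 hv).1) (by positivity)
      _ = _ := by rw [pow_one]
  · rw [Nat.card_Ico, nsmul_eq_mul]
    refine mul_le_mul_of_nonneg_right ?_ (by positivity)
    exact_mod_cast Nat.sub_le (2 * m) 1

theorem dependencyError_crossIndicator_le (hn : 1 ≤ n) :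
    dependencyError (Measure.pi fun _ : Fin n => μ) (Finset.univ.powersetCard (2 * m))
      (crossIndicator r m) Overlap ≤ 2 ^ (2 * m) * (4 * m) * (n * (n * q) ^ (2 * m)) := by
  have hpow : ∀ a : ℝ, a ^ (2 * m) = a * a ^ (2 * m - 1) := fun a => by
    rw [← pow_succ', Nat.sub_add_cancel (by omega)]
  have hproduct := sum_powersetCard_le (n := n) (l := 2 * m) (by positivity) fun S hS =>
    sum_overlap_integral_mul_integral_le hq0 hq hm hn hS
  have hjoint := sum_powersetCard_le (n := n) (l := 2 * m) (by positivity) fun S hS =>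
    sum_overlap_integral_mul_le hq0 hq hm hnq hS
  have hshrink : (n * q) ^ (2 * m - 1 + (2 * m - 1)) ≤ (n * q) ^ (2 * m) :=
    pow_le_pow_of_le_one (by positivity) hnq (by omega)
  have hproduct' : (n : ℝ) ^ (2 * m) * (2 ^ (2 * m) * ((2 * m) * ((n : ℝ) ^ (2 * m - 1) *
      (q ^ (2 * m - 1) * q ^ (2 * m - 1))))) ≤
      2 ^ (2 * m) * (2 * m) * (n * (n * q) ^ (2 * m)) := by
    calc _ = 2 ^ (2 * m) * (2 * m) * (n * (n * q) ^ (2 * m - 1 + (2 * m - 1))) := by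
          rw [hpow n, pow_add, mul_pow]; ring
      _ ≤ _ := by gcongr
  have hjoint' : (n : ℝ) ^ (2 * m) * (2 ^ (2 * m) * ((2 * m) * (q ^ (2 * m - 1) * (n * q)))) =
      2 ^ (2 * m) * (2 * m) * (n * (n * q) ^ (2 * m)) := by
    rw [hpow n, hpow (n * q), mul_pow]; ring
  unfold dependencyError
  linarith

end CrossPolytopeDependency

section Configuration

variable {E : Type*} [NormedAddCommGroup E] [NormedSpace ℝ E] {m : ℕ}

lemma exists_pairwise_linearIndependent_unit (hE : 1 < Module.rank ℝ E) (m : ℕ) :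
    ∃ v : Fin m → E, (∀ i, ‖v i‖ = 1) ∧ Pairwise fun i j => LinearIndependent ℝ ![v i, v j] := by
  obtain ⟨x, hx⟩ := rank_pos_iff_exists_ne_zero.1 (zero_lt_one.trans hE)
  obtain ⟨y, hxy⟩ := exists_linearIndependent_pair_of_one_lt_rank hE hx
  let w : Fin m → E := fun i => x + (i : ℝ) • y
  have hw : ∀ i, ‖w i‖ ≠ 0 := fun i => norm_ne_zero_iff.2 fun h => by
    have hcoeff := LinearIndependent.pair_iff.1 hxy 1 i (by rwa [one_smul])
    exact one_ne_zero hcoeff.1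
  refine ⟨fun i => ‖w i‖⁻¹ • w i, fun i => ?_, fun i j hij => ?_⟩
  · rw [norm_smul, norm_inv, norm_norm, inv_mul_cancel₀ (hw i)]
  · simp only [w, smul_add, smul_smul]
    refine (LinearIndependent.pair_add_smul_add_smul_iff ..).2 ⟨hxy, fun h => hij ?_⟩
    have hprod : ‖w i‖⁻¹ * ‖w j‖⁻¹ ≠ 0 := mul_ne_zero (inv_ne_zero (hw i)) (inv_ne_zero (hw j))
    have hji : (j : ℝ) = i := mul_left_cancel₀ hprod (by linear_combination h)
    exact (Fin.ext (by exact_mod_cast hji)).symm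

/-- Points `y (i, ±)` whose graph at distance `2` is a cross-polytope in which `y (i, +)` and
`y (i, -)` are opposite, with room to move every point by `η`. -/
def IsRobustCrossPolytope (y : Fin m × Bool → E) (η : ℝ) : Prop :=
  ∀ a b, a ≠ b → (a.1 = b.1 → 2 + 2 * η ≤ dist (y a) (y b)) ∧
    (a.1 ≠ b.1 → dist (y a) (y b) + 2 * η < 2)

lemma exists_unit_crossPolytope [StrictConvexSpace ℝ E] (hE : 1 < Module.rank ℝ E) (m : ℕ) :
    ∃ u : Fin m × Bool → E, (∀ a b, a ≠ b → a.1 = b.1 → dist (u a) (u b) = 2) ∧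
      ∀ a b, a.1 ≠ b.1 → dist (u a) (u b) < 2 := by
  obtain ⟨v, hv1, hv⟩ := exists_pairwise_linearIndependent_unit hE m
  have hopp : ∀ i, ‖v i + v i‖ = 2 := fun i => by
    rw [← two_smul ℝ, norm_smul, hv1, Real.norm_ofNat, mul_one]
  have hlt : ∀ i j, i ≠ j → ‖v i - v j‖ < 2 ∧ ‖v i + v j‖ < 2 := fun i j hij => by
    have hray := not_or.1 (mt sameRay_or_sameRay_neg_iff_not_linearIndependent.1
      (not_not.2 (hv hij)))
    have hsub := norm_add_lt_of_not_sameRay hray.2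
    have hadd := norm_add_lt_of_not_sameRay hray.1
    rw [norm_neg, hv1, hv1, one_add_one_eq_two, ← sub_eq_add_neg] at hsub
    rw [hv1, hv1, one_add_one_eq_two] at hadd
    exact ⟨hsub, hadd⟩
  refine ⟨fun a => if a.2 then v a.1 else -v a.1, ?_, ?_⟩
  · rintro ⟨i, b⟩ ⟨j, c⟩ hne (rfl : i = j)
    have hbc : b ≠ c := fun h => hne (by rw [h])
    cases b <;> cases c
    · exact absurd rfl hbc
    · simpa only [dist_eq_norm, Bool.false_eq_true, if_true, if_false, ← neg_add', norm_neg] using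
        hopp i
    · simpa [dist_eq_norm] using hopp i
    · exact absurd rfl hbc
  · rintro ⟨i, b⟩ ⟨j, c⟩ hij
    cases b <;> cases c
    · simpa [dist_eq_norm, neg_add_eq_sub, norm_sub_rev] using (hlt i j hij).1
    · simpa only [dist_eq_norm, Bool.false_eq_true, if_true, if_false, ← neg_add', norm_neg] using
        (hlt i j hij).2
    · simpa [dist_eq_norm] using (hlt i j hij).2
    · simpa [dist_eq_norm] using (hlt i j hij).1

-- Scaling a configuration of unit vectors by `1 + η` separates opposite points and, for small `η`,
-- keeps the other distances below `2`.
lemma exists_isRobustCrossPolytope [StrictConvexSpace ℝ E] (hE : 1 < Module.rank ℝ E) (m : ℕ) :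
    ∃ (y : Fin m × Bool → E) (η : ℝ), 0 < η ∧ IsRobustCrossPolytope y η := by
  obtain ⟨u, hopp, hlt⟩ := exists_unit_crossPolytope hE m
  have hsmall : ∀ᶠ η : ℝ in 𝓝[>] 0, ∀ a b, a.1 ≠ b.1 →
      (1 + η) * dist (u a) (u b) + 2 * η < 2 := by
    simp only [eventually_all]
    intro a b hab
    have hcont : Continuous fun η : ℝ => (1 + η) * dist (u a) (u b) + 2 * η := by fun_prop
    refine ((hcont.tendsto 0).mono_left nhdsWithin_le_nhds).eventually_lt_const ?_
    simpa using hlt a b hab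
  obtain ⟨η, hη, hη0⟩ := (hsmall.and self_mem_nhdsWithin).exists
  have hη0 : 0 < η := hη0
  refine ⟨fun a => (1 + η) • u a, η, hη0, fun a b hab => ?_⟩
  rw [dist_smul₀, Real.norm_of_nonneg (by positivity)]
  refine ⟨fun h => ?_, hη a b⟩
  rw [hopp a b hab h]
  linarith

lemma isCrossPolytope_of_equiv {V : Type*} {G : SimpleGraph V} {S : Finset V}
    (e : S ≃ Fin m × Bool) (hadj : ∀ s t : S, s ≠ t → (G.Adj s t ↔ (e s).1 ≠ (e t).1)) :
    IsCrossPolytope G m S := by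
  refine ⟨?_, fun v hv => ?_⟩
  · have hcard := Fintype.card_congr e
    simp only [Fintype.card_coe, Fintype.card_prod, Fintype.card_fin, Fintype.card_bool] at hcard
    omega
  · let s : S := ⟨v, hv⟩
    let t : S := e.symm ((e s).1, !(e s).2)
    have het : e t = ((e s).1, !(e s).2) := e.apply_symm_apply _
    have hts : t ≠ s := fun h => Bool.not_ne_self _ (congrArg Prod.snd (het.symm.trans (h ▸ rfl)))
    refine ⟨t, ⟨t.2, fun h => hts (Subtype.ext h), fun h => (hadj s t hts.symm).1 h ?_⟩, ?_⟩
    · rw [het]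
    · rintro u ⟨hu, huv, hna⟩
      let w : S := ⟨u, hu⟩
      have hws : w ≠ s := fun h => huv (congrArg Subtype.val h)
      have hfst : (e w).1 = (e s).1 := (not_not.1 (mt (hadj s w hws.symm).2 hna)).symm
      have hsnd : (e w).2 ≠ (e s).2 := fun h => hws (e.injective (Prod.ext hfst h))
      have hwt : e w = e t := by
        rw [het]
        exact Prod.ext hfst (Bool.eq_not.2 hsnd)
      exact congrArg Subtype.val (e.injective hwt)

lemma IsRobustCrossPolytope.isCrossPolytope_geometricGraph {d n : ℕ}
    {y : Fin m × Bool → EuclideanSpace ℝ (Fin d)} {η : ℝ} (hy : IsRobustCrossPolytope y η)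
    {S : Finset (Fin n)} (e : S ≃ Fin m × Bool) {r : ℝ} (hr : 0 < r)
    {x : Fin n → EuclideanSpace ℝ (Fin d)} {c : EuclideanSpace ℝ (Fin d)}
    (hx : ∀ s : S, dist (x s) (c + r • y (e s)) ≤ r * η) :
    IsCrossPolytope (geometricGraph x r) m S := by
  have hdist : ∀ s t : S, dist (c + r • y (e s)) (c + r • y (e t)) = r * dist (y (e s)) (y (e t)) :=
    fun s t => by rw [dist_add_left, dist_smul₀, Real.norm_of_nonneg hr.le]
  have hle : ∀ s t : S, dist (x s) (x t) ≤ r * (dist (y (e s)) (y (e t)) + 2 * η) := fun s t => by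
    have htri := dist_triangle4 (x s) (c + r • y (e s)) (c + r • y (e t)) (x t)
    rw [hdist, dist_comm (c + r • y (e t)) (x t)] at htri
    linarith [hx s, hx t]
  have hge : ∀ s t : S, r * (dist (y (e s)) (y (e t)) - 2 * η) ≤ dist (x s) (x t) := fun s t => by
    have htri := dist_triangle4 (c + r • y (e s)) (x s) (x t) (c + r • y (e t))
    rw [hdist, dist_comm (c + r • y (e s)) (x s)] at htri
    linarith [hx s, hx t]
  refine isCrossPolytope_of_equiv e fun s t hst => ?_
  obtain ⟨hopposite, hneighbour⟩ := hy _ _ (e.injective.ne hst)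
  rw [geometricGraph_adj]
  constructor
  · rintro ⟨-, hlt⟩ heq
    have hmul := mul_le_mul_of_nonneg_left (hopposite heq) hr.le
    linarith [hge s t]
  · intro hne
    have hmul := mul_lt_mul_of_pos_left (hneighbour hne) hr
    exact ⟨fun h => hst (Subtype.ext h), by linarith [hle s t]⟩

end Configuration

section Density

variable {d : ℕ} {f : EuclideanSpace ℝ (Fin d) → ℝ} {M : ℝ}

/-- The measure with density `f`. -/
def densityMeasure (f : EuclideanSpace ℝ (Fin d) → ℝ) : Measure (EuclideanSpace ℝ (Fin d)) :=
  volume.withDensity fun x => ENNReal.ofReal (f x)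

/-- `f` is a probability density with values in `[0, M]`. -/
structure IsBoundedDensity (f : EuclideanSpace ℝ (Fin d) → ℝ) (M : ℝ) : Prop where
  measurable : Measurable f
  nonneg : ∀ x, 0 ≤ f x
  le : ∀ x, f x ≤ M
  integral_eq_one : ∫ x, f x = 1

/-- The volume of the unit ball. -/
def unitBallVolume (d : ℕ) : ℝ :=
  (volume : Measure (EuclideanSpace ℝ (Fin d))).real (Metric.ball 0 1)

lemma unitBallVolume_pos (d : ℕ) : 0 < unitBallVolume d :=
  ENNReal.toReal_pos (Metric.measure_ball_pos volume _ one_pos).ne' measure_ball_lt_top.ne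

lemma volume_real_closedBall (a : EuclideanSpace ℝ (Fin d)) {ρ : ℝ} (hρ : 0 ≤ ρ) :
    (volume : Measure (EuclideanSpace ℝ (Fin d))).real (Metric.closedBall a ρ) =
      ρ ^ d * unitBallVolume d := by
  rw [Measure.addHaar_real_closedBall volume a hρ, finrank_euclideanSpace_fin]
  rfl

lemma measurable_measure_closedBall_add {μ : Measure (EuclideanSpace ℝ (Fin d))} [SFinite μ]
    (t : EuclideanSpace ℝ (Fin d)) (ρ : ℝ) :
    Measurable fun a => μ (Metric.closedBall (a + t) ρ) := by
  have hs : MeasurableSet {p : EuclideanSpace ℝ (Fin d) × EuclideanSpace ℝ (Fin d) |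
      dist p.2 (p.1 + t) ≤ ρ} :=
    measurableSet_le (measurable_snd.dist (measurable_fst.add_const _)) measurable_const
  exact measurable_measure_prodMk_left hs

namespace IsBoundedDensity

variable (hf : IsBoundedDensity f M)
include hf

lemma bound_nonneg : 0 ≤ M := (hf.nonneg 0).trans (hf.le 0)

lemma integrable : Integrable f :=
  not_not.1 fun h => zero_ne_one ((integral_undef h).symm.trans hf.integral_eq_one)

lemma isProbabilityMeasure : IsProbabilityMeasure (densityMeasure f) := by
  constructor
  rw [densityMeasure, withDensity_apply _ MeasurableSet.univ, Measure.restrict_univ,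
    ← ofReal_integral_eq_lintegral_ofReal hf.integrable (Eventually.of_forall hf.nonneg),
    hf.integral_eq_one, ENNReal.ofReal_one]

lemma measureReal_apply {s : Set (EuclideanSpace ℝ (Fin d))} (hs : MeasurableSet s) :
    (densityMeasure f).real s = ∫ x in s, f x := by
  rw [measureReal_def, densityMeasure, withDensity_apply _ hs,
    ← ofReal_integral_eq_lintegral_ofReal hf.integrable.integrableOn
      (Eventually.of_forall hf.nonneg), ENNReal.toReal_ofReal (integral_nonneg hf.nonneg)]

lemma measureReal_closedBall_le (a : EuclideanSpace ℝ (Fin d)) {ρ : ℝ} (hρ : 0 ≤ ρ) :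
    (densityMeasure f).real (Metric.closedBall a ρ) ≤ M * (ρ ^ d * unitBallVolume d) := by
  rw [hf.measureReal_apply measurableSet_closedBall]
  calc ∫ x in Metric.closedBall a ρ, f x ≤ ∫ _ in Metric.closedBall a ρ, M :=
        integral_mono hf.integrable.integrableOn
          (integrableOn_const measure_closedBall_lt_top.ne) hf.le
    _ = _ := by rw [setIntegral_const, volume_real_closedBall a hρ, smul_eq_mul, mul_comm]

lemma hasBallBound : HasBallBound (densityMeasure f) (M * unitBallVolume d) := by
  have := hf.isProbabilityMeasure
  refine ⟨mul_nonneg hf.bound_nonneg (unitBallVolume_pos d).le, fun a ρ hρ => ?_⟩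
  rw [← ofReal_measureReal (measure_ne_top _ _), mul_right_comm, mul_assoc]
  exact ENNReal.ofReal_le_ofReal (hf.measureReal_closedBall_le a hρ)

-- Lebesgue differentiation, in the form that allows a centre at distance comparable to the radius.
lemma ae_tendsto_average_closedBall (t : EuclideanSpace ℝ (Fin d)) {η : ℝ} (hη : 0 < η) :
    ∀ᵐ a ∂(densityMeasure f), Tendsto (fun r : ℝ => (densityMeasure f).real
      (Metric.closedBall (a + r • t) (r * η)) / ((r * η) ^ d * unitBallVolume d))
      (𝓝[>] 0) (𝓝 (f a)) := by
  have hac : densityMeasure f ≪ volume := withDensity_absolutelyContinuous _ _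
  have hpos : ∀ᶠ r : ℝ in 𝓝[>] 0, 0 < r := self_mem_nhdsWithin
  have hradius : Tendsto (fun r : ℝ => r * η) (𝓝[>] 0) (𝓝[>] 0) := by
    refine tendsto_nhdsWithin_iff.2 ⟨?_, hpos.mono fun r hr => mul_pos hr hη⟩
    have hcont := (continuous_mul_const η).tendsto 0
    rw [zero_mul] at hcont
    exact hcont.mono_left nhdsWithin_le_nhds
  have hdiff := IsUnifLocDoublingMeasure.ae_tendsto_average
    (μ := (volume : Measure (EuclideanSpace ℝ (Fin d)))) hf.integrable.locallyIntegrable (‖t‖ / η)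
  refine hac.ae_le ?_
  filter_upwards [hdiff] with a ha
  have hmem : ∀ᶠ r : ℝ in 𝓝[>] 0, a ∈ Metric.closedBall (a + r • t) (‖t‖ / η * (r * η)) := by
    filter_upwards [hpos] with r hr
    rw [Metric.mem_closedBall, dist_self_add_right, norm_smul, Real.norm_of_nonneg hr.le]
    exact le_of_eq (by field_simp)
  refine (ha (fun r : ℝ => a + r • t) (fun r => r * η) hradius hmem).congr' ?_
  filter_upwards [hpos] with r hr
  rw [hf.measureReal_apply measurableSet_closedBall, setAverage_eq,
    volume_real_closedBall _ (by positivity), smul_eq_mul, inv_mul_eq_div]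

lemma tendsto_integral_prod_closedBall {β : Type*} (B : Finset β)
    (t : β → EuclideanSpace ℝ (Fin d)) {η : ℝ} (hη : 0 < η) :
    Tendsto (fun r : ℝ => ∫ a, ∏ b ∈ B, ((densityMeasure f).real
        (Metric.closedBall (a + r • t b) (r * η)) / ((r * η) ^ d * unitBallVolume d))
        ∂(densityMeasure f)) (𝓝[>] 0) (𝓝 (∫ a, f a ^ B.card ∂(densityMeasure f))) := by
  have := hf.isProbabilityMeasure
  have := unitBallVolume_pos d
  refine tendsto_integral_filter_of_dominated_convergence (fun _ => M ^ B.card) ?_ ?_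
    (integrable_const _) ?_
  · refine Eventually.of_forall fun r => Measurable.aestronglyMeasurable ?_
    refine Finset.measurable_prod B fun b _ => Measurable.div_const ?_ _
    exact (measurable_measure_closedBall_add _ _).ennreal_toReal
  · filter_upwards [self_mem_nhdsWithin] with r (hr : 0 < r)
    refine Eventually.of_forall fun a => ?_
    rw [Real.norm_eq_abs, Finset.abs_prod, ← Finset.prod_const]
    refine Finset.prod_le_prod (fun _ _ => abs_nonneg _) fun b _ => ?_
    rw [abs_of_nonneg (by positivity), div_le_iff₀ (by positivity)]
    exact hf.measureReal_closedBall_le _ (by positivity)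
  · filter_upwards [(Finset.eventually_all B).2 fun b _ =>
      hf.ae_tendsto_average_closedBall (t b) hη] with a ha
    rw [← Finset.prod_const]
    exact tendsto_finsetProd B ha

lemma integral_pow_pos (N : ℕ) : 0 < ∫ a, f a ^ N ∂(densityMeasure f) := by
  have := hf.isProbabilityMeasure
  have hint : Integrable (fun a => f a ^ N) (densityMeasure f) :=
    integrable_of_abs_le (hf.measurable.pow_const N) fun a => by
      rw [abs_of_nonneg (pow_nonneg (hf.nonneg a) N)]
      exact pow_le_pow_left₀ (hf.nonneg a) (hf.le a) N
  have hpow0 : 0 ≤ fun a => f a ^ N := fun a => pow_nonneg (hf.nonneg a) N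
  have hne : ∀ᵐ a ∂(densityMeasure f), f a ≠ 0 := by
    refine (ae_withDensity_iff hf.measurable.ennreal_ofReal).2
      (Eventually.of_forall fun a ha h => ?_)
    exact ha (by rw [h, ENNReal.ofReal_zero])
  refine (integral_nonneg hpow0).lt_of_ne' fun h => ?_
  obtain ⟨a, hzero, hne⟩ := (((integral_eq_zero_iff_of_nonneg hpow0 hint).1 h).and hne).exists
  exact hne (eq_zero_of_pow_eq_zero hzero)

end IsBoundedDensity

end Density

section CrossPolytopeLowerBound

variable {d n : ℕ}

section

variable {ι : Type*} (j : ι ↪ Fin n) {i : Fin n} {s : Finset ι} (z : ι → EuclideanSpace ℝ (Fin d))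
  (ρ : ℝ)

lemma measurableSet_forall_dist_add_le :
    MeasurableSet {x : Fin n → EuclideanSpace ℝ (Fin d) |
      ∀ b ∈ s, dist (x (j b)) (x i + z b) ≤ ρ} := by
  simp only [Set.ofPred_forall]
  exact Finset.measurableSet_biInter s fun b _ => measurableSet_le
    ((measurable_pi_apply _).dist ((measurable_pi_apply _).add_const _)) measurable_const

lemma measureReal_forall_dist_add_le {μ : Measure (EuclideanSpace ℝ (Fin d))}
    [IsProbabilityMeasure μ] (hi : ∀ b ∈ s, j b ≠ i) :
    (Measure.pi fun _ : Fin n => μ).real {x | ∀ b ∈ s, dist (x (j b)) (x i + z b) ≤ ρ} =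
      ∫ a, ∏ b ∈ s, μ.real (Metric.closedBall (a + z b) ρ) ∂μ := by
  let R : Fin n → Set (EuclideanSpace ℝ (Fin d) × EuclideanSpace ℝ (Fin d)) := fun k =>
    {p | dist p.2 (p.1 + Function.extend j z 0 k) ≤ ρ}
  have hR : ∀ k, MeasurableSet (R k) := fun k =>
    measurableSet_le (measurable_snd.dist (measurable_fst.add_const _)) measurable_const
  have hnotMem : i ∉ s.map j := fun h => by
    obtain ⟨b, hb, hbi⟩ := Finset.mem_map.1 h
    exact hi b hb hbi
  have hpi := pi_forall_mem_eq_lintegral (μ := μ) hnotMem hR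
  simp only [Finset.forall_mem_map, Finset.prod_map, R, Set.mem_ofPred_eq,
    j.injective.extend_apply] at hpi
  rw [measureReal_def, hpi]
  simp_rw [measureReal_def, ← ENNReal.toReal_prod]
  exact (integral_toReal (Finset.measurable_prod _ fun b _ =>
    measurable_measure_closedBall_add _ _).aemeasurable (Eventually.of_forall fun a =>
      ENNReal.prod_lt_top fun b _ => measure_lt_top μ _)).symm

end

variable {m : ℕ} {S : Finset (Fin n)} {y : Fin m × Bool → EuclideanSpace ℝ (Fin d)} {η r : ℝ}

lemma IsRobustCrossPolytope.crossIndicator_eq_one (hy : IsRobustCrossPolytope y η) (hη : 0 ≤ η)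
    (hr : 0 < r) (e : S ≃ Fin m × Bool) (a : Fin m × Bool) {x : Fin n → EuclideanSpace ℝ (Fin d)}
    (hx : ∀ b ≠ a, dist (x (e.symm b)) (x (e.symm a) + r • (y b - y a)) ≤ r * η) :
    crossIndicator r m S x = 1 := by
  refine if_pos (hy.isCrossPolytope_geometricGraph e hr (c := x (e.symm a) - r • y a) fun s => ?_)
  obtain ⟨b, rfl⟩ := e.symm.surjective s
  rw [e.apply_symm_apply]
  rcases eq_or_ne b a with rfl | hb
  · rw [sub_add_cancel, dist_self]
    positivity
  · have hcentre : x (e.symm a) - r • y a + r • y b = x (e.symm a) + r • (y b - y a) := by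
      rw [smul_sub]
      abel
    rw [hcentre]
    exact hx b hb

lemma IsRobustCrossPolytope.integral_prod_closedBall_le (hy : IsRobustCrossPolytope y η)
    (hη : 0 ≤ η) (hr : 0 < r) (hS : S.card = 2 * m) (a : Fin m × Bool)
    {μ : Measure (EuclideanSpace ℝ (Fin d))} [IsProbabilityMeasure μ] :
    ∫ p, ∏ b ∈ Finset.univ.erase a, μ.real (Metric.closedBall (p + r • (y b - y a)) (r * η)) ∂μ ≤
      ∫ x, (crossIndicator r m S x : ℝ) ∂(Measure.pi fun _ : Fin n => μ) := by
  obtain ⟨e⟩ : Nonempty (S ≃ Fin m × Bool) := by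
    refine Fintype.card_eq.1 ?_
    simp only [Fintype.card_coe, Fintype.card_prod, Fintype.card_fin, Fintype.card_bool]
    omega
  let j : Fin m × Bool ↪ Fin n := e.symm.toEmbedding.trans (Function.Embedding.subtype _)
  have hmeas := measurableSet_forall_dist_add_le j (i := j a) (s := Finset.univ.erase a)
    (fun b => r • (y b - y a)) (r * η)
  rw [← measureReal_forall_dist_add_le j (i := j a) _ _ fun b hb =>
    j.injective.ne (Finset.ne_of_mem_erase hb), ← integral_indicator_one hmeas]
  refine integral_mono ((integrable_const (1 : ℝ)).indicator hmeas)
    (integrable_cast (measurable_crossIndicator r m) (crossIndicator_le_one r m) S) fun x => ?_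
  refine Set.indicator_le' (fun x hx => ?_) (fun x _ => Nat.cast_nonneg _) x
  rw [hy.crossIndicator_eq_one hη hr e a fun b hb =>
    hx b (Finset.mem_erase.2 ⟨hb, Finset.mem_univ b⟩), Nat.cast_one, Pi.one_apply]

theorem IsBoundedDensity.exists_le_integral_crossIndicator {f : EuclideanSpace ℝ (Fin d) → ℝ}
    {M : ℝ} (hf : IsBoundedDensity f M) (hd : 2 ≤ d) (hm : 1 ≤ m) :
    ∃ c : ℝ, 0 < c ∧ ∀ᶠ r : ℝ in 𝓝[>] 0, ∀ (n : ℕ) (S : Finset (Fin n)), S.card = 2 * m →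
      c * r ^ (d * (2 * m - 1)) ≤
        ∫ x, (crossIndicator r m S x : ℝ) ∂(Measure.pi fun _ : Fin n => densityMeasure f) := by
  have := hf.isProbabilityMeasure
  have hvol := unitBallVolume_pos d
  have hrank : 1 < Module.rank ℝ (EuclideanSpace ℝ (Fin d)) := by
    rw [← Module.finrank_eq_rank, finrank_euclideanSpace_fin]
    exact_mod_cast hd
  obtain ⟨y, η, hη, hy⟩ := exists_isRobustCrossPolytope hrank m
  let a : Fin m × Bool := (⟨0, hm⟩, true)
  have hcard : (Finset.univ.erase a).card = 2 * m - 1 := by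
    rw [Finset.card_erase_of_mem (Finset.mem_univ _), Finset.card_univ, Fintype.card_prod,
      Fintype.card_fin, Fintype.card_bool, mul_comm]
  have hI := hf.integral_pow_pos (Finset.univ.erase a).card
  have hlim := hf.tendsto_integral_prod_closedBall (Finset.univ.erase a) (fun b => y b - y a) hη
  rw [hcard] at hI hlim
  refine ⟨_, mul_pos (half_pos hI) (pow_pos (mul_pos (pow_pos hη d) hvol) (2 * m - 1)), ?_⟩
  filter_upwards [hlim.eventually_const_lt (half_lt_self hI), self_mem_nhdsWithin]
    with r hr (hr0 : 0 < r) n S hS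
  refine le_trans ?_ (hy.integral_prod_closedBall_le hη.le hr0 hS a)
  simp_rw [Finset.prod_div_distrib, Finset.prod_const, hcard] at hr
  rw [integral_div, lt_div_iff₀ (by positivity)] at hr
  refine le_of_eq_of_le ?_ hr.le
  rw [mul_pow r η, pow_mul, mul_assoc, ← mul_pow]
  ring

end CrossPolytopeLowerBound

section PoissonNormalLimit

open Complex

lemma norm_exp_sub_quadratic_le {z : ℂ} (hz : ‖z‖ ≤ 1) :
    ‖cexp z - (1 + z + z ^ 2 / 2)‖ ≤ ‖z‖ ^ 3 := by
  have hsum : ∑ m ∈ Finset.range 3, z ^ m / (m.factorial : ℂ) = 1 + z + z ^ 2 / 2 := by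
    simp [Finset.sum_range_succ]
  rw [← hsum]
  refine (exp_bound hz (n := 3) (by norm_num)).trans
    (mul_le_of_le_one_right (by positivity) ?_)
  norm_num [Nat.factorial]

lemma norm_sq_mul_exp_sub_le {t u : ℝ} (hu : 0 < u) (htu : |t| ≤ u) :
    ‖(u : ℂ) ^ 2 * (cexp ((t / u : ℝ) * I) - 1) - t * u * I - -(t : ℂ) ^ 2 / 2‖ ≤
      |t| ^ 3 / u := by
  have huc : (u : ℂ) ≠ 0 := by exact_mod_cast hu.ne'
  have hnorm : ‖((t / u : ℝ) : ℂ) * I‖ = |t| / u := by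
    rw [norm_mul, norm_I, mul_one, norm_real, Real.norm_eq_abs, abs_div, abs_of_pos hu]
  have htaylor := norm_exp_sub_quadratic_le (hnorm.trans_le ((div_le_one hu).2 htu))
  rw [hnorm] at htaylor
  have hsplit : (u : ℂ) ^ 2 * (cexp ((t / u : ℝ) * I) - 1) - t * u * I - -(t : ℂ) ^ 2 / 2 =
      (u : ℂ) ^ 2 * (cexp ((t / u : ℝ) * I) -
        (1 + ((t / u : ℝ) : ℂ) * I + (((t / u : ℝ) : ℂ) * I) ^ 2 / 2)) := by
    rw [mul_pow, I_sq]
    push_cast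
    field_simp
    ring
  rw [hsplit, norm_mul, norm_pow, norm_real, Real.norm_eq_abs, abs_of_pos hu]
  calc u ^ 2 * _ ≤ u ^ 2 * (|t| / u) ^ 3 := mul_le_mul_of_nonneg_left htaylor (by positivity)
    _ = |t| ^ 3 / u := by field_simp

lemma tendsto_sq_mul_exp_sub (t : ℝ) :
    Tendsto (fun u : ℝ => (u : ℂ) ^ 2 * (cexp ((t / u : ℝ) * I) - 1) - t * u * I) atTop
      (𝓝 (-(t : ℂ) ^ 2 / 2)) := by
  rw [tendsto_iff_norm_sub_tendsto_zero]
  refine squeeze_zero' (Eventually.of_forall fun _ => norm_nonneg _) ?_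
    (tendsto_const_nhds.div_atTop tendsto_id : Tendsto (fun u : ℝ => |t| ^ 3 / u) atTop (𝓝 0))
  filter_upwards [eventually_ge_atTop |t|, eventually_gt_atTop 0] with u htu hu
  exact norm_sq_mul_exp_sub_le hu htu

lemma integral_exp_poissonMeasure_sub_div_sqrt {l : ℝ} (hl : 0 < l) (t : ℝ) :
    ∫ j : ℕ, cexp (t * (((j : ℝ) - l) / √l : ℝ) * I) ∂(poissonMeasure l.toNNReal) =
      cexp ((√l : ℂ) ^ 2 * (cexp ((t / √l : ℝ) * I) - 1) - t * √l * I) := by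
  have hsqrt : (√l : ℂ) ≠ 0 := by exact_mod_cast (Real.sqrt_pos.2 hl).ne'
  have hsq : (√l : ℂ) ^ 2 = l := by exact_mod_cast Real.sq_sqrt hl.le
  have hcoe : ((l.toNNReal : ℝ≥0) : ℂ) = l := congrArg ofReal (Real.coe_toNNReal l hl.le)
  have hchar := charFun_map_cast_poissonMeasure l.toNNReal (t / √l)
  rw [charFun_apply_real, integral_map .of_discrete
    (by fun_prop : Measurable _).aestronglyMeasurable, hcoe] at hchar
  rw [hsq, sub_eq_add_neg, exp_add, ← hchar, ← integral_mul_const]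
  congr 1 with j
  rw [← exp_add]
  congr 1
  push_cast
  rw [← hsq]
  field_simp
  ring

lemma tendsto_integral_exp_poissonMeasure (t : ℝ) :
    Tendsto (fun l : ℝ => ∫ j : ℕ, cexp (t * (((j : ℝ) - l) / √l : ℝ) * I)
      ∂(poissonMeasure l.toNNReal)) atTop (𝓝 (cexp (-(t : ℂ) ^ 2 / 2))) := by
  refine Tendsto.congr' ?_ ((continuous_exp.tendsto _).comp
    ((tendsto_sq_mul_exp_sub t).comp Real.tendsto_sqrt_atTop))
  filter_upwards [eventually_gt_atTop 0] with l hl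
  exact (integral_exp_poissonMeasure_sub_div_sqrt hl t).symm

lemma norm_integral_sub_le_of_forall_real {Ω : Type*} [MeasurableSpace Ω] {P : Measure Ω}
    [IsFiniteMeasure P] {Q : Measure ℕ} [IsFiniteMeasure Q] {W : Ω → ℕ} (hW : Measurable W)
    {B : ℝ} (h : ∀ g : ℕ → ℝ, (∀ n, |g n| ≤ 1) → |∫ ω, g (W ω) ∂P - ∫ n, g n ∂Q| ≤ B)
    {F : ℕ → ℂ} (hF : ∀ n, ‖F n‖ ≤ 1) :
    ‖∫ ω, F (W ω) ∂P - ∫ n, F n ∂Q‖ ≤ 2 * B := by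
  have hFW : Integrable (fun ω => F (W ω)) P :=
    Integrable.of_bound ((measurable_from_nat (f := F)).comp hW).aestronglyMeasurable 1
      (Eventually.of_forall fun ω => hF _)
  have hFQ : Integrable F Q := Integrable.of_bound .of_discrete 1 (Eventually.of_forall hF)
  have hre : (∫ ω, F (W ω) ∂P - ∫ n, F n ∂Q).re = ∫ ω, (F (W ω)).re ∂P - ∫ n, (F n).re ∂Q :=
    congrArg₂ (· - ·) (reCLM.integral_comp_comm hFW).symm (reCLM.integral_comp_comm hFQ).symm
  have him : (∫ ω, F (W ω) ∂P - ∫ n, F n ∂Q).im = ∫ ω, (F (W ω)).im ∂P - ∫ n, (F n).im ∂Q :=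
    congrArg₂ (· - ·) (imCLM.integral_comp_comm hFW).symm (imCLM.integral_comp_comm hFQ).symm
  refine (norm_le_abs_re_add_abs_im _).trans ?_
  rw [hre, him, two_mul]
  exact add_le_add (h (fun n => (F n).re) fun n => (abs_re_le_norm _).trans (hF n))
    (h (fun n => (F n).im) fun n => (abs_im_le_norm _).trans (hF n))

end PoissonNormalLimit

section Standardization

variable {Ω : Type*} [MeasurableSpace Ω] {P : Measure Ω} {X Y : Ω → ℝ}

/-- The standardization of the random variable `X`, centred by its mean and scaled by its standard
deviation; it is `0` when the variance is `0`. -/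
def standardize (P : Measure Ω) (X : Ω → ℝ) (ω : Ω) : ℝ :=
  (X ω - ∫ ω', X ω' ∂P) / √(variance X P)

lemma aemeasurable_standardize (hX : AEMeasurable X P) : AEMeasurable (standardize P X) P :=
  (hX.sub_const _).div_const _

lemma abs_standardize_sub_div_le (hX : Integrable X P) (hY : Integrable Y P) {l : ℝ} (hl : 0 < l)
    (ω : Ω) :
    |standardize P Y ω - (X ω - ∫ ω', X ω' ∂P) / √l| ≤
      |Y ω - ∫ ω', Y ω' ∂P| * |1 / √(variance Y P) - 1 / √l| +
        |(Y - X) ω - ∫ ω', (Y - X) ω' ∂P| * (1 / √l) := by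
  have hmean : ∫ ω, (Y - X) ω ∂P = ∫ ω, Y ω ∂P - ∫ ω, X ω ∂P := integral_sub hY hX
  have hsplit : standardize P Y ω - (X ω - ∫ ω', X ω' ∂P) / √l =
      (Y ω - ∫ ω', Y ω' ∂P) * (1 / √(variance Y P) - 1 / √l) +
        ((Y - X) ω - ∫ ω', (Y - X) ω' ∂P) * (1 / √l) := by
    rw [hmean, standardize, Pi.sub_apply]
    ring
  rw [hsplit]
  refine (abs_add_le _ _).trans (le_of_eq ?_)
  rw [abs_mul, abs_mul, abs_of_pos (one_div_pos.2 (Real.sqrt_pos.2 hl))]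

section CharFun

open Complex

lemma norm_exp_mul_I_sub_le (t a b : ℝ) :
    ‖cexp (t * a * I) - cexp (t * b * I)‖ ≤ |t| * |a - b| := by
  have hfactor : cexp (t * a * I) - cexp (t * b * I) =
      cexp ((t * b : ℝ) * I) * (cexp (I * (t * (a - b) : ℝ)) - 1) := by
    rw [mul_sub, ← exp_add, mul_one]
    congr 2 <;> push_cast <;> ring
  rw [hfactor, norm_mul, norm_exp_ofReal_mul_I, one_mul, ← abs_mul]
  exact Real.norm_exp_I_mul_ofReal_sub_one_le

variable [IsFiniteMeasure P]

lemma integrable_exp_mul_I (hX : AEMeasurable X P) (t : ℝ) :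
    Integrable (fun ω => cexp (t * X ω * I)) P := by
  refine Integrable.of_bound (C := 1) (by fun_prop) (Eventually.of_forall fun ω => ?_)
  rw [← ofReal_mul, norm_exp_ofReal_mul_I]

lemma norm_integral_exp_mul_I_sub_le (hX : AEMeasurable X P) (hY : AEMeasurable Y P)
    (hXY : Integrable (fun ω => X ω - Y ω) P) (t : ℝ) :
    ‖∫ ω, cexp (t * X ω * I) ∂P - ∫ ω, cexp (t * Y ω * I) ∂P‖ ≤ |t| * ∫ ω, |X ω - Y ω| ∂P := by
  rw [← integral_sub (integrable_exp_mul_I hX t) (integrable_exp_mul_I hY t),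
    ← integral_const_mul]
  exact norm_integral_le_of_norm_le (hXY.abs.const_mul _)
    (Eventually.of_forall fun ω => norm_exp_mul_I_sub_le t _ _)

end CharFun

variable [IsProbabilityMeasure P]

lemma integral_abs_sub_le_sqrt_variance (hX : MemLp X 2 P) :
    ∫ ω, |X ω - ∫ ω', X ω' ∂P| ∂P ≤ √(variance X P) := by
  apply Real.le_sqrt_of_sq_le
  have habs : MemLp (fun ω => |X ω - ∫ ω', X ω' ∂P|) 2 P := (hX.sub (memLp_const _)).abs
  have h := variance_nonneg (fun ω => |X ω - ∫ ω', X ω' ∂P|) P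
  rw [variance_eq_sub habs] at h
  rw [variance_eq_integral hX.aestronglyMeasurable.aemeasurable]
  simpa using h

lemma covariance_sq_le (hX : MemLp X 2 P) (hY : MemLp Y 2 P) :
    covariance X Y P ^ 2 ≤ variance X P * variance Y P := by
  have hquad (t : ℝ) :
      0 ≤ variance Y P * (t * t) + 2 * covariance X Y P * t + variance X P := by
    have h := variance_nonneg (X + t • Y) P
    rw [variance_add hX (hY.const_smul t), variance_smul, covariance_smul_right] at h
    linarith
  have h := discrim_le_zero hquad
  rw [discrim] at h
  linarith

lemma abs_variance_sub_le (hX : MemLp X 2 P) (hY : MemLp Y 2 P) :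
    |variance Y P - variance X P| ≤
      2 * √(variance X P * variance (Y - X) P) + variance (Y - X) P := by
  have hvar : variance Y P = variance X P + 2 * covariance X (Y - X) P + variance (Y - X) P := by
    conv_lhs => rw [← add_sub_cancel X Y, variance_add hX (hY.sub hX)]
  have hcov := Real.abs_le_sqrt (covariance_sq_le hX (hY.sub hX))
  rw [hvar, add_assoc, add_sub_cancel_left]
  refine (abs_add_le _ _).trans ?_
  rw [abs_mul, abs_two, abs_of_nonneg (variance_nonneg (Y - X) P)]
  gcongr

lemma integrable_abs_sub_integral (hX : MemLp X 2 P) :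
    Integrable (fun ω => |X ω - ∫ ω', X ω' ∂P|) P :=
  ((hX.integrable one_le_two).sub (integrable_const _)).abs

lemma integral_abs_standardize_sub_div_le (hX : MemLp X 2 P) (hY : MemLp Y 2 P) {l : ℝ}
    (hl : 0 < l) (hvar : 0 < variance Y P) :
    ∫ ω, |standardize P Y ω - (X ω - ∫ ω', X ω' ∂P) / √l| ∂P ≤
      |1 - √(variance Y P / l)| + √(variance (Y - X) P / l) := by
  have hs := Real.sqrt_pos.2 hvar
  have hIY := (integrable_abs_sub_integral hY).mul_const |1 / √(variance Y P) - 1 / √l|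
  have hIR := (integrable_abs_sub_integral (hY.sub hX)).mul_const (1 / √l)
  refine (integral_mono_of_nonneg (Eventually.of_forall fun _ => abs_nonneg _) (hIY.add hIR)
    (Eventually.of_forall (abs_standardize_sub_div_le (hX.integrable one_le_two)
      (hY.integrable one_le_two) hl))).trans ?_
  simp only [Pi.add_apply]
  rw [integral_add hIY hIR, integral_mul_const, integral_mul_const, Real.sqrt_div hvar.le,
    Real.sqrt_div (variance_nonneg _ _), ← mul_one_div (√(variance (Y - X) P))]
  gcongr ?_ + ?_ * _
  · calc _ ≤ √(variance Y P) * |1 / √(variance Y P) - 1 / √l| :=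
          mul_le_mul_of_nonneg_right (integral_abs_sub_le_sqrt_variance hY) (abs_nonneg _)
      _ = |1 - √(variance Y P) / √l| := by
          rw [← abs_of_pos hs, ← abs_mul, abs_of_pos hs]
          congr 1
          field_simp
  · exact integral_abs_sub_le_sqrt_variance (hY.sub hX)

end Standardization

section NormalLimit

variable {Ω : ℕ → Type*} [∀ n, MeasurableSpace (Ω n)] {P : (n : ℕ) → Measure (Ω n)}
  [∀ n, IsProbabilityMeasure (P n)] {X Y : (n : ℕ) → Ω n → ℝ} {l : ℕ → ℝ}

lemma tendsto_variance_div_of_variance_sub (hX : ∀ n, MemLp (X n) 2 (P n))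
    (hY : ∀ n, MemLp (Y n) 2 (P n)) (hl : ∀ᶠ n in atTop, 0 < l n)
    (hXvar : Tendsto (fun n => variance (X n) (P n) / l n) atTop (𝓝 1))
    (hsub : Tendsto (fun n => variance (Y n - X n) (P n) / l n) atTop (𝓝 0)) :
    Tendsto (fun n => variance (Y n) (P n) / l n) atTop (𝓝 1) := by
  have hdiff : Tendsto (fun n => variance (Y n) (P n) / l n - variance (X n) (P n) / l n) atTop
      (𝓝 0) := by
    have hlim := (((hXvar.mul hsub).sqrt).const_mul 2).add hsub
    rw [mul_zero, Real.sqrt_zero, mul_zero, add_zero] at hlim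
    refine squeeze_zero_norm' ?_ hlim
    filter_upwards [hl] with n hln
    rw [Real.norm_eq_abs, ← sub_div, abs_div, abs_of_pos hln, div_le_iff₀ hln, add_mul,
      div_mul_cancel₀ _ hln.ne', div_mul_div_comm, Real.sqrt_div' _ (mul_self_nonneg _),
      Real.sqrt_mul_self hln.le, mul_assoc, div_mul_cancel₀ _ hln.ne']
    exact abs_variance_sub_le (hX n) (hY n)
  simpa only [sub_add_cancel, zero_add] using hdiff.add hXvar

open Complex in
lemma tendsto_integral_exp_standardize (hX : ∀ n, MemLp (X n) 2 (P n))
    (hY : ∀ n, MemLp (Y n) 2 (P n)) (hl : ∀ᶠ n in atTop, 0 < l n)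
    (hXvar : Tendsto (fun n => variance (X n) (P n) / l n) atTop (𝓝 1))
    (hsub : Tendsto (fun n => variance (Y n - X n) (P n) / l n) atTop (𝓝 0)) {t : ℝ} {c : ℂ}
    (hchar : Tendsto (fun n => ∫ ω, cexp (t * ((X n ω - ∫ ω', X n ω' ∂(P n)) / √(l n) : ℝ) * I)
      ∂(P n)) atTop (𝓝 c)) :
    Tendsto (fun n => ∫ ω, cexp (t * standardize (P n) (Y n) ω * I) ∂(P n)) atTop (𝓝 c) := by
  have hYvar := tendsto_variance_div_of_variance_sub hX hY hl hXvar hsub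
  have hbound : Tendsto (fun n => |t| * (|1 - √(variance (Y n) (P n) / l n)| +
      √(variance (Y n - X n) (P n) / l n))) atTop (𝓝 0) := by
    simpa using (((hYvar.sqrt.const_sub 1).abs).add hsub.sqrt).const_mul |t|
  have hdiff : Tendsto (fun n => ∫ ω, cexp (t * standardize (P n) (Y n) ω * I) ∂(P n) -
      ∫ ω, cexp (t * ((X n ω - ∫ ω', X n ω' ∂(P n)) / √(l n) : ℝ) * I) ∂(P n)) atTop (𝓝 0) := by
    refine squeeze_zero_norm' ?_ hbound
    filter_upwards [hl, hYvar.eventually_const_lt zero_lt_one] with n hln hv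
    have hIX : Integrable (fun ω => (X n ω - ∫ ω', X n ω' ∂(P n)) / √(l n)) (P n) :=
      (((hX n).integrable one_le_two).sub (integrable_const _)).div_const _
    have hIY : Integrable (standardize (P n) (Y n)) (P n) :=
      (((hY n).integrable one_le_two).sub (integrable_const _)).div_const _
    refine (norm_integral_exp_mul_I_sub_le hIY.aemeasurable hIX.aemeasurable
      (hIY.sub hIX) t).trans (mul_le_mul_of_nonneg_left ?_ (abs_nonneg t))
    exact integral_abs_standardize_sub_div_le (hX n) (hY n) hln
      ((div_pos_iff_of_pos_right hln).1 hv)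
  simpa only [sub_add_cancel, zero_add] using hdiff.add hchar

open Complex in
lemma tendstoInDistribution_gaussianReal_of_charFun (hX : ∀ n, AEMeasurable (X n) (P n))
    (h : ∀ t : ℝ, Tendsto (fun n => ∫ ω, cexp (t * X n ω * I) ∂(P n)) atTop
      (𝓝 (cexp (-(t : ℂ) ^ 2 / 2)))) :
    TendstoInDistribution X atTop (id : ℝ → ℝ) P (gaussianReal 0 1) := by
  refine ⟨hX, aemeasurable_id, ProbabilityMeasure.tendsto_of_tendsto_charFun fun t => ?_⟩
  have hgauss : charFun (gaussianReal 0 1) t = cexp (-(t : ℂ) ^ 2 / 2) := by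
    rw [charFun_gaussianReal]
    congr 1
    simp [neg_div]
  simp only [ProbabilityMeasure.coe_mk, Measure.map_id, hgauss]
  refine (h t).congr fun n => ?_
  rw [charFun_apply_real, integral_map (hX n)
    (by fun_prop : Measurable fun x : ℝ => cexp (t * x * I)).aestronglyMeasurable]

end NormalLimit

section SampleFunctionals

variable {d n : ℕ}

/-- The joint law of `n` independent points with law `μ`. -/
abbrev sampleLaw (μ : Measure (EuclideanSpace ℝ (Fin d))) (n : ℕ) :
    Measure (Fin n → EuclideanSpace ℝ (Fin d)) := Measure.pi fun _ => μ

/-- The dimension of the reduced homology in degree `m - 1` of the Vietoris–Rips complex of radius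
`r` on the points `x`; for `m ≥ 2` this is the Betti number `β_{m-1}`. -/
def sampleBetti (r : ℝ) (m : ℕ) (x : Fin n → EuclideanSpace ℝ (Fin d)) : ℕ :=
  cliqueBetti (geometricGraph x r) Finset.univ m

/-- The number of cross-polytopes on `2 m` vertices in the geometric graph of the points `x`. -/
def sampleCount (r : ℝ) (m : ℕ) (x : Fin n → EuclideanSpace ℝ (Fin d)) : ℕ :=
  crossPolytopeCount (geometricGraph x r) Finset.univ m

/-- The part of `sampleBetti` which is not accounted for by cross-polytopes. -/
def sampleRemainder (r : ℝ) (m : ℕ) (x : Fin n → EuclideanSpace ℝ (Fin d)) : ℝ :=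
  bettiRemainder (geometricGraph x r) Finset.univ m

/-- The expected number of cross-polytopes among `n` independent points with law `μ`. -/
def meanCount (μ : Measure (EuclideanSpace ℝ (Fin d))) (n m : ℕ) (r : ℝ) : ℝ :=
  ∫ x, (sampleCount r m x : ℝ) ∂(sampleLaw μ n)

lemma meanCount_nonneg (μ : Measure (EuclideanSpace ℝ (Fin d))) (n m : ℕ) (r : ℝ) :
    0 ≤ meanCount μ n m r :=
  integral_nonneg fun _ => Nat.cast_nonneg _

variable (r : ℝ) (m : ℕ)

lemma measurable_sampleBetti : Measurable (sampleBetti (d := d) (n := n) r m) :=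
  measurable_comp_geometricGraph r fun G => cliqueBetti G Finset.univ m

lemma measurable_sampleCount : Measurable (sampleCount (d := d) (n := n) r m) :=
  measurable_comp_geometricGraph r fun G => crossPolytopeCount G Finset.univ m

lemma measurable_sampleRemainder : Measurable (sampleRemainder (d := d) (n := n) r m) :=
  measurable_comp_geometricGraph r fun G => bettiRemainder G Finset.univ m

lemma sampleBetti_le (x : Fin n → EuclideanSpace ℝ (Fin d)) : sampleBetti r m x ≤ n ^ m := by
  simpa only [sampleBetti, Finset.card_univ, Fintype.card_fin] using
    cliqueBetti_le (geometricGraph x r) Finset.univ m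

lemma sampleCount_le (x : Fin n → EuclideanSpace ℝ (Fin d)) :
    sampleCount r m x ≤ n ^ (2 * m) := by
  simpa only [sampleCount, Finset.card_univ, Fintype.card_fin] using
    crossPolytopeCount_le (geometricGraph x r) Finset.univ m

lemma abs_bettiRemainder_univ_le (G : SimpleGraph (Fin n)) :
    |bettiRemainder G Finset.univ m| ≤ componentWeight m n := by
  simpa only [Finset.card_univ, Fintype.card_fin] using abs_bettiRemainder_le G Finset.univ m

variable {μ : Measure (EuclideanSpace ℝ (Fin d))} [IsProbabilityMeasure μ]

lemma integrable_comp_sampleBetti (g : ℕ → ℝ) :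
    Integrable (fun x => g (sampleBetti r m x)) (sampleLaw μ n) :=
  integrable_comp_of_le (measurable_sampleBetti r m) (sampleBetti_le r m) g

lemma integrable_comp_sampleCount (g : ℕ → ℝ) :
    Integrable (fun x => g (sampleCount r m x)) (sampleLaw μ n) :=
  integrable_comp_of_le (measurable_sampleCount r m) (sampleCount_le r m) g

lemma integrable_sampleRemainder : Integrable (sampleRemainder r m) (sampleLaw μ n) :=
  integrable_of_abs_le (measurable_sampleRemainder r m) fun _ => abs_bettiRemainder_univ_le m _

lemma memLp_two_sampleBetti : MemLp (fun x => (sampleBetti r m x : ℝ)) 2 (sampleLaw μ n) :=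
  (memLp_two_iff_integrable_sq
    (integrable_comp_sampleBetti r m fun j => (j : ℝ)).aestronglyMeasurable).2
    (integrable_comp_sampleBetti r m fun j => (j : ℝ) ^ 2)

lemma memLp_two_sampleCount : MemLp (fun x => (sampleCount r m x : ℝ)) 2 (sampleLaw μ n) :=
  (memLp_two_iff_integrable_sq
    (integrable_comp_sampleCount r m fun j => (j : ℝ)).aestronglyMeasurable).2
    (integrable_comp_sampleCount r m fun j => (j : ℝ) ^ 2)

lemma integrable_componentWeight_pow (i : Fin n) (p : ℕ) :
    Integrable (fun x => componentWeight m (componentOf (geometricGraph x r) i).card ^ p)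
      (sampleLaw μ n) :=
  integrable_comp_of_le (U := fun x => (componentOf (geometricGraph x r) i).card)
    (measurable_comp_geometricGraph r fun G => (componentOf G i).card) (N := n)
    (fun x => by simpa using Finset.card_le_univ (componentOf (geometricGraph x r) i))
    fun c => componentWeight m c ^ p

end SampleFunctionals

section RemainderMoments

variable {d n m : ℕ} {r B : ℝ} {μ : Measure (EuclideanSpace ℝ (Fin d))} [IsProbabilityMeasure μ]

lemma integral_abs_sampleRemainder_le (hm : 2 ≤ m)
    (hB : ∀ i, ∫ x, componentWeight m (componentOf (geometricGraph x r) i).card ^ 1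
      ∂(sampleLaw μ n) ≤ B) :
    ∫ x, |sampleRemainder r m x| ∂(sampleLaw μ n) ≤ 2 * (n * B) := by
  have hint : ∀ i : Fin n, Integrable (fun x =>
      2 * componentWeight m (componentOf (geometricGraph x r) i).card ^ 1) (sampleLaw μ n) :=
    fun i => (integrable_componentWeight_pow r m i 1).const_mul 2
  calc ∫ x, |sampleRemainder r m x| ∂(sampleLaw μ n)
      ≤ ∫ x, ∑ i, 2 * componentWeight m (componentOf (geometricGraph x r) i).card ^ 1
        ∂(sampleLaw μ n) :=
        integral_mono (integrable_sampleRemainder r m).abs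
          (integrable_finsetSum _ fun i _ => hint i) fun x => by
            simpa only [pow_one, sampleRemainder] using
              abs_bettiRemainder_le_sum (geometricGraph x r) hm
    _ = ∑ i, 2 * ∫ x, componentWeight m (componentOf (geometricGraph x r) i).card ^ 1
        ∂(sampleLaw μ n) := by
        rw [integral_finsetSum _ fun i _ => hint i]
        simp_rw [integral_const_mul]
    _ ≤ ∑ _i : Fin n, 2 * B :=
        Finset.sum_le_sum fun i _ => mul_le_mul_of_nonneg_left (hB i) two_pos.le
    _ = 2 * (n * B) := by
        rw [Finset.sum_const, Finset.card_univ, Fintype.card_fin, nsmul_eq_mul]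
        ring

lemma isolate_geometricGraph_congr {x y : Fin n → EuclideanSpace ℝ (Fin d)} {i : Fin n}
    (h : ∀ j, j ≠ i → x j = y j) (r : ℝ) :
    isolate (geometricGraph x r) {i} = isolate (geometricGraph y r) {i} := by
  ext u v
  simp only [isolate, geometricGraph_adj, Finset.mem_singleton]
  constructor <;> rintro ⟨⟨hne, hdist⟩, hu, hv⟩
  · exact ⟨⟨hne, by rwa [← h u hu, ← h v hv]⟩, hu, hv⟩
  · exact ⟨⟨hne, by rwa [h u hu, h v hv]⟩, hu, hv⟩

-- The Efron–Stein inequality, where forgetting the `i`-th point means isolating the vertex `i`.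
lemma variance_sampleRemainder_le (hm : 2 ≤ m)
    (hB : ∀ i, ∫ x, componentWeight m (componentOf (geometricGraph x r) i).card ^ 2
      ∂(sampleLaw μ n) ≤ B) :
    variance (sampleRemainder r m) (sampleLaw μ n) ≤ 4 * (n * B) := by
  let isolated (i : Fin n) (x : Fin n → EuclideanSpace ℝ (Fin d)) : ℝ :=
    bettiRemainder (isolate (geometricGraph x r) {i}) Finset.univ m
  have hmeas : ∀ i, Measurable (isolated i) := fun i =>
    measurable_comp_geometricGraph r fun G => bettiRemainder (isolate G {i}) Finset.univ m
  have hdiff : ∀ i x, (sampleRemainder r m x - isolated i x) ^ 2 ≤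
      4 * componentWeight m (componentOf (geometricGraph x r) i).card ^ 2 := fun i x => by
    have hsq := pow_le_pow_left₀ (abs_nonneg _)
      (abs_bettiRemainder_sub_isolate_singleton_le (geometricGraph x r) i hm) 2
    rw [sq_abs, mul_pow] at hsq
    exact hsq.trans_eq (by ring)
  calc variance (sampleRemainder r m) (sampleLaw μ n)
      ≤ ∑ i, ∫ x, (sampleRemainder r m x - isolated i x) ^ 2 ∂(sampleLaw μ n) :=
        variance_pi_le_sum (measurable_sampleRemainder r m)
          (fun x => abs_bettiRemainder_univ_le m _) hmeas
          (fun i x => abs_bettiRemainder_univ_le m _) fun i x y h => by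
            simp only [isolated, isolate_geometricGraph_congr h r]
    _ ≤ ∑ i, 4 * ∫ x, componentWeight m (componentOf (geometricGraph x r) i).card ^ 2
        ∂(sampleLaw μ n) := Finset.sum_le_sum fun i _ => by
        rw [← integral_const_mul]
        exact integral_mono_of_nonneg (Eventually.of_forall fun x => sq_nonneg _)
          ((integrable_componentWeight_pow r m i 2).const_mul 4) (Eventually.of_forall (hdiff i))
    _ ≤ ∑ _i : Fin n, 4 * B :=
        Finset.sum_le_sum fun i _ => mul_le_mul_of_nonneg_left (hB i) four_pos.le
    _ = 4 * (n * B) := by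
        rw [Finset.sum_const, Finset.card_univ, Fintype.card_fin, nsmul_eq_mul]
        ring

end RemainderMoments

section CountMoments

variable {d n m : ℕ} {r : ℝ} {μ : Measure (EuclideanSpace ℝ (Fin d))} [IsProbabilityMeasure μ]

lemma meanCount_eq_sum (n m : ℕ) (r : ℝ) :
    meanCount μ n m r = ∑ S ∈ (Finset.univ : Finset (Fin n)).powersetCard (2 * m),
      ∫ x, (crossIndicator r m S x : ℝ) ∂(sampleLaw μ n) := by
  simp_rw [meanCount, sampleCount, crossPolytopeCount_eq_sum, Nat.cast_sum]
  exact integral_finsetSum _ fun S _ =>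
    integrable_cast (measurable_crossIndicator r m) (crossIndicator_le_one r m) S

lemma meanCount_le {q : ℝ} (hq0 : 0 ≤ q)
    (hq : ∀ a, μ (Metric.closedBall a (4 * r)) ≤ ENNReal.ofReal q) (hm : 2 ≤ m) :
    meanCount μ n m r ≤ n ^ (2 * m) * q ^ (2 * m - 1) := by
  rw [meanCount_eq_sum]
  exact sum_powersetCard_le (by positivity) fun S hS => integral_crossIndicator_le hq0 hq hm hS

lemma le_meanCount {b : ℝ} (hb : 0 ≤ b) (hn : 4 * m ≤ n)
    (h : ∀ S : Finset (Fin n), S.card = 2 * m →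
      b ≤ ∫ x, (crossIndicator r m S x : ℝ) ∂(sampleLaw μ n)) :
    (n / 2 : ℝ) ^ (2 * m) / (2 * m).factorial * b ≤ meanCount μ n m r := by
  have hhalf : (n / 2 : ℝ) ≤ (n + 1 - 2 * m : ℕ) := by
    rw [Nat.cast_sub (by omega)]
    have : (4 * m : ℝ) ≤ n := by exact_mod_cast hn
    push_cast
    linarith
  calc (n / 2 : ℝ) ^ (2 * m) / (2 * m).factorial * b
      ≤ (n + 1 - 2 * m : ℕ) ^ (2 * m) / (2 * m).factorial * b := by gcongr
    _ ≤ n.choose (2 * m) * b := by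
        gcongr
        exact Nat.pow_le_choose (2 * m) n
    _ ≤ meanCount μ n m r := by
        rw [meanCount_eq_sum]
        refine le_trans (le_of_eq ?_) (Finset.card_nsmul_le_sum _ _ _ fun S hS =>
          h S (Finset.mem_powersetCard.1 hS).2)
        rw [nsmul_eq_mul, Finset.card_powersetCard, Finset.card_univ, Fintype.card_fin]

lemma abs_integral_comp_sampleCount_sub_poisson_le (hm : 1 ≤ m) (hl : 0 < meanCount μ n m r)
    {g : ℕ → ℝ} (hg : ∀ j, |g j| ≤ 1) :
    |∫ x, g (sampleCount r m x) ∂(sampleLaw μ n) -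
        ∫ j, g j ∂(poissonMeasure (meanCount μ n m r).toNNReal)| ≤
      2 * min 1 (1 / meanCount μ n m r) * dependencyError (sampleLaw μ n)
        (Finset.univ.powersetCard (2 * m)) (crossIndicator r m) Overlap := by
  have hstein := (isLocallyDependent_crossIndicator (n := n) (μ := μ) r
    hm).abs_integral_sub_poisson_le (Real.toNNReal_pos.2 hl)
    (by rw [Real.coe_toNNReal _ hl.le, meanCount_eq_sum]) hg
  rw [Real.coe_toNNReal _ hl.le] at hstein
  simpa only [sampleCount, crossPolytopeCount_eq_sum] using hstein

lemma abs_variance_sampleCount_sub_meanCount_le (hm : 1 ≤ m) :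
    |variance (fun x => (sampleCount r m x : ℝ)) (sampleLaw μ n) - meanCount μ n m r| ≤
      dependencyError (sampleLaw μ n) (Finset.univ.powersetCard (2 * m)) (crossIndicator r m)
        Overlap := by
  have hvar := (isLocallyDependent_crossIndicator (n := n) (μ := μ) r hm).abs_variance_sub_mean_le
  rw [meanCount_eq_sum]
  simpa only [sampleCount, crossPolytopeCount_eq_sum] using hvar

end CountMoments

section Regimes

variable {d n m : ℕ} {μ : Measure (EuclideanSpace ℝ (Fin d))}

/-- Relative to the mean number of cross-polytopes, the difference between the Betti number and the
number of cross-polytopes, and the error of the Chen–Stein bound for the latter, are at most `δ`. -/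
structure HasRelativeError (μ : Measure (EuclideanSpace ℝ (Fin d))) (n m : ℕ) (r δ : ℝ) : Prop where
  integral_abs_remainder_le :
    ∫ x, |sampleRemainder r m x| ∂(sampleLaw μ n) ≤ δ * meanCount μ n m r
  variance_remainder_le :
    variance (sampleRemainder r m) (sampleLaw μ n) ≤ δ * meanCount μ n m r
  dependencyError_le :
    dependencyError (sampleLaw μ n) (Finset.univ.powersetCard (2 * m)) (crossIndicator r m)
      Overlap ≤ δ * meanCount μ n m r

lemma abs_comp_sub_comp_le {g : ℕ → ℝ} (hg : ∀ j, |g j| ≤ 1) (a b : ℕ) :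
    |g a - g b| ≤ 2 * |(a : ℝ) - b| := by
  rcases eq_or_ne a b with rfl | hab
  · simp
  · have hone : (1 : ℝ) ≤ |(a : ℝ) - b| := by
      have : (1 : ℤ) ≤ |(a : ℤ) - b| := Int.one_le_abs (sub_ne_zero.2 (by exact_mod_cast hab))
      exact_mod_cast this
    linarith [abs_sub (g a) (g b), hg a, hg b]

lemma one_sub_integral_le_measure_eq_zero {Ω : Type*} [MeasurableSpace Ω] {P : Measure Ω}
    [IsProbabilityMeasure P] {U : Ω → ℕ} (hU : Measurable U)
    (hi : Integrable (fun ω => (U ω : ℝ)) P) :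
    1 - ∫ ω, (U ω : ℝ) ∂P ≤ P.real {ω | U ω = 0} := by
  have hmarkov := mul_meas_ge_le_integral_of_nonneg
    (Eventually.of_forall fun ω => Nat.cast_nonneg (U ω)) hi 1
  have hcompl : {ω | (1 : ℝ) ≤ U ω} = {ω | U ω = 0}ᶜ := by
    ext ω
    simp [Nat.one_le_iff_ne_zero]
  have hmeas : MeasurableSet {ω | U ω = 0} := hU (measurableSet_singleton 0)
  rw [hcompl, probReal_compl_eq_one_sub hmeas] at hmarkov
  linarith

variable [IsProbabilityMeasure μ]

lemma abs_integral_sampleBetti_sub_meanCount_le (r : ℝ) (m : ℕ) :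
    |∫ x, (sampleBetti r m x : ℝ) ∂(sampleLaw μ n) - meanCount μ n m r| ≤
      ∫ x, |sampleRemainder r m x| ∂(sampleLaw μ n) := by
  rw [meanCount, ← integral_sub (integrable_comp_sampleBetti r m fun j => (j : ℝ))
    (integrable_comp_sampleCount r m fun j => (j : ℝ))]
  exact abs_integral_le_integral_abs

lemma abs_integral_comp_sampleBetti_sub_le (r : ℝ) (m : ℕ) {g : ℕ → ℝ} (hg : ∀ j, |g j| ≤ 1) :
    |∫ x, g (sampleBetti r m x) ∂(sampleLaw μ n) -
        ∫ x, g (sampleCount r m x) ∂(sampleLaw μ n)| ≤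
      2 * ∫ x, |sampleRemainder r m x| ∂(sampleLaw μ n) := by
  have hint := (integrable_comp_sampleBetti (n := n) (μ := μ) r m g).sub
    (integrable_comp_sampleCount r m g)
  rw [← integral_sub (integrable_comp_sampleBetti r m g) (integrable_comp_sampleCount r m g),
    ← integral_const_mul]
  exact abs_integral_le_integral_abs.trans (integral_mono hint.abs
    ((integrable_sampleRemainder r m).abs.const_mul 2) fun x => abs_comp_sub_comp_le hg _ _)

theorem tendsto_measure_sampleBetti_eq_zero {r δ : ℕ → ℝ}
    (h : ∀ᶠ n in atTop, HasRelativeError μ n m (r n) (δ n)) (hδ : Tendsto δ atTop (𝓝 0))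
    (hl : Tendsto (fun n => meanCount μ n m (r n)) atTop (𝓝 0)) :
    Tendsto (fun n => sampleLaw μ n {x | sampleBetti (r n) m x = 0}) atTop (𝓝 1) := by
  have hlower : Tendsto (fun n => 1 - (δ n * meanCount μ n m (r n) + meanCount μ n m (r n))) atTop
      (𝓝 1) := by
    simpa using ((hδ.mul hl).add hl).const_sub 1
  have hreal : Tendsto (fun n => (sampleLaw μ n).real {x | sampleBetti (r n) m x = 0}) atTop
      (𝓝 1) := by
    refine tendsto_of_tendsto_of_tendsto_of_le_of_le' hlower tendsto_const_nhds ?_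
      (Eventually.of_forall fun n => measureReal_le_one)
    filter_upwards [h] with n hn
    have hmarkov := one_sub_integral_le_measure_eq_zero (P := sampleLaw μ n)
      (measurable_sampleBetti (r n) m) (integrable_comp_sampleBetti (r n) m fun j => (j : ℝ))
    have hmean := (abs_le.1 ((abs_integral_sampleBetti_sub_meanCount_le (n := n) (μ := μ) (r n)
      m).trans hn.integral_abs_remainder_le)).2
    linarith
  have hofReal := ENNReal.tendsto_ofReal hreal
  rw [ENNReal.ofReal_one] at hofReal
  exact hofReal.congr fun n => by rw [ofReal_measureReal]

theorem HasRelativeError.abs_integral_comp_sampleBetti_sub_poisson_le {r δ : ℝ}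
    (h : HasRelativeError μ n m r δ) (hm : 1 ≤ m) (hl : 0 < meanCount μ n m r) {g : ℕ → ℝ}
    (hg : ∀ j, |g j| ≤ 1) :
    |∫ x, g (sampleBetti r m x) ∂(sampleLaw μ n) -
        ∫ j, g j ∂(poissonMeasure (∫ x, (sampleBetti r m x : ℝ) ∂(sampleLaw μ n)).toNNReal)| ≤
      6 * (δ * meanCount μ n m r) := by
  set l := meanCount μ n m r
  set b := ∫ x, (sampleBetti r m x : ℝ) ∂(sampleLaw μ n)
  set D := dependencyError (sampleLaw μ n) (Finset.univ.powersetCard (2 * m)) (crossIndicator r m)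
    Overlap
  have hb : 0 ≤ b := integral_nonneg fun _ => Nat.cast_nonneg _
  have hD : 0 ≤ D := (abs_nonneg _).trans (abs_variance_sampleCount_sub_meanCount_le hm)
  have hcount := abs_integral_comp_sampleBetti_sub_le (n := n) (μ := μ) r m hg
  have hpoisson : |∫ x, g (sampleCount r m x) ∂(sampleLaw μ n) -
      ∫ j, g j ∂(poissonMeasure l.toNNReal)| ≤ 2 * D :=
    (abs_integral_comp_sampleCount_sub_poisson_le hm hl hg).trans <| by
      have := mul_le_mul_of_nonneg_right (min_le_left 1 (1 / l)) hD
      linarith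
  have hmean := abs_integral_poissonMeasure_sub_le l.toNNReal b.toNNReal hg
  rw [Real.coe_toNNReal _ hl.le, Real.coe_toNNReal _ hb, abs_sub_comm l] at hmean
  have hbl := abs_integral_sampleBetti_sub_meanCount_le (n := n) (μ := μ) r m
  have htri := dist_triangle4 (∫ x, g (sampleBetti r m x) ∂(sampleLaw μ n))
    (∫ x, g (sampleCount r m x) ∂(sampleLaw μ n)) (∫ j, g j ∂(poissonMeasure l.toNNReal))
    (∫ j, g j ∂(poissonMeasure b.toNNReal))
  simp only [Real.dist_eq] at htri
  linarith [h.integral_abs_remainder_le, h.dependencyError_le]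

lemma HasRelativeError.abs_variance_sampleCount_div_sub_one_le {r δ : ℝ}
    (h : HasRelativeError μ n m r δ) (hm : 1 ≤ m) (hl : 0 < meanCount μ n m r) :
    |variance (fun x => (sampleCount r m x : ℝ)) (sampleLaw μ n) / meanCount μ n m r - 1| ≤ δ := by
  rw [div_sub_one hl.ne', abs_div, abs_of_pos hl, div_le_iff₀ hl]
  exact (abs_variance_sampleCount_sub_meanCount_le hm).trans h.dependencyError_le

lemma HasRelativeError.abs_integral_comp_sampleCount_sub_poisson_le {r δ : ℝ}
    (h : HasRelativeError μ n m r δ) (hm : 1 ≤ m) (hl : 0 < meanCount μ n m r) {g : ℕ → ℝ}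
    (hg : ∀ j, |g j| ≤ 1) :
    |∫ x, g (sampleCount r m x) ∂(sampleLaw μ n) -
      ∫ j, g j ∂(poissonMeasure (meanCount μ n m r).toNNReal)| ≤ 2 * δ := by
  refine (RandomRips.abs_integral_comp_sampleCount_sub_poisson_le hm hl hg).trans ?_
  rw [mul_assoc]
  refine mul_le_mul_of_nonneg_left ?_ two_pos.le
  calc min 1 (1 / meanCount μ n m r) * dependencyError (sampleLaw μ n)
        (Finset.univ.powersetCard (2 * m)) (crossIndicator r m) Overlap
      ≤ 1 / meanCount μ n m r * (δ * meanCount μ n m r) :=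
        mul_le_mul (min_le_right _ _) h.dependencyError_le
          ((abs_nonneg _).trans (abs_variance_sampleCount_sub_meanCount_le hm)) (by positivity)
    _ = δ := by field_simp

section Normal

variable {r δ : ℕ → ℝ} (h : ∀ᶠ n in atTop, HasRelativeError μ n m (r n) (δ n))
  (hδ : Tendsto δ atTop (𝓝 0)) (hm : 1 ≤ m)
  (hl : Tendsto (fun n => meanCount μ n m (r n)) atTop atTop)
include h hδ hm hl

open Complex in
lemma tendsto_integral_exp_sampleCount (t : ℝ) :
    Tendsto (fun n => ∫ x, cexp (t * (((sampleCount (r n) m x : ℝ) - meanCount μ n m (r n)) /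
      √(meanCount μ n m (r n)) : ℝ) * I) ∂(sampleLaw μ n)) atTop (𝓝 (cexp (-(t : ℂ) ^ 2 / 2))) := by
  let F (l : ℝ) (j : ℕ) : ℂ := cexp (t * (((j : ℝ) - l) / √l : ℝ) * I)
  have hpoisson := (tendsto_integral_exp_poissonMeasure t).comp hl
  have hdiff : Tendsto (fun n => (∫ x, F (meanCount μ n m (r n)) (sampleCount (r n) m x)
      ∂(sampleLaw μ n)) - ∫ j, F (meanCount μ n m (r n)) j
        ∂(poissonMeasure (meanCount μ n m (r n)).toNNReal)) atTop (𝓝 0) := by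
    refine squeeze_zero_norm' ?_ (by simpa using (hδ.const_mul 2).const_mul 2 :
      Tendsto (fun n => 2 * (2 * δ n)) atTop (𝓝 0))
    filter_upwards [h, hl.eventually_gt_atTop 0] with n hn hl0
    refine norm_integral_sub_le_of_forall_real (measurable_sampleCount (r n) m)
      (fun g hg => hn.abs_integral_comp_sampleCount_sub_poisson_le hm hl0 hg) fun j => ?_
    simp only [F]
    rw [← ofReal_mul, norm_exp_ofReal_mul_I]
  simpa [F] using hdiff.add hpoisson

theorem tendstoInDistribution_standardize_sampleBetti :
    TendstoInDistribution
      (fun n => standardize (sampleLaw μ n) fun x => (sampleBetti (r n) m x : ℝ)) atTop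
      (id : ℝ → ℝ) (fun n => sampleLaw μ n) (gaussianReal 0 1) := by
  have hl0 := hl.eventually_gt_atTop 0
  refine tendstoInDistribution_gaussianReal_of_charFun (fun n => aemeasurable_standardize
    (memLp_two_sampleBetti (r n) m).aestronglyMeasurable.aemeasurable) fun t =>
    tendsto_integral_exp_standardize (fun n => memLp_two_sampleCount (r n) m)
      (fun n => memLp_two_sampleBetti (r n) m) hl0 ?_ ?_
      (tendsto_integral_exp_sampleCount h hδ hm hl t)
  · rw [tendsto_iff_norm_sub_tendsto_zero]
    refine squeeze_zero' (Eventually.of_forall fun n => norm_nonneg _) ?_ hδ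
    filter_upwards [h, hl0] with n hn hn0 using hn.abs_variance_sampleCount_div_sub_one_le hm hn0
  · refine squeeze_zero' ?_ ?_ hδ
    · filter_upwards [hl0] with n hn0 using div_nonneg (variance_nonneg _ _) hn0.le
    · filter_upwards [h, hl0] with n hn hn0
      exact (div_le_iff₀ hn0).2 hn.variance_remainder_le

end Normal

end Regimes

section SparseRegime

/-- The radii `r n` are in the sparse regime in dimension `d`: the expected degree, of order
`n * r n ^ d`, tends to zero, and some power of it beats any given power of `n`. -/
structure IsSparseRadius (d : ℕ) (r : ℕ → ℝ) : Prop where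
  pos : ∀ n, 0 < r n
  tendsto_zero : Tendsto r atTop (𝓝 0)
  tendsto_mul_pow_zero : Tendsto (fun n : ℕ => n * r n ^ d) atTop (𝓝 0)
  exists_tendsto_pow_mul_pow_zero : ∀ N : ℕ, ∃ j : ℕ,
    Tendsto (fun n : ℕ => (n : ℝ) ^ N * (n * r n ^ d) ^ j) atTop (𝓝 0)

lemma exists_mul_pow_le_of_isBigO {d : ℕ} (hd : d ≠ 0) {ε : ℝ} {r : ℕ → ℝ}
    (hr_pos : ∀ n, 0 < r n) (hr : r =O[atTop] fun n : ℕ => (n : ℝ) ^ (-(1 / (d : ℝ)) - ε)) :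
    ∃ K : ℝ, ∀ᶠ n : ℕ in atTop, n * r n ^ d ≤ K * (n : ℝ) ^ (-(d * ε)) := by
  obtain ⟨K, -, hK⟩ := hr.exists_pos
  refine ⟨K ^ d, ?_⟩
  filter_upwards [hK.bound, eventually_gt_atTop 0] with n hn hn0
  have hn0' : (0 : ℝ) < n := by exact_mod_cast hn0
  have hd' : (d : ℝ) ≠ 0 := by exact_mod_cast hd
  have hrn := (hr_pos n).le
  rw [Real.norm_of_nonneg hrn, Real.norm_of_nonneg (by positivity)] at hn
  have hexponent : 1 + (-(1 / (d : ℝ)) - ε) * d = -(d * ε) := by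
    field_simp
    ring
  calc n * r n ^ d ≤ n * (K * (n : ℝ) ^ (-(1 / (d : ℝ)) - ε)) ^ d := by gcongr
    _ = K ^ d * ((n : ℝ) ^ (1 : ℝ) * (n : ℝ) ^ ((-(1 / (d : ℝ)) - ε) * d)) := by
        rw [Real.rpow_mul hn0'.le, Real.rpow_natCast, Real.rpow_one, mul_pow]
        ring
    _ = K ^ d * (n : ℝ) ^ (-(d * ε)) := by rw [← Real.rpow_add hn0', hexponent]

lemma tendsto_pow_mul_pow_of_le_rpow {δ K : ℝ} {ν : ℕ → ℝ} (hν0 : ∀ n, 0 ≤ ν n)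
    (hν : ∀ᶠ n : ℕ in atTop, ν n ≤ K * (n : ℝ) ^ (-δ)) {N j : ℕ} (hN : (N : ℝ) < δ * j) :
    Tendsto (fun n : ℕ => (n : ℝ) ^ N * ν n ^ j) atTop (𝓝 0) := by
  have hlim : Tendsto (fun n : ℕ => K ^ j * (n : ℝ) ^ (-(δ * j - N))) atTop (𝓝 0) := by
    simpa using ((tendsto_rpow_neg_atTop (sub_pos.2 hN)).comp
      tendsto_natCast_atTop_atTop).const_mul (K ^ j)
  have hnonneg : ∀ n : ℕ, 0 ≤ (n : ℝ) ^ N * ν n ^ j := fun n =>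
    mul_nonneg (by positivity) (pow_nonneg (hν0 n) j)
  refine squeeze_zero' (Eventually.of_forall hnonneg) ?_ hlim
  filter_upwards [hν, eventually_gt_atTop 0] with n hn hn0
  have hn0' : (0 : ℝ) < n := by exact_mod_cast hn0
  have hνn := hν0 n
  calc (n : ℝ) ^ N * ν n ^ j ≤ (n : ℝ) ^ N * (K * (n : ℝ) ^ (-δ)) ^ j := by gcongr
    _ = K ^ j * ((n : ℝ) ^ (N : ℝ) * (n : ℝ) ^ ((-δ) * j)) := by
        rw [Real.rpow_mul hn0'.le, Real.rpow_natCast, Real.rpow_natCast, mul_pow]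
        ring
    _ = K ^ j * (n : ℝ) ^ (-(δ * j - N)) := by
        rw [← Real.rpow_add hn0']
        ring_nf

lemma isSparseRadius_of_isBigO {d : ℕ} (hd : d ≠ 0) {ε : ℝ} (hε : 0 < ε) {r : ℕ → ℝ}
    (hr_pos : ∀ n, 0 < r n) (hr : r =O[atTop] fun n : ℕ => (n : ℝ) ^ (-(1 / (d : ℝ)) - ε)) :
    IsSparseRadius d r := by
  obtain ⟨K, hK⟩ := exists_mul_pow_le_of_isBigO hd hr_pos hr
  have hdε : 0 < d * ε := mul_pos (by exact_mod_cast Nat.pos_of_ne_zero hd) hε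
  have hdecay {N j : ℕ} (hj : (N : ℝ) < d * ε * j) :=
    tendsto_pow_mul_pow_of_le_rpow (fun n => mul_nonneg n.cast_nonneg (pow_nonneg (hr_pos n).le d))
      hK hj
  refine ⟨hr_pos, hr.trans_tendsto ?_, ?_, fun N => ?_⟩
  · have hδ : 0 < 1 / (d : ℝ) + ε := by positivity
    simpa only [neg_add', Function.comp_def] using
      (tendsto_rpow_neg_atTop hδ).comp tendsto_natCast_atTop_atTop
  · simpa using hdecay (N := 0) (j := 1) (by simpa using hdε)
  · obtain ⟨j, hj⟩ := exists_nat_gt ((N : ℝ) / (d * ε))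
    exact ⟨j, hdecay ((div_lt_iff₀' hdε).1 hj)⟩

/-- `F n (r n) = O (G n (r n))` for all radii in the sparse regime, with a constant that does not
depend on the radii. -/
def SparseLE (d : ℕ) (F G : ℕ → ℝ → ℝ) : Prop :=
  ∃ C : ℝ, 0 < C ∧ ∀ r, IsSparseRadius d r → ∀ᶠ n in atTop, F n (r n) ≤ C * G n (r n)

namespace SparseLE

variable {d : ℕ} {F G H : ℕ → ℝ → ℝ}

lemma trans (hFG : SparseLE d F G) (hGH : SparseLE d G H) : SparseLE d F H := by
  obtain ⟨C, hC, hF⟩ := hFG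
  obtain ⟨C', hC', hG⟩ := hGH
  refine ⟨C * C', mul_pos hC hC', fun r hr => ?_⟩
  filter_upwards [hF r hr, hG r hr] with n hFn hGn
  rw [mul_assoc]
  exact hFn.trans (mul_le_mul_of_nonneg_left hGn hC.le)

lemma mul_right (hFG : SparseLE d F G) (hH : ∀ n r, 0 < r → 0 ≤ H n r) :
    SparseLE d (fun n r => F n r * H n r) fun n r => G n r * H n r := by
  obtain ⟨C, hC, hF⟩ := hFG
  refine ⟨C, hC, fun r hr => ?_⟩
  filter_upwards [hF r hr] with n hFn
  rw [← mul_assoc]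
  exact mul_le_mul_of_nonneg_right hFn (hH n (r n) (hr.pos n))

variable {r : ℕ → ℝ} (hFG : SparseLE d F G) (hr : IsSparseRadius d r)
include hFG hr

lemma tendsto_zero (hF : ∀ n, 0 ≤ F n (r n)) (hG : Tendsto (fun n => G n (r n)) atTop (𝓝 0)) :
    Tendsto (fun n => F n (r n)) atTop (𝓝 0) := by
  obtain ⟨C, -, hFG⟩ := hFG
  exact squeeze_zero' (Eventually.of_forall hF) (hFG r hr) (by simpa using hG.const_mul C)

lemma tendsto_atTop (hF : Tendsto (fun n => F n (r n)) atTop atTop) :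
    Tendsto (fun n => G n (r n)) atTop atTop := by
  obtain ⟨C, hC, hFG⟩ := hFG
  exact (tendsto_const_mul_atTop_of_pos hC).1 (tendsto_atTop_mono' _ (hFG r hr) hF)

end SparseLE

section ComponentMoments

lemma tendsto_sum_range_mul_pow_zero {ν : ℕ → ℝ} (hν : Tendsto ν atTop (𝓝 0)) (a : ℕ → ℝ) (j : ℕ) :
    Tendsto (fun n => ∑ s ∈ Finset.range (j + 1), a s * ν n ^ s) atTop (𝓝 (a 0)) := by
  have hsum := tendsto_finsetSum (Finset.range (j + 1)) fun s _ => (hν.pow s).const_mul (a s)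
  rwa [Finset.sum_range_succ', Finset.sum_eq_zero fun s _ => by rw [zero_pow s.succ_ne_zero,
    mul_zero], zero_add, pow_zero, mul_one] at hsum

variable {d m : ℕ} {A : ℝ} {μ : Measure (EuclideanSpace ℝ (Fin d))} [IsProbabilityMeasure μ]

-- The sum over component sizes is dominated by its first term, and the decay of the degree absorbs
-- the polynomial factor in the term for all the components larger than a suitable size.
lemma exists_integral_componentWeight_pow_le (hA : HasBallBound μ A) (m : ℕ) {p : ℕ}
    (hp : p ≠ 0) :
    ∃ C : ℝ, 0 < C ∧ ∀ r, IsSparseRadius d r → ∀ᶠ n in atTop, ∀ i : Fin n,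
      ∫ x, componentWeight m (componentOf (geometricGraph x (r n)) i).card ^ p ∂(sampleLaw μ n) ≤
        C * (n * r n ^ d) ^ (2 * m) := by
  let a (s : ℕ) : ℝ := (((2 * m + s : ℕ) + 1 : ℝ) ^ (2 * m)) ^ p * tailConst A d (2 * m + s)
  have ha : 0 ≤ a 0 := mul_nonneg (by positivity) (tailConst_nonneg hA.1 d _)
  refine ⟨a 0 + 1, by positivity, fun r hr => ?_⟩
  obtain ⟨j, hj⟩ := hr.exists_tendsto_pow_mul_pow_zero (2 * m * p)
  let ν (n : ℕ) : ℝ := n * r n ^ d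
  have hν : Tendsto ν atTop (𝓝 0) := hr.tendsto_mul_pow_zero
  let T := tailConst A d (2 * m + (j + 1))
  have hlim : Tendsto (fun n => ∑ s ∈ Finset.range (j + 1), a s * ν n ^ s +
      T * ν n * ((n : ℝ) ^ (2 * m * p) * ν n ^ j)) atTop (𝓝 (a 0)) := by
    simpa using (tendsto_sum_range_mul_pow_zero hν a j).add ((hν.const_mul T).mul hj)
  filter_upwards [hlim.eventually_lt_const (lt_add_one (a 0))] with n hn i
  have hνn : 0 ≤ ν n := mul_nonneg n.cast_nonneg (pow_nonneg (hr.pos n).le _)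
  calc ∫ x, componentWeight m (componentOf (geometricGraph x (r n)) i).card ^ p ∂(sampleLaw μ n)
      ≤ ∑ s ∈ Finset.range (j + 1), (((2 * m + s : ℕ) + 1 : ℝ) ^ (2 * m)) ^ p *
          (tailConst A d (2 * m + s) * ν n ^ (2 * m + s)) +
        ((n : ℝ) ^ (2 * m)) ^ p * (T * ν n ^ (2 * m + (j + 1))) := by
        simpa only [Finset.sum_Ico_eq_sum_range, Nat.add_sub_cancel_left] using
          integral_componentWeight_pow_le hA (hr.pos n).le i m (2 * m + (j + 1)) hp
    _ = (∑ s ∈ Finset.range (j + 1), a s * ν n ^ s +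
          T * ν n * ((n : ℝ) ^ (2 * m * p) * ν n ^ j)) * ν n ^ (2 * m) := by
        rw [add_mul, Finset.sum_mul]
        congr 1
        · refine Finset.sum_congr rfl fun s _ => ?_
          rw [pow_add]
          ring
        · rw [pow_add _ (2 * m), pow_succ, pow_mul]
          ring
    _ ≤ (a 0 + 1) * ν n ^ (2 * m) := mul_le_mul_of_nonneg_right hn.le (pow_nonneg hνn _)

lemma sparseLE_integral_abs_sampleRemainder (hA : HasBallBound μ A) (hm : 2 ≤ m) :
    SparseLE d (fun n r => ∫ x, |sampleRemainder r m x| ∂(sampleLaw μ n))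
      fun n r => n * (n * r ^ d) ^ (2 * m) := by
  obtain ⟨C, hC, hweight⟩ := exists_integral_componentWeight_pow_le hA m one_ne_zero
  refine ⟨2 * C, by positivity, fun r hr => ?_⟩
  filter_upwards [hweight r hr] with n hn
  exact (integral_abs_sampleRemainder_le hm hn).trans_eq (by ring)

lemma sparseLE_variance_sampleRemainder (hA : HasBallBound μ A) (hm : 2 ≤ m) :
    SparseLE d (fun n r => variance (sampleRemainder r m) (sampleLaw μ n))
      fun n r => n * (n * r ^ d) ^ (2 * m) := by
  obtain ⟨C, hC, hweight⟩ := exists_integral_componentWeight_pow_le hA m two_ne_zero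
  refine ⟨4 * C, by positivity, fun r hr => ?_⟩
  filter_upwards [hweight r hr] with n hn
  exact (variance_sampleRemainder_le hm hn).trans_eq (by ring)

end ComponentMoments

section CrossPolytopeOrder

/-- The order of magnitude `n ^ (2 m) r ^ (d (2 m - 1))` of the expected number of cross-polytopes
on `2 m` vertices in the sparse regime; `m` is taken to be positive. -/
def countScale (d m n : ℕ) (r : ℝ) : ℝ := (n : ℝ) ^ (2 * m) * r ^ (d * (2 * m - 1))

variable {d m : ℕ}

lemma mul_mul_pow_eq_countScale_mul (hm : 1 ≤ m) (n : ℕ) (r : ℝ) :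
    n * (n * r ^ d) ^ (2 * m) = countScale d m n r * (n * r ^ d) := by
  obtain ⟨q, hq⟩ : ∃ q, 2 * m = q + 1 := ⟨2 * m - 1, by omega⟩
  rw [countScale, hq, Nat.add_sub_cancel, mul_pow, ← pow_mul, mul_add, pow_add r]
  ring

section BallBound

variable {A : ℝ} {μ : Measure (EuclideanSpace ℝ (Fin d))} (hA : HasBallBound μ A)
include hA

lemma HasBallBound.measure_closedBall_four_mul_le {r : ℝ} (hr : 0 ≤ r)
    (a : EuclideanSpace ℝ (Fin d)) :
    μ (Metric.closedBall a (4 * r)) ≤ ENNReal.ofReal (A * 4 ^ d * r ^ d) := by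
  simpa only [mul_pow, mul_assoc] using hA.2 a (4 * r) (by positivity)

variable [IsProbabilityMeasure μ]

lemma sparseLE_dependencyError (hm : 2 ≤ m) :
    SparseLE d (fun n r => dependencyError (sampleLaw μ n) (Finset.univ.powersetCard (2 * m))
      (crossIndicator r m) Overlap) fun n r => n * (n * r ^ d) ^ (2 * m) := by
  have hA0 := hA.1
  refine ⟨2 ^ (2 * m) * (4 * m) * (A * 4 ^ d) ^ (2 * m) + 1, by positivity, fun r hr => ?_⟩
  have hdegree : Tendsto (fun n : ℕ => n * (A * 4 ^ d * r n ^ d)) atTop (𝓝 0) := by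
    simpa only [mul_zero, mul_left_comm] using hr.tendsto_mul_pow_zero.const_mul (A * 4 ^ d)
  filter_upwards [hdegree.eventually_le_const one_pos, eventually_ge_atTop 1] with n hn hn1
  have hrn := (hr.pos n).le
  calc dependencyError (sampleLaw μ n) (Finset.univ.powersetCard (2 * m))
        (crossIndicator (r n) m) Overlap
      ≤ 2 ^ (2 * m) * (4 * m) * (n * (n * (A * 4 ^ d * r n ^ d)) ^ (2 * m)) :=
        dependencyError_crossIndicator_le (by positivity)
          (hA.measure_closedBall_four_mul_le hrn) hm hn hn1
    _ = 2 ^ (2 * m) * (4 * m) * (A * 4 ^ d) ^ (2 * m) * (n * (n * r n ^ d) ^ (2 * m)) := by ring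
    _ ≤ _ := mul_le_mul_of_nonneg_right (lt_add_one _).le (by positivity)

lemma sparseLE_meanCount_countScale (hm : 2 ≤ m) :
    SparseLE d (fun n r => meanCount μ n m r) (countScale d m) := by
  have hA0 := hA.1
  refine ⟨(A * 4 ^ d) ^ (2 * m - 1) + 1, by positivity, fun r hr =>
    Eventually.of_forall fun n => ?_⟩
  have hrn := (hr.pos n).le
  calc meanCount μ n m (r n) ≤ n ^ (2 * m) * (A * 4 ^ d * r n ^ d) ^ (2 * m - 1) :=
        meanCount_le (by positivity) (hA.measure_closedBall_four_mul_le hrn) hm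
    _ = (A * 4 ^ d) ^ (2 * m - 1) * countScale d m n (r n) := by
        rw [countScale, mul_pow, ← pow_mul]
        ring
    _ ≤ _ := mul_le_mul_of_nonneg_right (lt_add_one _).le
        (mul_nonneg (by positivity) (pow_nonneg hrn _))

end BallBound

variable {f : EuclideanSpace ℝ (Fin d) → ℝ} {M : ℝ} (hf : IsBoundedDensity f M) (hd : 2 ≤ d)
include hf hd

lemma sparseLE_countScale_meanCount (hm : 1 ≤ m) :
    SparseLE d (countScale d m) fun n r => meanCount (densityMeasure f) n m r := by
  have := hf.isProbabilityMeasure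
  obtain ⟨c, hc, hcross⟩ := hf.exists_le_integral_crossIndicator hd hm
  let c' : ℝ := (1 / 2) ^ (2 * m) / (2 * m).factorial * c
  have hc' : 0 < c' := by positivity
  refine ⟨c'⁻¹, by positivity, fun r hr => ?_⟩
  have hr0 := tendsto_nhdsWithin_iff.2 ⟨hr.tendsto_zero, Eventually.of_forall hr.pos⟩
  filter_upwards [hr0.eventually hcross, eventually_ge_atTop (4 * m)] with n hn hnm
  rw [le_inv_mul_iff₀ hc']
  calc c' * countScale d m n (r n)
      = (n / 2 : ℝ) ^ (2 * m) / (2 * m).factorial * (c * r n ^ (d * (2 * m - 1))) := by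
        simp only [c', countScale]
        ring
    _ ≤ meanCount (densityMeasure f) n m (r n) :=
        le_meanCount (mul_nonneg hc.le (pow_nonneg (hr.pos n).le _)) hnm (hn n)

theorem exists_hasRelativeError (hm : 2 ≤ m) :
    ∃ C : ℝ, 0 < C ∧ ∀ r, IsSparseRadius d r → ∀ᶠ n : ℕ in atTop,
      HasRelativeError (densityMeasure f) n m (r n) (C * (n * r n ^ d)) := by
  have := hf.isProbabilityMeasure
  have hscale : SparseLE d (fun n r => n * (n * r ^ d) ^ (2 * m))
      fun n r => meanCount (densityMeasure f) n m r * (n * r ^ d) := by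
    simpa only [mul_mul_pow_eq_countScale_mul (one_le_two.trans hm)] using
      (sparseLE_countScale_meanCount hf hd (one_le_two.trans hm)).mul_right
        fun n r hr => mul_nonneg n.cast_nonneg (pow_nonneg hr.le d)
  obtain ⟨C₁, hC₁, hmean⟩ :=
    (sparseLE_integral_abs_sampleRemainder hf.hasBallBound hm).trans hscale
  obtain ⟨C₂, hC₂, hvariance⟩ := (sparseLE_variance_sampleRemainder hf.hasBallBound hm).trans hscale
  obtain ⟨C₃, hC₃, hdependency⟩ := (sparseLE_dependencyError hf.hasBallBound hm).trans hscale
  refine ⟨C₁ + C₂ + C₃, by positivity, fun r hr => ?_⟩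
  filter_upwards [hmean r hr, hvariance r hr, hdependency r hr] with n h₁ h₂ h₃
  have hpos : 0 ≤ meanCount (densityMeasure f) n m (r n) * (n * r n ^ d) :=
    mul_nonneg (meanCount_nonneg _ _ _ _) (mul_nonneg n.cast_nonneg (pow_nonneg (hr.pos n).le d))
  have hle {C a : ℝ} (ha : a ≤ C * (meanCount (densityMeasure f) n m (r n) * (n * r n ^ d)))
      (hC : C ≤ C₁ + C₂ + C₃) :
      a ≤ (C₁ + C₂ + C₃) * (n * r n ^ d) * meanCount (densityMeasure f) n m (r n) :=
    (ha.trans (mul_le_mul_of_nonneg_right hC hpos)).trans_eq (by ring)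
  exact ⟨hle h₁ (by linarith), hle h₂ (by linarith), hle h₃ (by linarith)⟩

end CrossPolytopeOrder

end SparseRegime

section TotalVariation

lemma dTV_le {E : Type*} [TopologicalSpace E] [MeasurableSpace E] {μ ν : Measure E} {b : ℝ}
    (h : ∀ g : E → ℝ, Continuous g → (∀ y, |g y| ≤ 1) → |∫ y, g y ∂μ - ∫ y, g y ∂ν| ≤ b) :
    dTV μ ν ≤ b := by
  refine csSup_le ⟨_, 0, continuous_zero, fun _ => by simp, rfl⟩ ?_
  rintro _ ⟨g, hcont, hg, rfl⟩
  exact h g hcont hg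

variable {d m : ℕ} {f : EuclideanSpace ℝ (Fin d) → ℝ} {M : ℝ}

theorem exists_dTV_sampleBetti_poisson_le (hf : IsBoundedDensity f M) (hd : 2 ≤ d) (hm : 2 ≤ m) :
    ∃ c : ℝ, 0 < c ∧ ∀ r, IsSparseRadius d r → ∀ α : ℝ, 0 < α →
      Tendsto (fun n => countScale d m n (r n)) atTop (𝓝 α) → ∀ᶠ n : ℕ in atTop,
        dTV ((sampleLaw (densityMeasure f) n).map (sampleBetti (r n) m)) (poissonMeasure
          (∫ x, (sampleBetti (r n) m x : ℝ) ∂(sampleLaw (densityMeasure f) n)).toNNReal) ≤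
        c * α * (n * r n ^ d) := by
  have := hf.isProbabilityMeasure
  obtain ⟨C, hC, herror⟩ := exists_hasRelativeError hf hd hm
  obtain ⟨C', hC', hmean⟩ := sparseLE_meanCount_countScale hf.hasBallBound hm
  obtain ⟨C'', hC'', hscale⟩ := sparseLE_countScale_meanCount hf hd (one_le_two.trans hm)
  refine ⟨12 * C * C', by positivity, fun r hr α hα h => ?_⟩
  filter_upwards [herror r hr, hmean r hr, hscale r hr, h.eventually_const_lt hα,
    h.eventually_le_const (lt_two_mul_self hα)] with n hn hmean_le hle_mean hpos hle
  have hmean_pos : 0 < meanCount (densityMeasure f) n m (r n) :=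
    pos_of_mul_pos_right (hpos.trans_le hle_mean) hC''.le
  have hδ : 0 ≤ C * (n * r n ^ d) :=
    mul_nonneg hC.le (mul_nonneg n.cast_nonneg (pow_nonneg (hr.pos n).le d))
  refine dTV_le fun g hcont hg => ?_
  rw [integral_map (measurable_sampleBetti (r n) m).aemeasurable hcont.aestronglyMeasurable]
  calc _ ≤ 6 * (C * (n * r n ^ d) * meanCount (densityMeasure f) n m (r n)) :=
        hn.abs_integral_comp_sampleBetti_sub_poisson_le (one_le_two.trans hm) hmean_pos hg
    _ ≤ 6 * (C * (n * r n ^ d) * (C' * (2 * α))) := by gcongr; exact hmean_le.trans (by gcongr)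
    _ = 12 * C * C' * α * (n * r n ^ d) := by ring

end TotalVariation

section Sample

variable {Ω Ω' : Type*} [MeasurableSpace Ω] [MeasurableSpace Ω'] {P : Measure Ω} {Q : Measure Ω'}

lemma identDistrib_standardize {X : Ω → ℝ} {Y : Ω' → ℝ} (h : IdentDistrib X Y P Q) :
    IdentDistrib (standardize P X) (standardize Q Y) P Q := by
  unfold standardize
  rw [h.integral_eq, h.variance_eq]
  exact h.comp ((measurable_id.sub_const _).div_const _)

lemma tendstoInDistribution_of_identDistrib {E ι : Type*} [TopologicalSpace E] [MeasurableSpace E]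
    [OpensMeasurableSpace E] {l : Filter ι} {Ω₁ Ω₂ : ι → Type*} {Ω₃ : Type*}
    [∀ i, MeasurableSpace (Ω₁ i)] [∀ i, MeasurableSpace (Ω₂ i)] [MeasurableSpace Ω₃]
    {P₁ : (i : ι) → Measure (Ω₁ i)} [∀ i, IsProbabilityMeasure (P₁ i)]
    {P₂ : (i : ι) → Measure (Ω₂ i)} [∀ i, IsProbabilityMeasure (P₂ i)]
    {P₃ : Measure Ω₃} [IsProbabilityMeasure P₃] {X : (i : ι) → Ω₁ i → E} {Y : (i : ι) → Ω₂ i → E}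
    {Z : Ω₃ → E} (h : ∀ i, IdentDistrib (X i) (Y i) (P₁ i) (P₂ i))
    (hY : TendstoInDistribution Y l Z P₂ P₃) : TendstoInDistribution X l Z P₁ P₃ :=
  ⟨fun i => (h i).aemeasurable_fst, hY.aemeasurable_limit,
    hY.tendsto.congr fun i => Subtype.ext (h i).map_eq.symm⟩

variable {d n k : ℕ} [IsProbabilityMeasure P] {X : Fin n → Ω → EuclideanSpace ℝ (Fin d)}
  {f : EuclideanSpace ℝ (Fin d) → ℝ}

lemma IsIIDSample.identDistrib_id (hX : IsIIDSample P X f) :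
    IdentDistrib (fun ω i => X i ω) id P (sampleLaw (densityMeasure f) n) where
  aemeasurable_fst := (measurable_pi_lambda _ hX.measurable).aemeasurable
  aemeasurable_snd := aemeasurable_id
  map_eq := by
    rw [(iIndepFun_iff_map_fun_eq_pi_map fun i => (hX.measurable i).aemeasurable).1 hX.indep,
      Measure.map_id]
    exact congrArg Measure.pi (funext hX.law)

lemma IsIIDSample.identDistrib_randomBetti (hX : IsIIDSample P X f) (hk : 1 ≤ k) (r : ℝ) :
    IdentDistrib (randomBetti X r k) (sampleBetti r (k + 1)) P
      (sampleLaw (densityMeasure f) n) := by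
  have hbetti : randomBetti X r k = sampleBetti r (k + 1) ∘ fun ω i => X i ω :=
    funext fun _ => betti_cliqueComplex _ hk
  rw [hbetti]
  exact hX.identDistrib_id.comp (measurable_sampleBetti r (k + 1))

lemma IsIIDSample.identDistrib_natCast_randomBetti (hX : IsIIDSample P X f) (hk : 1 ≤ k) (r : ℝ) :
    IdentDistrib (fun ω => (randomBetti X r k ω : ℝ)) (fun x => (sampleBetti r (k + 1) x : ℝ)) P
      (sampleLaw (densityMeasure f) n) :=
  (hX.identDistrib_randomBetti hk r).comp (measurable_of_countable fun j : ℕ => (j : ℝ))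

end Sample

end RandomRips

end

theorem theorem4 (d k : ℕ) (hd : 2 ≤ d) (hk : 1 ≤ k)
    (f : EuclideanSpace ℝ (Fin d) → ℝ) (hf_meas : Measurable f) (hf_nonneg : ∀ x, 0 ≤ f x)
    (hf_bdd : ∃ M : ℝ, ∀ x, f x ≤ M) (hf_int : ∫ x, f x = 1) :
    ∃ c : ℝ, 0 < c ∧
      ∀ (Ω : ℕ → Type*) [∀ n, MeasurableSpace (Ω n)] (P : (n : ℕ) → Measure (Ω n))
        [∀ n, IsProbabilityMeasure (P n)]
        (X : (n : ℕ) → Fin n → Ω n → EuclideanSpace ℝ (Fin d))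
        (_hX : ∀ n, RandomRips.IsIIDSample (P n) (X n) f)
        (ε : ℝ) (_hε : 0 < ε) (r : ℕ → ℝ) (_hr_pos : ∀ n, 0 < r n)
        (_hr : r =O[atTop] fun n : ℕ => (n : ℝ) ^ (-(1 / (d : ℝ)) - ε)),
        -- vanishing regime
        (Tendsto (fun n : ℕ => (n : ℝ) ^ (2 * k + 2) * r n ^ (d * (2 * k + 1))) atTop (𝓝 0) →
          Tendsto (fun n => P n {ω | RandomRips.randomBetti (X n) (r n) k ω = 0}) atTop (𝓝 1)) ∧
        -- Poisson regime
        (∀ α : ℝ, 0 < α →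
          Tendsto (fun n : ℕ => (n : ℝ) ^ (2 * k + 2) * r n ^ (d * (2 * k + 1))) atTop (𝓝 α) →
          ∀ᶠ n : ℕ in atTop,
            RandomRips.dTV ((P n).map (RandomRips.randomBetti (X n) (r n) k))
              (poissonMeasure
                (∫ ω, (RandomRips.randomBetti (X n) (r n) k ω : ℝ) ∂(P n)).toNNReal) ≤
              c * α * (n * r n ^ d)) ∧
        -- normal regime
        (Tendsto (fun n : ℕ => (n : ℝ) ^ (2 * k + 2) * r n ^ (d * (2 * k + 1))) atTop atTop →
          TendstoInDistribution
            (fun n ω => ((RandomRips.randomBetti (X n) (r n) k ω : ℝ)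
                - ∫ ω', (RandomRips.randomBetti (X n) (r n) k ω' : ℝ) ∂(P n)) /
              Real.sqrt (variance (fun ω' => (RandomRips.randomBetti (X n) (r n) k ω' : ℝ)) (P n)))
            atTop (id : ℝ → ℝ) P (gaussianReal 0 1)) := by
  obtain ⟨M, hM⟩ := hf_bdd
  have hf : RandomRips.IsBoundedDensity f M := ⟨hf_meas, hf_nonneg, hM, hf_int⟩
  have := hf.isProbabilityMeasure
  have hm : 2 ≤ k + 1 := by omega
  obtain ⟨C, -, herror⟩ := RandomRips.exists_hasRelativeError hf hd hm
  have hmean_le := RandomRips.sparseLE_meanCount_countScale hf.hasBallBound hm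
  have hle_mean := RandomRips.sparseLE_countScale_meanCount hf hd (one_le_two.trans hm)
  obtain ⟨c, hc, hpoisson⟩ := RandomRips.exists_dTV_sampleBetti_poisson_le hf hd hm
  refine ⟨c, hc, fun Ω _ P _ X hX ε hε r hr_pos hr => ?_⟩
  have hsparse := RandomRips.isSparseRadius_of_isBigO (by omega) hε hr_pos hr
  have hbetti := fun n => (hX n).identDistrib_randomBetti hk (r n)
  have hbetti_cast := fun n => (hX n).identDistrib_natCast_randomBetti hk (r n)
  have hδ : Tendsto (fun n : ℕ => C * (n * r n ^ d)) atTop (𝓝 0) := by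
    simpa using hsparse.tendsto_mul_pow_zero.const_mul C
  refine ⟨fun h => ?_, fun α hα h => ?_, fun h => ?_⟩
  · refine (RandomRips.tendsto_measure_sampleBetti_eq_zero (herror r hsparse) hδ
      (hmean_le.tendsto_zero hsparse (fun n => RandomRips.meanCount_nonneg _ _ _ _) h)).congr
      fun n => ((hbetti n).measure_mem_eq (measurableSet_singleton 0)).symm
  · simpa only [(hbetti _).map_eq, (hbetti_cast _).integral_eq] using hpoisson r hsparse α hα h
  · exact RandomRips.tendstoInDistribution_of_identDistrib
      (fun n => RandomRips.identDistrib_standardize (hbetti_cast n))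
      (RandomRips.tendstoInDistribution_standardize_sampleBetti (herror r hsparse) hδ
        (one_le_two.trans hm) (hle_mean.tendsto_atTop hsparse h))
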